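/- Let $F$ be a field. All groups below except $\tilde G_4(F)$ are tensored with $\mathbb Q$; $F^*_{\mathbb Q}=F^*\otimes\mathbb Q$, written additively in tensor and exterior products. Put $$r(x_1,x_2,x_3,x_4)=\frac{\Delta(x_1,x_3)\Delta(x_2,x_4)}{\Delta(x_1,x_4)\Delta(x_2,x_3)},\qquad r_3(x_1,\dots,x_6)=\frac1{15}\,\mathrm{Alt}_6\Big\{\frac{\Delta(x_1,x_2,x_4)\Delta(x_2,x_3,x_5)\Delta(x_3,x_1,x_6)}{\Delta(x_1,x_2,x_5)\Delta(x_2,x_3,x_6)\Delta(x_3,x_1,x_4)}\Big\},$$ where $\Delta$ is the determinant of vectors representing the points and $\mathrm{Alt}_n f(x_1,\dots,x_n)=\sum_{\sigma\in S_n}(-1)^{|\sigma|}f(x_{\sigma(1)},\dots,x_{\sigma(n)})$. A bar $(l|x_1,x_2,\dots)$ denotes projection of the points $x_i$ with center $l$ (or with center the span of the points before the bar). $B_2(F)$ is $\mathbb Q[F^*\setminus\{1\}]$ modulo the five-term relations $\sum_{i=1}^5(-1)^i\{r(x_1,\dots,\hat x_i,\dots,x_5)\}$ for distinct $x_i\in\mathbb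 P^1(F)$. $B_3(F)$ is $\mathbb Q[F^*]$ modulo $\{x\}-\{x^{-1}\}$ ($x\in F^*$), the seven-term relations $\sum_{i=1}^7(-1)^i r_3(x_1,\dots,\hat x_i,\dots,x_7)$ for $7$ generic points of $\mathbb P^2(F)$, and, for $x,y\in F^*\setminus\{1\}$, the Kummer relations $$-\Big\{\tfrac{x(1-y)^2}{y(1-x)^2}\Big\}-\{xy\}-\Big\{\tfrac xy\Big\}-2\{1\}+2\Big(\Big\{\tfrac{-x(1-y)}{1-x}\Big\}+\Big\{\tfrac{x(1-y)}{y(1-x)}\Big\}+\Big\{\tfrac{-y(1-x)}{1-y}\Big\}+\Big\{\tfrac{1-x}{1-y}\Big\}+\{y\}+\{x\}\Big).$$ The image of $\{x\}$ in $B_n(F)$ is $\{x\}_n$, and $\{1\}_2:=0$. For $3+3$ distinct points of a line let $\mu_3(x_1,x_2,x_3;y_1,y_2,y_3)=\frac14\mathrm{Alt}_{(x_1,x_2,x_3)(y_1,y_2,y_3)}\big(\{r(x_1,y_2,x_2,y_1)\}_3-\{r(x_1,y_1,x_2,y_2)\}_3\big)$. For a pair $(L;M)=(l_0,\dots,l_3;m_0,\dots,m_3)$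 of tetrahedra in $\mathbb P^3(F)$ with all $8$ points in generic position let $$a_3(L;M)=\sum_{i,j=0}^3(-1)^{i+j}\Big(\tfrac16\,r_3(l_i|l_0,..,\hat l_i,..,l_3,m_0,..,\hat m_j,..,m_3)-\tfrac13\,\mu_3(l_i,m_j|l_0,..,\hat l_i,..,l_3;m_0,..,\hat m_j,..,m_3)\Big)\in B_3(F).$$ $\tilde G_4(F)$ is the free abelian group generated by $8$-tuples $(l_1,\dots,l_8)$ of points in generic position in $\mathbb P^3(F)$ modulo: (1) $(l_1,\dots,l_8)=(gl_1,\dots,gl_8)$ for $g\in PGL_4(F)$; (2) $(l_1,\dots,l_8)=(-1)^{|\sigma|}(l_{\sigma(1)},\dots,l_{\sigma(8)})$ for $\sigma\in S_8$; (3) $\sum_{i=0}^8(-1)^i(l_0,\dots,\hat l_i,\dots,l_8)=0$ for $9$ generic points of $\mathbb P^3(F)$; (4) $\sum_{i=0}^8(-1)^i(l_i|l_0,\dots,\hat l_i,\dots,l_8)=0$ for $9$ generic points of $\mathbb P^4(F)$. **Theorem.** a) Choose a volume form on $F^4$ and vectors representing $l_1,\dots,l_8$, and put $$\delta_{3,1}(l_1,\dots,l_8)=\mathrm{Alt}_8\big((l_1,l_2,l_3,l_4;l_5,l_6,l_7,l_8)\otimes\Delta(l_5,l_6,l_7,l_8)\big),$$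 $$\delta_{1,3}(l_1,\dots,l_8)=-\mathrm{Alt}_8\big(\Delta(l_1,l_2,l_3,l_4)\otimes(l_1,l_2,l_3,l_4;l_5,l_6,l_7,l_8)\big),$$ $$\delta_{2,2}(l_1,\dots,l_8)=-\tfrac{144}{7}\,\mathrm{Alt}_8\big(\{r(l_1,l_2|l_3,l_4,l_5,l_6)\}_2\wedge\{r(l_3,l_4|l_1,l_2,l_5,l_7)\}_2\big).$$ Then $\delta=\big((a_3\otimes\mathrm{id})\,\delta_{3,1}-(\mathrm{id}\otimes a_3)\,\delta_{1,3},\ \delta_{2,2}\big)$, where $F^*\otimes B_3(F)$ is identified with $B_3(F)\otimes F^*$ by exchanging the factors, does not depend on the choices and sends the relations (1)–(4) to zero, so it is a well-defined homomorphism $$\delta:\tilde G_4(F)\longrightarrow B_3(F)\otimes F^*_{\mathbb Q}\ \oplus\ \Lambda^2B_2(F).$$ b) There is a well-defined linear map $B_3(F)\otimes F^*_{\mathbb Q}\oplus\Lambda^2B_2(F)\to B_2(F)\otimes\Lambda^2F^*_{\mathbb Q}$ with $\{x\}_3\otimes y\mapsto\{x\}_2\otimes x\wedge y$ for $x,y\in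 F^*$ and $\{x\}_2\wedge\{y\}_2\mapsto\{y\}_2\otimes(1-x)\wedge x-\{x\}_2\otimes(1-y)\wedge y$ for $x,y\in F^*\setminus\{1\}$, and its composition with $\delta$ is zero. -/

import Mathlib

open scoped TensorProduct LinearAlgebra.Projectivization

noncomputable section

namespace Tetralog

open Classical in
/-- The symbol `{x}` in `ℚ[F* ∖ {1}]` (zero when `x` is `0` or `1`). -/
def pre2 {F : Type*} [Field F] (x : F) : {x : F // x ≠ 0 ∧ x ≠ 1} →₀ ℚ :=
  if h : x ≠ 0 ∧ x ≠ 1 then Finsupp.single ⟨x, h⟩ 1 else 0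

open Classical in
/-- The symbol `{x}` in `ℚ[F*]` (zero when `x = 0`; the symbol `{1}` is a generator). -/
def pre3 {F : Type*} [Field F] (x : F) : Fˣ →₀ ℚ :=
  if h : x ≠ 0 then Finsupp.single (Units.mk0 x h) 1 else 0

/-- `F* ⊗ ℚ`, written additively. -/
abbrev MultQ (F : Type*) [Field F] : Type _ := ℚ ⊗[ℤ] Additive Fˣ

open Classical in
/-- The class of `x ∈ F*` in `F* ⊗ ℚ` (zero when `x = 0`). -/
def unitClass {F : Type*} [Field F] (x : F) : MultQ F :=
  if h : x ≠ 0 then (1 : ℚ) ⊗ₜ[ℤ] Additive.ofMul (Units.mk0 x h) else 0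

/-- `a ∧ b` in the exterior square `Λ² M`. -/
def wedge {M : Type*} [AddCommGroup M] [Module ℚ M] (a b : M) : ⋀[ℚ]^2 M :=
  exteriorPower.ιMulti ℚ 2 ![a, b]

/-- Vectors in general position in `Fⁿ`: any `n` of them are linearly independent. -/
def GenericVectors {F : Type*} [Field F] {n m : ℕ} (v : Fin m → (Fin n → F)) : Prop :=
  ∀ s : Fin n ↪ Fin m, LinearIndependent F (v ∘ s)

/-- The standard volume form on `Fⁿ`. -/
def stdVol (F : Type*) [Field F] (n : ℕ) : (Fin n → F) [⋀^Fin n]→ₗ[F] F :=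
  Matrix.detRowAlternating

/-! ### Cross-ratios

If `ω` is a volume form on `V` then `ω.curryLeft l` is, up to the choice of a scalar, the pull-back
to `V` of a volume form on `V / ⟨l⟩`. So a configuration `(l | x₁, …, x_k)`, obtained by projection
with center `l`, is dealt with by using the vectors `x₁, …, x_k` of `V` together with the form
`ω.curryLeft l`, i.e. the determinants `Δ(l, x_i, x_j, …)`. -/

/-- `r(x₁,x₂,x₃,x₄) = Δ(x₁,x₃) Δ(x₂,x₄) / (Δ(x₁,x₄) Δ(x₂,x₃))`. -/
def crossRatio {F V : Type*} [Field F] [AddCommGroup V] [Module F V]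
    (ω : V [⋀^Fin 2]→ₗ[F] F) (x : Fin 4 → V) : F :=
  (ω ![x 0, x 2] * ω ![x 1, x 3]) / (ω ![x 0, x 3] * ω ![x 1, x 2])

/-- `Δ(x₁,x₂,x₄) Δ(x₂,x₃,x₅) Δ(x₃,x₁,x₆) / (Δ(x₁,x₂,x₅) Δ(x₂,x₃,x₆) Δ(x₃,x₁,x₄))`. -/
def tripleRatio {F V : Type*} [Field F] [AddCommGroup V] [Module F V]
    (ω : V [⋀^Fin 3]→ₗ[F] F) (x : Fin 6 → V) : F :=
  (ω ![x 0, x 1, x 3] * ω ![x 1, x 2, x 4] * ω ![x 2, x 0, x 5]) /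
    (ω ![x 0, x 1, x 4] * ω ![x 1, x 2, x 5] * ω ![x 2, x 0, x 3])

/-- The generalized cross-ratio `r₃` of six points of the plane, as an element of `ℚ[F*]`. -/
def preR3 {F V : Type*} [Field F] [AddCommGroup V] [Module F V]
    (ω : V [⋀^Fin 3]→ₗ[F] F) (x : Fin 6 → V) : Fˣ →₀ ℚ :=
  (1 / 15 : ℚ) • ∑ σ : Equiv.Perm (Fin 6),
    ((Equiv.Perm.sign σ : ℤ) : ℚ) • pre3 (tripleRatio ω (x ∘ σ))

/-! ### The groups `B₂(F)` and `B₃(F)`, tensored with `ℚ` -/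

/-- The five-term relations. -/
def R2 (F : Type*) [Field F] : Submodule ℚ ({x : F // x ≠ 0 ∧ x ≠ 1} →₀ ℚ) :=
  Submodule.span ℚ
    {z | ∃ x : Fin 5 → (Fin 2 → F), GenericVectors x ∧
      z = ∑ i : Fin 5, (-1 : ℚ) ^ (i : ℕ) • pre2 (crossRatio (stdVol F 2) (x ∘ i.succAbove))}

/-- `B₂(F) ⊗ ℚ`. -/
abbrev B2 (F : Type*) [Field F] : Type _ := ({x : F // x ≠ 0 ∧ x ≠ 1} →₀ ℚ) ⧸ R2 F

/-- `{x}₂`. -/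
def sym2 {F : Type*} [Field F] (x : F) : B2 F := (R2 F).mkQ (pre2 x)

/-- Kummer's relation `K(x, y)`. -/
def kummer {F : Type*} [Field F] (x y : F) : Fˣ →₀ ℚ :=
  - pre3 (x * (1 - y) ^ 2 / (y * (1 - x) ^ 2)) - pre3 (x * y) - pre3 (x / y)
    - (2 : ℚ) • pre3 (1 : F)
    + (2 : ℚ) • (pre3 (-x * (1 - y) / (1 - x)) + pre3 (x * (1 - y) / (y * (1 - x)))
      + pre3 (-y * (1 - x) / (1 - y)) + pre3 ((1 - x) / (1 - y)) + pre3 y + pre3 x)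

/-- The relations of `B₃(F)`: inversion, the seven-term relations for generic points of the plane,
and Kummer's relations. -/
def R3 (F : Type*) [Field F] : Submodule ℚ (Fˣ →₀ ℚ) :=
  Submodule.span ℚ
    ({z | ∃ x : F, x ≠ 0 ∧ z = pre3 x - pre3 x⁻¹} ∪
     {z | ∃ x : Fin 7 → (Fin 3 → F), GenericVectors x ∧
       z = ∑ i : Fin 7, (-1 : ℚ) ^ (i : ℕ) • preR3 (stdVol F 3) (x ∘ i.succAbove)} ∪
     {z | ∃ x y : F, x ≠ 0 ∧ x ≠ 1 ∧ y ≠ 0 ∧ y ≠ 1 ∧ z = kummer x y})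

/-- `B₃(F) ⊗ ℚ`. -/
abbrev B3 (F : Type*) [Field F] : Type _ := (Fˣ →₀ ℚ) ⧸ R3 F

/-- `{x}₃`. -/
def sym3 {F : Type*} [Field F] (x : F) : B3 F := (R3 F).mkQ (pre3 x)

/-- `r₃(x₁, …, x₆)` in `B₃(F) ⊗ ℚ`. -/
def r3 {F V : Type*} [Field F] [AddCommGroup V] [Module F V]
    (ω : V [⋀^Fin 3]→ₗ[F] F) (x : Fin 6 → V) : B3 F := (R3 F).mkQ (preR3 ω x)

/-- `μ₃(x₁,x₂,x₃; y₁,y₂,y₃)` for six points of a line. -/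
def mu3 {F V : Type*} [Field F] [AddCommGroup V] [Module F V]
    (ω : V [⋀^Fin 2]→ₗ[F] F) (x y : Fin 3 → V) : B3 F :=
  (1 / 4 : ℚ) • ∑ σ : Equiv.Perm (Fin 3), ∑ τ : Equiv.Perm (Fin 3),
    (((Equiv.Perm.sign σ : ℤ) : ℚ) * ((Equiv.Perm.sign τ : ℤ) : ℚ)) •
      (sym3 (crossRatio ω ![x (σ 0), y (τ 1), x (σ 1), y (τ 0)])
        - sym3 (crossRatio ω ![x (σ 0), y (τ 0), x (σ 1), y (τ 1)]))

/-! ### The map `a₃` -/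

/-- `a₃'(L; M) = ∑ (-1)^(i+j) r₃(l_i | l₀, …, l̂_i, …, l₃; m₀, …, m̂_j, …, m₃)`. -/
def a3' {F V : Type*} [Field F] [AddCommGroup V] [Module F V]
    (ω : V [⋀^Fin 4]→ₗ[F] F) (l m : Fin 4 → V) : B3 F :=
  ∑ i : Fin 4, ∑ j : Fin 4, (-1 : ℚ) ^ ((i : ℕ) + (j : ℕ)) •
    r3 (ω.curryLeft (l i))
      (Fin.append (l ∘ i.succAbove : Fin 3 → V) (m ∘ j.succAbove : Fin 3 → V))

/-- `a₃''(L; M) = ∑ (-1)^(i+j) μ₃(l_i, m_j | l₀, …, l̂_i, …, l₃; m₀, …, m̂_j, …, m₃)`. -/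
def a3'' {F V : Type*} [Field F] [AddCommGroup V] [Module F V]
    (ω : V [⋀^Fin 4]→ₗ[F] F) (l m : Fin 4 → V) : B3 F :=
  ∑ i : Fin 4, ∑ j : Fin 4, (-1 : ℚ) ^ ((i : ℕ) + (j : ℕ)) •
    mu3 ((ω.curryLeft (l i)).curryLeft (m j)) (l ∘ i.succAbove) (m ∘ j.succAbove)

/-- `a₃ = (1/6) a₃' - (1/3) a₃''`. -/
def a3Vec {F V : Type*} [Field F] [AddCommGroup V] [Module F V]
    (ω : V [⋀^Fin 4]→ₗ[F] F) (l m : Fin 4 → V) : B3 F :=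
  (1 / 6 : ℚ) • a3' ω l m - (1 / 3 : ℚ) • a3'' ω l m

/-! ### Generic configurations of points and the group `G̃₄(F)` -/

/-- Points in general position in `ℙⁿ⁻¹(F)`: any `n` of them are independent. -/
def GenericPoints {F : Type*} [Field F] {n m : ℕ} (p : Fin m → ℙ F (Fin n → F)) : Prop :=
  ∀ s : Fin n ↪ Fin m, Projectivization.Independent (p ∘ s)

/-- `m`-tuples of points in general position in `ℙⁿ⁻¹(F)`. -/
def Conf (F : Type*) [Field F] (n m : ℕ) : Type _ :=
  {p : Fin m → ℙ F (Fin n → F) // GenericPoints p}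

/-- `(l_{σ(1)}, …, l_{σ(m)})`. -/
def Conf.perm {F : Type*} [Field F] {n m : ℕ} (c : Conf F n m) (σ : Equiv.Perm (Fin m)) :
    Conf F n m :=
  ⟨c.1 ∘ σ, fun s => c.2 (s.trans σ.toEmbedding)⟩

/-- `y` is a projection of the tuple `x` of points of `ℙⁿ` to `ℙⁿ⁻¹` with center the point `q`. -/
def IsProjectionFrom {F : Type*} [Field F] {n m : ℕ} (q : ℙ F (Fin (n + 1) → F))
    (x : Fin m → ℙ F (Fin (n + 1) → F)) (y : Fin m → ℙ F (Fin n → F)) : Prop :=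
  ∃ π : (Fin (n + 1) → F) →ₗ[F] (Fin n → F), LinearMap.ker π = q.submodule ∧
    ∀ j, (y j).submodule = (x j).submodule.map π

/-- The defining relations of `G̃₄(F)`: projective invariance, skew symmetry, the nine-term
relation and the dual nine-term relation. -/
def relG4 (F : Type*) [Field F] : Submodule ℤ (Conf F 4 8 →₀ ℤ) :=
  Submodule.span ℤ
    ({z | ∃ (c c' : Conf F 4 8) (g : LinearMap.GeneralLinearGroup F (Fin 4 → F)),
        (∀ j, c'.1 j = g • c.1 j) ∧ z = Finsupp.single c 1 - Finsupp.single c' 1} ∪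
     {z | ∃ (c : Conf F 4 8) (σ : Equiv.Perm (Fin 8)),
        z = Finsupp.single c 1 - (Equiv.Perm.sign σ : ℤ) • Finsupp.single (c.perm σ) 1} ∪
     {z | ∃ (p : Conf F 4 9) (c : Fin 9 → Conf F 4 8), (∀ i, (c i).1 = p.1 ∘ i.succAbove) ∧
        z = ∑ i : Fin 9, (-1 : ℤ) ^ (i : ℕ) • Finsupp.single (c i) 1} ∪
     {z | ∃ (p : Conf F 5 9) (c : Fin 9 → Conf F 4 8),
        (∀ i, IsProjectionFrom (p.1 i) (p.1 ∘ i.succAbove) (c i).1) ∧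
        z = ∑ i : Fin 9, (-1 : ℤ) ^ (i : ℕ) • Finsupp.single (c i) 1})

/-- The group `G̃₄(F)`. -/
abbrev G4 (F : Type*) [Field F] : Type _ := (Conf F 4 8 →₀ ℤ) ⧸ relG4 F

/-- The generator `(l₁, …, l₈)` of `G̃₄(F)`. -/
def G4.mk {F : Type*} [Field F] (c : Conf F 4 8) : G4 F :=
  (relG4 F).mkQ (Finsupp.single c 1)

/-! ### The cobracket -/

/-- The `ℚ`-vector space with basis the pairs of tetrahedra `(l₁,l₂,l₃,l₄; l₅,l₆,l₇,l₈)` in generic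
position in `ℙ³(F)`. -/
abbrev TetraPairs (F : Type*) [Field F] : Type _ := Conf F 4 8 →₀ ℚ

/-- `a₃` as a linear map on pairs of tetrahedra (it does not depend on the vectors which represent
the points). -/
def a3 (F : Type*) [Field F] : TetraPairs F →ₗ[ℚ] B3 F :=
  Finsupp.linearCombination ℚ fun c : Conf F 4 8 =>
    a3Vec (stdVol F 4) (fun k : Fin 4 => (c.1 (Fin.castAdd 4 k)).rep)
      (fun k : Fin 4 => (c.1 (Fin.natAdd 4 k)).rep)

/-- `δ₃,₁(l₁,…,l₈) = Alt₈ ((l₁,l₂,l₃,l₄; l₅,l₆,l₇,l₈) ⊗ Δ(l₅,l₆,l₇,l₈))`; here `v` are vectors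
which represent the points of `c`, and `ω` is a volume form. -/
def delta31 {F : Type*} [Field F] (ω : (Fin 4 → F) [⋀^Fin 4]→ₗ[F] F)
    (v : Fin 8 → (Fin 4 → F)) (c : Conf F 4 8) : TetraPairs F ⊗[ℚ] MultQ F :=
  ∑ σ : Equiv.Perm (Fin 8), ((Equiv.Perm.sign σ : ℤ) : ℚ) •
    (Finsupp.single (c.perm σ) (1 : ℚ) ⊗ₜ[ℚ]
      unitClass (ω ![v (σ 4), v (σ 5), v (σ 6), v (σ 7)]))

/-- `δ₁,₃(l₁,…,l₈) = - Alt₈ (Δ(l₁,l₂,l₃,l₄) ⊗ (l₁,l₂,l₃,l₄; l₅,l₆,l₇,l₈))`. -/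
def delta13 {F : Type*} [Field F] (ω : (Fin 4 → F) [⋀^Fin 4]→ₗ[F] F)
    (v : Fin 8 → (Fin 4 → F)) (c : Conf F 4 8) : MultQ F ⊗[ℚ] TetraPairs F :=
  - ∑ σ : Equiv.Perm (Fin 8), ((Equiv.Perm.sign σ : ℤ) : ℚ) •
    (unitClass (ω ![v (σ 0), v (σ 1), v (σ 2), v (σ 3)]) ⊗ₜ[ℚ]
      Finsupp.single (c.perm σ) (1 : ℚ))

/-- `(a, b | x₁, x₂, x₃, x₄)₂`: the class in `B₂(F) ⊗ ℚ` of the cross-ratio of the projection of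
four points of `ℙ³` to a line with center the line through `a` and `b`. -/
def projSym2 {F V : Type*} [Field F] [AddCommGroup V] [Module F V]
    (ω : V [⋀^Fin 4]→ₗ[F] F) (a b : V) (x : Fin 4 → V) : B2 F :=
  sym2 (crossRatio ((ω.curryLeft a).curryLeft b) x)

/-- `δ₂,₂(l₁,…,l₈) = -(144/7) Alt₈ ((l₁,l₂|l₃,l₄,l₅,l₆)₂ ∧ (l₃,l₄|l₁,l₂,l₅,l₇)₂)`. -/
def delta22 {F : Type*} [Field F] (ω : (Fin 4 → F) [⋀^Fin 4]→ₗ[F] F)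
    (v : Fin 8 → (Fin 4 → F)) : ⋀[ℚ]^2 (B2 F) :=
  (-144 / 7 : ℚ) • ∑ σ : Equiv.Perm (Fin 8), ((Equiv.Perm.sign σ : ℤ) : ℚ) •
    wedge (projSym2 ω (v (σ 0)) (v (σ 1)) ![v (σ 2), v (σ 3), v (σ 4), v (σ 5)])
      (projSym2 ω (v (σ 2)) (v (σ 3)) ![v (σ 0), v (σ 1), v (σ 4), v (σ 6)])

/-- The target `(B₃(F) ⊗ F* ⊕ Λ² B₂(F)) ⊗ ℚ` of the cobracket in degree `4`. -/
abbrev Target (F : Type*) [Field F] : Type _ := (B3 F ⊗[ℚ] MultQ F) × ⋀[ℚ]^2 (B2 F)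

/-- The map `(a₃ ⊗ id - id ⊗ a₃, id)`, where `F* ⊗ B₃(F)` is identified with `B₃(F) ⊗ F*` by
exchanging the factors, applied to `(x, y, z)`. -/
def throughA3 {F : Type*} [Field F] (x : TetraPairs F ⊗[ℚ] MultQ F)
    (y : MultQ F ⊗[ℚ] TetraPairs F) (z : ⋀[ℚ]^2 (B2 F)) : Target F :=
  (TensorProduct.map (a3 F) LinearMap.id x
    - TensorProduct.comm ℚ (MultQ F) (B3 F) (TensorProduct.map LinearMap.id (a3 F) y), z)

end Tetralog

end

/-!
Every expression in the statement is an alternating sum over the permutations of indices of points,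
of terms which depend on a tuple of indices (the arguments of a cross-ratio or of `r₃`, with the
centres of the projection in front) and on sets of indices (the determinants `Δ(I)`; their order
does not matter, as the class of `-1` in `F* ⊗ ℚ` is zero). Three facts about such sums (`altSum`)
do most of the work: relabelling the indices multiplies the sum by a sign (`altSum_relabel`), a sum
vanishes if an odd permutation fixes its terms, for instance if two indices do not occur
(`altSum_eq_zero_of_fixed`), and the alternating sum of the sums obtained by omitting one point is
an alternating sum over all points (`sum_altSum_succAbove`). What remains are functional equations
of the terms. These are the five-term relation for `B₂`, the seven-term relation for `B₃`, and their
duals, in which a point in turn becomes the centre of projection (`dual_five_term`,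
`dual_seven_term`): Gale duality (`exists_gale_dual`, from Jacobi's identity for complementary
minors) turns them into the original relations. The skew symmetry of `{r}₂` comes from
`{x}₂ + {1/x}₂ = 0` and `{x}₂ + {1 - x}₂ = 0`, which the five-term relations imply as soon as `F`
has four elements.

For the homomorphism `δ`, the sums over the vertices in `a₃` and over the permutations in `μ₃` are
absorbed by `Alt₈` (`sum_a3Vec_tmul`), so that the component in `B₃ ⊗ F*` is a combination of
alternating sums of `r₃(x₀ | …) ⊗ Δ(J)` and of `{r(x₀, x₄ | …)}₃ ⊗ Δ(J)`, for `J` and for its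
complement (`cobracket31`). Another choice of the vectors and of the volume form changes
`Δ(J) + Δ(Jᶜ)` by a constant, and the alternating sums without the factor `Δ` vanish, so the
component does not depend on the choices. In the nine-term relations most sums vanish by symmetry;
the two which do not are treated by the seven-term relation and its dual (`altSum_r3Vol_nine`,
`altSum_projR3Vol_nine`), and the one in `Λ² B₂` by both kinds of five-term relations
(`altSum_projRatioWedge`).

For the map `d`, the seven-term and the Kummer relations have to be mapped to zero by
`{x} ↦ {x}₂ ⊗ x`. A five-term relation in which two arguments are triple ratios shows that
`r₃(x₀, …, x₅)` is mapped to `-1/2` times the alternating sum of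
`(x₀ | x₁, x₂, x₃, x₄)₂ ⊗ Δ(x₀, x₁, x₂)` (`symTensor_preR3`); this involves five points only, which
gives the seven-term relation. The Kummer relation follows from three five-term relations
(`sym2_kummer`). If `F` has at most three elements, then `F* ⊗ ℚ = 0`, and there is nothing to
prove.

For `d ∘ δ = 0`, the formula for `d r₃` and the classes of `r` and `1 - r` for a cross-ratio `r`
show that every component of `δ` is mapped to alternating sums of
`{r(x₀, x₁ | x₂, x₃, x₄, x₅)}₂ ⊗ Δ(I) ∧ Δ(J)` (`standardSum`). Such a sum vanishes if `(0 1)` or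
`(6 7)` preserves `I` and `J`. The five-term relation with `x₆` as the additional point and the dual
five-term relation give the linear relations `standardSum_relations` between the others, and these
suffice (`differential_cobracket`).
-/

namespace Tetralog

open Equiv

/-! ### Alternating sums -/

section AlternatingSums

variable {T T' : Type*} [AddCommGroup T] [Module ℚ T] [AddCommGroup T'] [Module ℚ T']

/-- The sign of a permutation as a rational number. -/
def sgn {α : Type*} [DecidableEq α] [Fintype α] (σ : Perm α) : ℚ := ((Perm.sign σ : ℤ) : ℚ)

section
variable {α β : Type*} [DecidableEq α] [Fintype α] [DecidableEq β] [Fintype β]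

@[simp] lemma sgn_one : sgn (1 : Perm α) = 1 := by simp [sgn]

lemma sgn_mul (σ τ : Perm α) : sgn (σ * τ) = sgn σ * sgn τ := by simp [sgn]

lemma sgn_mul_self (σ : Perm α) : sgn σ * sgn σ = 1 := by
  have h := Int.units_mul_self (Perm.sign σ)
  have h' := congrArg (fun u : ℤˣ => ((u : ℤ) : ℚ)) h
  simpa only [sgn, Units.val_mul, Int.cast_mul, Units.val_one, Int.cast_one] using h'

lemma sgn_swap {i j : α} (h : i ≠ j) : sgn (swap i j) = -1 := by simp [sgn, Perm.sign_swap h]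

lemma sgn_eq (σ : Perm α) {z : ℤˣ} (h : Perm.sign σ = z) : sgn σ = ((z : ℤ) : ℚ) := by
  rw [sgn, h]

end

variable {m : ℕ} {X : Type*} [MulAction (Perm (Fin m)) X]

/-- The alternating sum `∑ sgn(σ) f(σ x)` over the permutations `σ` of `m` indices, for a function
`f` of indexed data `x` (tuples of indices, sets of indices, …). -/
def altSum (m : ℕ) {X : Type*} [MulAction (Perm (Fin m)) X] (f : X → T) (x : X) :
    T :=
  ∑ σ : Perm (Fin m), sgn σ • f (σ • x)

lemma altSum_smul (f : X → T) (τ : Perm (Fin m)) (x : X) :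
    altSum m f (τ • x) = sgn τ • altSum m f x := by
  rw [altSum, altSum, Finset.smul_sum]
  refine Fintype.sum_equiv (Equiv.mulRight τ) _ _ fun σ => ?_
  simp only [Equiv.coe_mulRight]
  rw [smul_smul σ τ, sgn_mul, smul_smul (sgn τ), mul_comm (sgn σ), ← mul_assoc, sgn_mul_self,
    one_mul]

/-- Relabelling: `y` is obtained from `x` by the permutation `τ` of the indices. -/
lemma altSum_relabel (f : X → T) (τ : Perm (Fin m)) {x y : X} (h : τ • x = y) :
    altSum m f y = sgn τ • altSum m f x := by
  rw [← h, altSum_smul]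

lemma altSum_congr {f g : X → T} {x y : X} (h : ∀ σ : Perm (Fin m), f (σ • x) = g (σ • y)) :
    altSum m f x = altSum m g y :=
  Finset.sum_congr rfl fun σ _ => by rw [h σ]

lemma eq_zero_of_eq_neg {t : T} (h : t = -t) : t = 0 := by
  have h2 : (2 : ℚ) • t = 0 := by
    rw [two_smul]
    nth_rewrite 1 [h]
    simp
  simpa using h2

/-- An alternating sum vanishes if some permutation of the indices changes the summands by minus
its sign. -/
lemma altSum_eq_zero (f : X → T) (τ : Perm (Fin m)) (x : X)
    (h : ∀ σ : Perm (Fin m), f (σ • τ • x) = -(sgn τ • f (σ • x))) : altSum m f x = 0 := by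
  refine eq_zero_of_eq_neg ?_
  have h1 : altSum m f (τ • x) = -(sgn τ • altSum m f x) := by
    rw [altSum, altSum, Finset.smul_sum, ← Finset.sum_neg_distrib]
    refine Finset.sum_congr rfl fun σ _ => ?_
    rw [h σ, smul_neg, smul_comm]
  rw [altSum_smul] at h1
  have h2 := congrArg (fun t => sgn τ • t) h1
  simpa only [smul_neg, smul_smul, sgn_mul_self, one_smul] using h2

/-- An alternating sum vanishes if an odd permutation fixes the data; this applies in particular to
data which do not involve two of the indices. -/
lemma altSum_eq_zero_of_fixed (f : X → T) (τ : Perm (Fin m)) {x : X} (h : τ • x = x)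
    (hτ : Perm.sign τ = -1) : altSum m f x = 0 :=
  altSum_eq_zero f τ x fun σ => by rw [h, sgn_eq τ hτ]; simp

lemma altSum_neg (f : X → T) (x : X) : altSum m (fun y => -f y) x = -altSum m f x := by
  simp [altSum]

lemma altSum_const_smul (c : ℚ) (f : X → T) (x : X) :
    altSum m (fun y => c • f y) x = c • altSum m f x := by
  simp only [altSum, Finset.smul_sum]
  exact Finset.sum_congr rfl fun σ _ => smul_comm _ _ _

lemma map_altSum (L : T →ₗ[ℚ] T') (f : X → T) (x : X) :
    L (altSum m f x) = altSum m (fun y => L (f y)) x := by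
  simp [altSum]

end AlternatingSums

/-- Every permutation of `n + 1` indices is determined by the image `i` of `0` and the permutation
of the `n` other indices which it induces; `i.cycleRange.symm` inserts `i` in the first place. -/
lemma sum_perm_succ {T : Type*} [AddCommGroup T] [Module ℚ T] {n : ℕ}
    (F : Perm (Fin (n + 1)) → T) :
    ∑ σ, sgn σ • F σ = ∑ i : Fin (n + 1), (-1 : ℚ) ^ (i : ℕ) • ∑ σ : Perm (Fin n),
      sgn σ • F (i.cycleRange.symm * Perm.decomposeFin.symm (0, σ)) := by
  have key : ∀ (i : Fin (n + 1)) (σ : Perm (Fin n)),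
      sgn (i.cycleRange.symm * Perm.decomposeFin.symm (0, σ)) = (-1) ^ (i : ℕ) * sgn σ := by
    intro i σ
    rw [sgn_mul]
    congr 1
    · simp [sgn, Fin.sign_cycleRange]
    · simp [sgn, Perm.decomposeFin.symm_sign]
  simp only [Finset.smul_sum]
  rw [← Finset.sum_product']
  symm
  refine Finset.sum_bij' (i := fun p _ => p.1.cycleRange.symm * Perm.decomposeFin.symm (0, p.2))
    (j := fun σ _ => (σ 0, (Perm.decomposeFin ((σ 0).cycleRange * σ)).2)) ?_ ?_ ?_ ?_ ?_
  · simp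
  · simp
  · rintro ⟨i, σ⟩ -
    have h0 : (i.cycleRange.symm * Perm.decomposeFin.symm (0, σ)) 0 = i := by
      simp [Perm.mul_apply]
    simp only [h0]
    rw [← mul_assoc, show i.cycleRange * i.cycleRange.symm = 1 from by ext; simp, one_mul]
    simp
  · intro σ _
    have h0 : ((σ 0).cycleRange * σ) 0 = 0 := by simp [Perm.mul_apply]
    obtain ⟨⟨p, e⟩, hp⟩ := Perm.decomposeFin.symm.surjective ((σ 0).cycleRange * σ)
    have hp0 : p = 0 := by
      rw [← hp] at h0
      simpa using h0
    subst hp0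
    simp only [← hp, Equiv.apply_symm_apply]
    rw [hp, ← mul_assoc, show (σ 0).cycleRange.symm * (σ 0).cycleRange = 1 from by ext; simp,
      one_mul]
  · rintro ⟨i, σ⟩ -
    simp only [key, smul_smul]

lemma cycleRange_symm_mul_zero {n : ℕ} (i : Fin (n + 1)) (σ : Perm (Fin n)) :
    (i.cycleRange.symm * Perm.decomposeFin.symm (0, σ)) 0 = i := by
  simp [Perm.mul_apply]

lemma cycleRange_symm_mul_succ {n : ℕ} (i : Fin (n + 1)) (σ : Perm (Fin n)) (k : Fin n) :
    (i.cycleRange.symm * Perm.decomposeFin.symm (0, σ)) k.succ = i.succAbove (σ k) := by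
  simp [Perm.mul_apply]

/-! ### Classes in `F* ⊗ ℚ` -/

section UnitClass

variable {F : Type*} [Field F]

@[simp] lemma unitClass_zero : unitClass (0 : F) = 0 := by simp [unitClass]

lemma unitClass_mul {x y : F} (hx : x ≠ 0) (hy : y ≠ 0) :
    unitClass (x * y) = unitClass x + unitClass y := by
  rw [unitClass, dif_pos (mul_ne_zero hx hy), unitClass, dif_pos hx, unitClass, dif_pos hy,
    ← TensorProduct.tmul_add, ← ofMul_mul, Units.mk0_mul]

@[simp] lemma unitClass_one : unitClass (1 : F) = 0 := by
  have h := unitClass_mul (one_ne_zero (α := F)) one_ne_zero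
  simpa using h

lemma unitClass_inv (x : F) : unitClass x⁻¹ = -unitClass x := by
  by_cases hx : x = 0
  · simp [hx]
  · have h := unitClass_mul hx (inv_ne_zero hx)
    rw [mul_inv_cancel₀ hx, unitClass_one] at h
    exact eq_neg_of_add_eq_zero_right h.symm

lemma unitClass_div {x y : F} (hx : x ≠ 0) (hy : y ≠ 0) :
    unitClass (x / y) = unitClass x - unitClass y := by
  rw [div_eq_mul_inv, unitClass_mul hx (inv_ne_zero hy), unitClass_inv, sub_eq_add_neg]

/-- The class of `-1` is `2`-torsion, hence zero after tensoring with `ℚ`. -/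
@[simp] lemma unitClass_neg_one : unitClass (-1 : F) = 0 := by
  have h := unitClass_mul (x := (-1 : F)) (y := -1) (by simp) (by simp)
  simp only [mul_neg, mul_one, neg_neg, unitClass_one] at h
  exact eq_zero_of_eq_neg (eq_neg_of_add_eq_zero_left h.symm)

@[simp] lemma unitClass_neg (x : F) : unitClass (-x) = unitClass x := by
  by_cases hx : x = 0
  · simp [hx]
  · rw [← neg_one_mul, unitClass_mul (by simp) hx, unitClass_neg_one, zero_add]

lemma unitClass_pow {x : F} (hx : x ≠ 0) (n : ℕ) : unitClass (x ^ n) = (n : ℚ) • unitClass x := by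
  induction n with
  | zero => simp
  | succ n ih => rw [pow_succ, unitClass_mul (pow_ne_zero n hx) hx, ih]; push_cast; module

lemma unitClass_prod {ι : Type*} (s : Finset ι) (f : ι → F) (h : ∀ i ∈ s, f i ≠ 0) :
    unitClass (∏ i ∈ s, f i) = ∑ i ∈ s, unitClass (f i) := by
  classical
  induction s using Finset.induction_on with
  | empty => simp
  | insert a s ha ih =>
    rw [Finset.prod_insert ha, Finset.sum_insert ha, unitClass_mul (h a (by simp))
      (Finset.prod_ne_zero_iff.2 fun i hi => h i (by simp [hi])),
      ih fun i hi => h i (by simp [hi])]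

end UnitClass

/-! ### Volumes of subsets of a tuple of vectors -/

section Volumes

variable {F V : Type*} [Field F] [AddCommGroup V] [Module F V] {n m k : ℕ}

/-- The class in `F* ⊗ ℚ` of the volume of the vectors `x i`, `i ∈ I`, for a set `I` of `n`
indices. The order of the vectors does not matter, since the class of `-1` is zero. -/
noncomputable def vol (ω : V [⋀^Fin n]→ₗ[F] F) (x : Fin m → V) (I : Finset (Fin m)) : MultQ F :=
  if h : I.card = n then unitClass (ω (x ∘ I.orderEmbOfFin h)) else 0

lemma unitClass_map_perm (ω : V [⋀^Fin n]→ₗ[F] F) (y : Fin n → V) (σ : Perm (Fin n)) :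
    unitClass (ω (y ∘ σ)) = unitClass (ω y) := by
  rw [ω.map_perm]
  rcases Int.units_eq_one_or (Perm.sign σ) with h | h <;> simp [h]

lemma vol_image (ω : V [⋀^Fin n]→ₗ[F] F) (x : Fin m → V) {e : Fin n → Fin m}
    (he : Function.Injective e) :
    vol ω x (Finset.univ.image e) = unitClass (ω (x ∘ e)) := by
  have hc : (Finset.univ.image e).card = n := by simp [Finset.card_image_of_injective _ he]
  rw [vol, dif_pos hc]
  set o := (Finset.univ.image e).orderEmbOfFin hc
  have hmem : ∀ k, ∃ j, o j = e k := fun k => by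
    have : e k ∈ Set.range o := by
      rw [Finset.range_orderEmbOfFin]
      simp
    exact this
  choose g hg using hmem
  have hgi : Function.Injective g := fun a b hab => he (by rw [← hg a, ← hg b, hab])
  let σ : Perm (Fin n) := Equiv.ofBijective g (Finite.injective_iff_bijective.1 hgi)
  have h1 : x ∘ e = (x ∘ o) ∘ σ := by
    funext k
    simp [σ, hg]
  rw [h1, unitClass_map_perm]

lemma vol_eq (ω : V [⋀^Fin n]→ₗ[F] F) (x : Fin m → V) {I : Finset (Fin m)} (e : Fin n → Fin m)
    (he : Function.Injective e) (hI : Finset.univ.image e = I) :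
    vol ω x I = unitClass (ω (x ∘ e)) := by
  rw [← hI, vol_image ω x he]

lemma vol_comp (ω : V [⋀^Fin n]→ₗ[F] F) (x : Fin m → V) {e : Fin k → Fin m}
    (he : Function.Injective e) (I : Finset (Fin k)) :
    vol ω (x ∘ e) I = vol ω x (I.image e) := by
  by_cases h : I.card = n
  · have h1 : I.image e = Finset.univ.image (e ∘ I.orderEmbOfFin h) := by
      rw [← Finset.image_image]
      congr 1
      ext a
      simp
    rw [h1, vol_image ω x (he.comp (I.orderEmbOfFin h).injective), vol, dif_pos h]
    rfl
  · rw [vol, dif_neg h, vol, dif_neg (by rwa [Finset.card_image_of_injective _ he])]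

lemma vol_curryLeft (ω : V [⋀^Fin (n + 1)]→ₗ[F] F) (x : Fin m → V) {i : Fin m}
    {I : Finset (Fin m)} (hi : i ∉ I) :
    vol (ω.curryLeft (x i)) x I = vol ω x (insert i I) := by
  by_cases h : I.card = n
  · have h1 : insert i I =
        Finset.univ.image (Fin.cons i (I.orderEmbOfFin h) : Fin (n + 1) → _) := by
      ext a
      have := Set.ext_iff.1 (Finset.range_orderEmbOfFin I h) a
      simp only [Set.mem_range, SetLike.mem_coe] at this
      simp [Fin.exists_fin_succ, ← this, eq_comm]
    have h2 : Function.Injective (Fin.cons i (I.orderEmbOfFin h) : Fin (n + 1) → Fin m) := by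
      rw [Fin.cons_injective_iff]
      refine ⟨?_, (I.orderEmbOfFin h).injective⟩
      rw [Finset.range_orderEmbOfFin]
      simpa using hi
    rw [h1, vol_image ω x h2, vol, dif_pos h]
    rw [AlternatingMap.curryLeft_apply_apply]
    refine congrArg unitClass (congrArg ω ?_)
    funext k
    refine Fin.cases ?_ (fun k => ?_) k <;> simp
  · rw [vol, dif_neg h, vol, dif_neg (by rw [Finset.card_insert_of_notMem hi]; omega)]

end Volumes

/-! ### Configurations of vectors up to scalars -/

section Configurations

variable {F V W U : Type*} [Field F] [AddCommGroup V] [Module F V] [AddCommGroup W] [Module F W]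
  [AddCommGroup U] [Module F U] {n m k : ℕ}

lemma comp_vecCons {α β : Type*} (z : α → β) (i : α) (e : Fin n → α) :
    z ∘ Matrix.vecCons i e = Matrix.vecCons (z i) (z ∘ e) := by
  funext j
  refine Fin.cases ?_ (fun j => ?_) j <;> simp

/-- The two tuples of vectors have the same volumes up to a scalar for each vector and a scalar for
the volume form. So they represent the same configuration of points. -/
def ScaledBy (ω : V [⋀^Fin n]→ₗ[F] F) (ω' : W [⋀^Fin n]→ₗ[F] F) (x : Fin m → V)
    (x' : Fin m → W) : Prop :=
  ∃ (μ : F) (l : Fin m → F), μ ≠ 0 ∧ (∀ i, l i ≠ 0) ∧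
    ∀ e : Fin n → Fin m, ω' (x' ∘ e) = μ * (∏ i, l (e i)) * ω (x ∘ e)

lemma ScaledBy.refl (ω : V [⋀^Fin n]→ₗ[F] F) (x : Fin m → V) : ScaledBy ω ω x x :=
  ⟨1, 1, one_ne_zero, fun _ => one_ne_zero, fun e => by simp⟩

lemma ScaledBy.symm {ω : V [⋀^Fin n]→ₗ[F] F} {ω' : W [⋀^Fin n]→ₗ[F] F} {x : Fin m → V}
    {x' : Fin m → W} (h : ScaledBy ω ω' x x') : ScaledBy ω' ω x' x := by
  obtain ⟨μ, l, hμ, hl, h⟩ := h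
  refine ⟨μ⁻¹, fun i => (l i)⁻¹, inv_ne_zero hμ, fun i => inv_ne_zero (hl i), fun e => ?_⟩
  have hp : (∏ i, l (e i)) ≠ 0 := Finset.prod_ne_zero_iff.2 fun i _ => hl _
  rw [h e, Finset.prod_inv_distrib]
  field_simp

lemma ScaledBy.trans {ω : V [⋀^Fin n]→ₗ[F] F} {ω' : W [⋀^Fin n]→ₗ[F] F}
    {ω'' : U [⋀^Fin n]→ₗ[F] F} {x : Fin m → V} {x' : Fin m → W} {x'' : Fin m → U}
    (h : ScaledBy ω ω' x x') (h' : ScaledBy ω' ω'' x' x'') : ScaledBy ω ω'' x x'' := by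
  obtain ⟨μ, l, hμ, hl, h⟩ := h
  obtain ⟨μ', l', hμ', hl', h'⟩ := h'
  refine ⟨μ' * μ, fun i => l' i * l i, mul_ne_zero hμ' hμ, fun i => mul_ne_zero (hl' i) (hl i),
    fun e => ?_⟩
  rw [h' e, h e, Finset.prod_mul_distrib]
  ring

lemma ScaledBy.comp {ω : V [⋀^Fin n]→ₗ[F] F} {ω' : W [⋀^Fin n]→ₗ[F] F} {x : Fin m → V}
    {x' : Fin m → W} (h : ScaledBy ω ω' x x') (f : Fin k → Fin m) :
    ScaledBy ω ω' (x ∘ f) (x' ∘ f) := by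
  obtain ⟨μ, l, hμ, hl, h⟩ := h
  exact ⟨μ, l ∘ f, hμ, fun i => hl _, fun e => h (f ∘ e)⟩

lemma ScaledBy.curryLeft {ω : V [⋀^Fin (n + 1)]→ₗ[F] F} {ω' : W [⋀^Fin (n + 1)]→ₗ[F] F}
    {x : Fin m → V} {x' : Fin m → W} (h : ScaledBy ω ω' x x') (i : Fin m) :
    ScaledBy (ω.curryLeft (x i)) (ω'.curryLeft (x' i)) x x' := by
  obtain ⟨μ, l, hμ, hl, h⟩ := h
  refine ⟨μ * l i, l, mul_ne_zero hμ (hl i), hl, fun e => ?_⟩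
  have h1 := h (Matrix.vecCons i e)
  rw [comp_vecCons, comp_vecCons] at h1
  rw [AlternatingMap.curryLeft_apply_apply, AlternatingMap.curryLeft_apply_apply, h1,
    Fin.prod_univ_succ]
  simp only [Matrix.cons_val_zero, Matrix.cons_val_succ]
  ring

/-- Vectors which represent a configuration of points in general position in `ℙⁿ⁻¹`. The form `ω`
may be degenerate, as is `ω.curryLeft l` for a projection with center `l`. -/
def Generic (ω : V [⋀^Fin n]→ₗ[F] F) (x : Fin m → V) : Prop :=
  ∃ y : Fin m → (Fin n → F), GenericVectors y ∧ ScaledBy (stdVol F n) ω y x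

lemma stdVol_ne_zero_iff (y : Fin n → (Fin n → F)) :
    stdVol F n y ≠ 0 ↔ LinearIndependent F y := by
  have h := Matrix.linearIndependent_rows_iff_isUnit (A := Matrix.of y)
  rw [Matrix.isUnit_iff_isUnit_det, isUnit_iff_ne_zero] at h
  exact h.symm

lemma GenericVectors.ne_zero {y : Fin m → (Fin n → F)} (hy : GenericVectors y)
    {e : Fin n → Fin m} (he : Function.Injective e) : stdVol F n (y ∘ e) ≠ 0 :=
  (stdVol_ne_zero_iff _).2 (hy ⟨e, he⟩)

lemma genericVectors_of_ne_zero {y : Fin m → (Fin n → F)}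
    (h : ∀ e : Fin n → Fin m, Function.Injective e → stdVol F n (y ∘ e) ≠ 0) :
    GenericVectors y :=
  fun s => (stdVol_ne_zero_iff _).1 (h s s.injective)

lemma GenericVectors.generic {y : Fin m → (Fin n → F)} (hy : GenericVectors y) :
    Generic (stdVol F n) y :=
  ⟨y, hy, ScaledBy.refl _ _⟩

lemma Generic.ne_zero {ω : V [⋀^Fin n]→ₗ[F] F} {x : Fin m → V} (h : Generic ω x)
    {e : Fin n → Fin m} (he : Function.Injective e) : ω (x ∘ e) ≠ 0 := by
  obtain ⟨y, hy, μ, l, hμ, hl, hs⟩ := h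
  rw [hs e]
  exact mul_ne_zero (mul_ne_zero hμ (Finset.prod_ne_zero_iff.2 fun i _ => hl _)) (hy.ne_zero he)

lemma Generic.of_scaledBy {ω : V [⋀^Fin n]→ₗ[F] F} {ω' : W [⋀^Fin n]→ₗ[F] F} {x : Fin m → V}
    {x' : Fin m → W} (hx : Generic ω x) (h : ScaledBy ω ω' x x') : Generic ω' x' := by
  obtain ⟨y, hy, hs⟩ := hx
  exact ⟨y, hy, hs.trans h⟩

lemma Generic.comp {ω : V [⋀^Fin n]→ₗ[F] F} {x : Fin m → V} (hx : Generic ω x)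
    {f : Fin k → Fin m} (hf : Function.Injective f) : Generic ω (x ∘ f) := by
  obtain ⟨y, hy, hs⟩ := hx
  refine ⟨y ∘ f, fun s => hy (s.trans ⟨f, hf⟩), hs.comp f⟩

/-- If `π` is a projection with center `l`, then the volumes `ω(l, v₁, …, vₙ)` are, up to a scalar,
the volumes of the projected vectors. -/
lemma exists_curryLeft_eq (ω : (Fin (n + 1) → F) [⋀^Fin (n + 1)]→ₗ[F] F) (l : Fin (n + 1) → F)
    (π : (Fin (n + 1) → F) →ₗ[F] (Fin n → F)) (hsurj : Function.Surjective π)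
    (hker : LinearMap.ker π = Submodule.span F {l}) :
    ∃ c : F, ∀ v : Fin n → (Fin (n + 1) → F),
      ω.curryLeft l v = c * stdVol F n (fun i => π (v i)) := by
  obtain ⟨s, hs⟩ := π.exists_rightInverse_of_surjective (LinearMap.range_eq_top.2 hsurj)
  have hs' : ∀ w, π (s w) = w := fun w => LinearMap.congr_fun hs w
  set η := (ω.curryLeft l).compLinearMap s with hη
  have hη' := η.eq_smul_basis_det (Pi.basisFun F (Fin n))
  refine ⟨η (Pi.basisFun F (Fin n)), fun v => ?_⟩
  have h1 : ω.curryLeft l v = η (fun i => π (v i)) := by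
    have h2 : ∀ i, ∃ c : F, v i = s (π (v i)) + c • l := by
      intro i
      have : v i - s (π (v i)) ∈ LinearMap.ker π := by simp [hs']
      rw [hker, Submodule.mem_span_singleton] at this
      obtain ⟨c, hc⟩ := this
      exact ⟨c, by rw [hc]; abel⟩
    choose c hc using h2
    -- replace the vectors one after the other by `s (π (v i))`: the difference is a multiple of `l`
    have h3 : ∀ (t : Finset (Fin n)), ω.curryLeft l v =
        ω.curryLeft l (fun i => if i ∈ t then s (π (v i)) else v i) := by
      intro t
      induction t using Finset.induction_on with
      | empty => simp
      | insert a t ha ih =>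
        rw [ih]
        set v' : Fin n → (Fin (n + 1) → F) := fun i => if i ∈ t then s (π (v i)) else v i with hv'
        have e1 : v' = Function.update v' a (s (π (v a)) + c a • l) := by
          rw [← hc a]
          conv_rhs => rw [show v a = v' a by simp [hv', ha]]
          rw [Function.update_eq_self]
        have e2 : (fun i => if i ∈ insert a t then s (π (v i)) else v i) =
            Function.update v' a (s (π (v a))) := by
          funext i
          by_cases hia : i = a
          · subst hia; simp
          · simp [hia, hv']
        rw [e2]
        conv_lhs => rw [e1]
        rw [(ω.curryLeft l).map_update_add, (ω.curryLeft l).map_update_smul]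
        have e3 : ω.curryLeft l (Function.update v' a l) = 0 := by
          rw [AlternatingMap.curryLeft_apply_apply]
          refine ω.map_eq_zero_of_eq _ (i := 0) (j := a.succ) ?_ (Fin.succ_ne_zero a).symm
          simp
        rw [e3, smul_zero, add_zero]
    rw [h3 Finset.univ]
    simp [hη]
  have h2 := congrArg (fun g : (Fin n → F) [⋀^Fin n]→ₗ[F] F => g fun i => π (v i)) hη'
  simp only [AlternatingMap.smul_apply, smul_eq_mul, Pi.basisFun_det] at h2
  rw [h1, h2]
  rfl

lemma exists_projection (l : Fin (n + 1) → F) (hl : l ≠ 0) :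
    ∃ π : (Fin (n + 1) → F) →ₗ[F] (Fin n → F), Function.Surjective π ∧
      LinearMap.ker π = Submodule.span F {l} := by
  have h1 : Module.finrank F ((Fin (n + 1) → F) ⧸ Submodule.span F {l}) = n := by
    have := (Submodule.span F {l}).finrank_quotient_add_finrank
    rw [finrank_span_singleton hl, Module.finrank_fin_fun] at this
    omega
  let e : ((Fin (n + 1) → F) ⧸ Submodule.span F {l}) ≃ₗ[F] (Fin n → F) :=
    LinearEquiv.ofFinrankEq _ _ (by rw [h1, Module.finrank_fin_fun])
  refine ⟨e.toLinearMap ∘ₗ (Submodule.span F {l}).mkQ, ?_, ?_⟩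
  · exact e.surjective.comp (Submodule.mkQ_surjective _)
  · rw [LinearMap.ker_comp, LinearEquiv.ker, ← LinearMap.ker, Submodule.ker_mkQ]

/-- The projection of points in general position with center one of them. -/
lemma Generic.proj {ω : V [⋀^Fin (n + 1)]→ₗ[F] F} {x : Fin m → V} (hx : Generic ω x) (i : Fin m)
    {f : Fin k → Fin m} (hf : Function.Injective f) (hi : ∀ j, f j ≠ i) (hk : n ≤ k) :
    Generic (ω.curryLeft (x i)) (x ∘ f) := by
  obtain ⟨y, hy, hs⟩ := hx
  refine Generic.of_scaledBy ?_ ((hs.curryLeft i).comp f)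
  have hcons : ∀ e : Fin n → Fin k, Function.Injective e →
      Function.Injective (Fin.cons i (f ∘ e) : Fin (n + 1) → Fin m) := by
    intro e he
    rw [Fin.cons_injective_iff]
    refine ⟨?_, hf.comp he⟩
    rintro ⟨j, hj⟩
    exact hi _ hj
  have hyi : y i ≠ 0 := by
    have h1 := hy ⟨_, hcons (Fin.castLE hk) (Fin.castLE_injective hk)⟩
    simpa using h1.ne_zero 0
  obtain ⟨π, hπ, hker⟩ := exists_projection (y i) hyi
  obtain ⟨c, hc⟩ := exists_curryLeft_eq (stdVol F (n + 1)) (y i) π hπ hker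
  have key : ∀ e : Fin n → Fin k, Function.Injective e →
      (stdVol F (n + 1)).curryLeft (y i) (y ∘ f ∘ e) ≠ 0 := by
    intro e he
    rw [AlternatingMap.curryLeft_apply_apply]
    have h1 := hy.ne_zero (hcons e he)
    convert h1 using 2
    funext j
    refine Fin.cases ?_ (fun j => ?_) j <;> simp
  have hc0 : c ≠ 0 := by
    rintro rfl
    exact key (Fin.castLE hk) (Fin.castLE_injective hk) (by rw [hc]; simp)
  refine ⟨fun j => π (y (f j)), genericVectors_of_ne_zero fun e he h0 => key e he ?_,
    c, 1, hc0, fun _ => one_ne_zero, fun e => ?_⟩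
  · rw [hc]
    exact mul_eq_zero_of_right _ h0
  · rw [show (y ∘ f) ∘ e = y ∘ f ∘ e from rfl, hc]
    simp only [Pi.one_apply, Finset.prod_const_one, mul_one]
    rfl

end Configurations

lemma comp_vecEmpty {α β : Type*} (z : α → β) : z ∘ ![] = ![] := Subsingleton.elim _ _

/-! ### Gale duality -/

section GaleDuality

variable {F : Type*} [Field F] {a b : ℕ}

/-- Jacobi's identity for complementary minors of a matrix and of its inverse. -/
lemma det_toBlocks₁₁_of_mul_eq_one {ι κ : Type*} [Fintype ι] [Fintype κ] [DecidableEq ι]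
    [DecidableEq κ] (M M' : Matrix (ι ⊕ κ) (ι ⊕ κ) F) (h : M * M' = 1) :
    M.toBlocks₁₁.det = M.det * M'.toBlocks₂₂.det := by
  have h1 : M * Matrix.fromBlocks 1 M'.toBlocks₁₂ 0 M'.toBlocks₂₂ =
      Matrix.fromBlocks M.toBlocks₁₁ 0 M.toBlocks₂₁ 1 := by
    rw [← Matrix.fromBlocks_toBlocks M, ← Matrix.fromBlocks_toBlocks M',
      Matrix.fromBlocks_multiply, ← Matrix.fromBlocks_one, Matrix.fromBlocks_inj] at h
    conv_lhs => rw [← Matrix.fromBlocks_toBlocks M]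
    rw [Matrix.fromBlocks_multiply, h.2.1, h.2.2.2]
    simp
  have h2 := congrArg Matrix.det h1
  rw [Matrix.det_mul, Matrix.det_fromBlocks_zero₂₁, Matrix.det_fromBlocks_zero₁₂] at h2
  simpa using h2.symm

/-- Gale duality: `a + b` vectors of `Fᵃ` have a dual configuration of `a + b` vectors of `Fᵇ`, such
that complementary volumes are proportional. -/
lemma exists_gale_dual (y : Fin (a + b) → (Fin a → F)) (hy : GenericVectors y) :
    ∃ (z : Fin (a + b) → (Fin b → F)) (c : F), GenericVectors z ∧ c ≠ 0 ∧
      ∀ σ : Perm (Fin (a + b)), stdVol F a (y ∘ σ ∘ Fin.castAdd b) =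
        c * ((Perm.sign σ : ℤ) : F) * stdVol F b (z ∘ σ ∘ Fin.natAdd a) := by
  let E : Fin a ⊕ Fin b ≃ Fin (a + b) := finSumFinEquiv
  let N : Matrix (Fin a ⊕ Fin b) (Fin a ⊕ Fin b) F :=
    Matrix.fromBlocks (Matrix.of fun i k => y (E (Sum.inl k)) i)
      (Matrix.of fun i k => y (E (Sum.inr k)) i) 0 1
  have hN : N.det = stdVol F a (y ∘ Fin.castAdd b) := by
    rw [Matrix.det_fromBlocks_zero₂₁, Matrix.det_one, mul_one, ← Matrix.det_transpose]
    rfl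
  have hN0 : N.det ≠ 0 := by
    rw [hN]
    exact hy.ne_zero (Fin.castAdd_injective a b)
  have hNinv : N * N⁻¹ = 1 := Matrix.mul_nonsing_inv _ (isUnit_iff_ne_zero.2 hN0)
  let z : Fin (a + b) → (Fin b → F) := fun j i => N⁻¹ (E.symm j) (Sum.inr i)
  have key : ∀ σ : Perm (Fin (a + b)), stdVol F a (y ∘ σ ∘ Fin.castAdd b) =
        N.det * ((Perm.sign σ : ℤ) : F) * stdVol F b (z ∘ σ ∘ Fin.natAdd a) := by
    intro σ
    let τ : Perm (Fin a ⊕ Fin b) := E.symm.permCongr σ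
    have hτ : ∀ s, τ s = E.symm (σ (E s)) := fun s => by simp [τ, Equiv.permCongr_apply]
    have hM : N.submatrix id τ * (N⁻¹).submatrix τ id = 1 := by
      rw [Matrix.submatrix_mul_equiv, hNinv]
      simp
    have h1 := det_toBlocks₁₁_of_mul_eq_one _ _ hM
    rw [Matrix.det_permute', Perm.sign_permCongr] at h1
    have h2 : (N.submatrix id τ).toBlocks₁₁ =
        Matrix.transpose (Matrix.of (y ∘ σ ∘ Fin.castAdd b)) := by
      ext i k
      have : ∀ s, N (Sum.inl i) s = y (E s) i := by
        rintro (s | s) <;> rfl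
      simp only [Matrix.toBlocks₁₁, Matrix.of_apply, Matrix.submatrix_apply, id, this, hτ,
        Equiv.apply_symm_apply, Matrix.transpose_apply]
      rfl
    have h3 : ((N⁻¹).submatrix τ id).toBlocks₂₂ = Matrix.of (z ∘ σ ∘ Fin.natAdd a) := by
      ext i k
      simp only [Matrix.toBlocks₂₂, Matrix.of_apply, Matrix.submatrix_apply, id, hτ]
      rfl
    rw [h2, h3, Matrix.det_transpose] at h1
    rw [mul_comm N.det]
    exact h1
  refine ⟨z, N.det, genericVectors_of_ne_zero fun e he h0 => ?_, hN0, key⟩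
  have := Perm.isMultiplyPretransitive (Fin (a + b)) b
  obtain ⟨σ, hσ⟩ := MulAction.exists_smul_eq (Perm (Fin (a + b)))
    (⟨Fin.natAdd a, Fin.natAdd_injective b a⟩ : Fin b ↪ Fin (a + b)) ⟨e, he⟩
  have h1 : σ ∘ Fin.natAdd a = e := by
    funext i
    exact DFunLike.congr_fun hσ i
  have h2 := key σ
  rw [show z ∘ σ ∘ Fin.natAdd a = z ∘ e by rw [h1], h0, mul_zero] at h2
  exact hy.ne_zero (σ.injective.comp (Fin.castAdd_injective a b)) h2

end GaleDuality

/-! ### The group `B₂(F)` -/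

section BlochGroup

variable {F V W : Type*} [Field F] [AddCommGroup V] [Module F V] [AddCommGroup W] [Module F W]
  {n m k : ℕ}

@[simp] lemma sym2_zero : sym2 (0 : F) = 0 := by simp [sym2, pre2]

@[simp] lemma sym2_one : sym2 (1 : F) = 0 := by simp [sym2, pre2]

lemma ScaledBy.crossRatio_eq {ω : V [⋀^Fin 2]→ₗ[F] F} {ω' : W [⋀^Fin 2]→ₗ[F] F} {x : Fin m → V}
    {x' : Fin m → W} (h : ScaledBy ω ω' x x') (e : Fin 4 → Fin m) :
    crossRatio ω' (x' ∘ e) = crossRatio ω (x ∘ e) := by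
  obtain ⟨μ, l, hμ, hl, h⟩ := h
  have h1 : ∀ i j : Fin 4, ω' ![(x' ∘ e) i, (x' ∘ e) j] =
      μ * (l (e i) * l (e j)) * ω ![(x ∘ e) i, (x ∘ e) j] := by
    intro i j
    have := h ![e i, e j]
    simpa [Fin.prod_univ_succ, comp_vecCons, comp_vecEmpty] using this
  have hl' := fun i => hl (e i)
  simp only [crossRatio, h1]
  have hc : μ ^ 2 * (l (e 0) * l (e 1) * l (e 2) * l (e 3)) ≠ 0 :=
    mul_ne_zero (pow_ne_zero _ hμ)
      (mul_ne_zero (mul_ne_zero (mul_ne_zero (hl' 0) (hl' 1)) (hl' 2)) (hl' 3))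
  conv_rhs => rw [← mul_div_mul_left _ _ hc]
  congr 1 <;> ring

/-- The five-term relation for five points of a projected configuration. -/
lemma five_term {ω : V [⋀^Fin 2]→ₗ[F] F} {x : Fin 5 → V} (hx : Generic ω x) :
    ∑ i : Fin 5, (-1 : ℚ) ^ (i : ℕ) • sym2 (crossRatio ω (x ∘ i.succAbove)) = 0 := by
  obtain ⟨y, hy, hs⟩ := hx
  simp only [hs.crossRatio_eq, sym2, ← map_smul, ← map_sum]
  exact (Submodule.Quotient.mk_eq_zero _).2 (Submodule.subset_span ⟨y, hy, rfl⟩)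

lemma stdVol_two (u v : Fin 2 → F) : stdVol F 2 ![u, v] = u 0 * v 1 - u 1 * v 0 := by
  change Matrix.det (Matrix.of ![u, v]) = _
  rw [Matrix.det_fin_two]
  simp

lemma five_term_affine {a b : F} (ha : a ≠ 0) (ha1 : a ≠ 1) (hb : b ≠ 0) (hb1 : b ≠ 1)
    (hab : a ≠ b) :
    -sym2 a + sym2 b - sym2 (b / a) + sym2 ((1 - b) / (1 - a)) -
      sym2 (a * (1 - b) / (b * (1 - a))) = 0 := by
  let y : Fin 5 → (Fin 2 → F) := ![![1, 0], ![0, 1], ![1, 1], ![a, 1], ![b, 1]]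
  have ha2 := sub_ne_zero.2 ha1
  have hb2 := sub_ne_zero.2 hb1
  have ha3 := sub_ne_zero.2 ha1.symm
  have hb3 := sub_ne_zero.2 hb1.symm
  have hab2 := sub_ne_zero.2 hab
  have hab3 := sub_ne_zero.2 hab.symm
  have hy : GenericVectors y := by
    refine genericVectors_of_ne_zero fun e he => ?_
    have h1 : y ∘ e = ![y (e 0), y (e 1)] := by
      funext i
      fin_cases i <;> rfl
    have h2 : e 0 ≠ e 1 := fun h => by simpa using he h
    rw [h1, stdVol_two]
    generalize e 0 = i at h2
    generalize e 1 = j at h2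
    fin_cases i <;> fin_cases j <;> first | exact absurd rfl h2 | simp [y, *]
  have h := five_term hy.generic
  have hc : ∀ x : Fin 4 → (Fin 2 → F), crossRatio (stdVol F 2) x =
      ((x 0 0 * x 2 1 - x 0 1 * x 2 0) * (x 1 0 * x 3 1 - x 1 1 * x 3 0)) /
        ((x 0 0 * x 3 1 - x 0 1 * x 3 0) * (x 1 0 * x 2 1 - x 1 1 * x 2 0)) := by
    intro x
    simp only [crossRatio, stdVol_two]
  simp only [hc, Fin.sum_univ_succ, Function.comp] at h
  simp [y, Fin.succAbove, Fin.lt_def] at h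
  rw [← neg_eq_zero, ← h]
  norm_num
  abel

/-- The field has at least four elements. -/
def HasFourElements (F : Type*) [Field F] : Prop :=
  ∃ a b : F, a ≠ 0 ∧ a ≠ 1 ∧ b ≠ 0 ∧ b ≠ 1 ∧ a ≠ b

lemma HasFourElements.exists_ne (hF : HasFourElements F) (c : F) :
    ∃ y : F, y ≠ 0 ∧ y ≠ 1 ∧ y ≠ c := by
  obtain ⟨a, b, ha, ha1, hb, hb1, hab⟩ := hF
  by_cases h : a = c
  · exact ⟨b, hb, hb1, fun hc => hab (h.trans hc.symm)⟩
  · exact ⟨a, ha, ha1, h⟩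

/-- Exchanging the parameters `a` and `b` in the five-term relation, and adding up, one gets a
relation for the sums `{t} + {t⁻¹}`, which exchanging `p` and `q` shows to be zero. -/
lemma sym2_inv (hF : HasFourElements F) (x : F) : sym2 x⁻¹ = -sym2 x := by
  by_cases hx : x = 0
  · simp [hx]
  by_cases hx1 : x = 1
  · simp [hx1]
  have key : ∀ p q : F, p ≠ 0 → p ≠ 1 → q ≠ 0 → q ≠ 1 → p ≠ q →
      (sym2 p + sym2 p⁻¹) - (sym2 q + sym2 q⁻¹) + (sym2 (q / p) + sym2 (p / q)) = 0 := by
    intro p q hp hp1 hq hq1 hpq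
    have hpq' := sub_ne_zero.2 hpq
    have hq1' := sub_ne_zero.2 hq1.symm
    have hp1' := sub_ne_zero.2 hp1.symm
    have hp1'' := sub_ne_zero.2 hp1
    -- the parameters with `b / a = p` and `(1 - b) / (1 - a) = q`
    let a := (1 - q) / (p - q)
    let b := p * a
    have ha : a ≠ 0 := div_ne_zero hq1' hpq'
    have hb : b ≠ 0 := mul_ne_zero hp ha
    have h1a : 1 - a = (p - 1) / (p - q) := by simp only [a]; field_simp; ring
    have h1b : 1 - b = q * ((p - 1) / (p - q)) := by simp only [a, b]; field_simp; ring
    have ha1 : a ≠ 1 := by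
      intro h
      rw [h, sub_self] at h1a
      exact div_ne_zero hp1'' hpq' h1a.symm
    have hb1 : b ≠ 1 := by
      intro h
      rw [h, sub_self] at h1b
      exact mul_ne_zero hq (div_ne_zero hp1'' hpq') h1b.symm
    have hab : a ≠ b := by
      intro h
      have : (1 - p) * a = 0 := by rw [sub_mul, one_mul]; exact sub_eq_zero.2 h
      exact mul_ne_zero hp1' ha this
    have e1 := five_term_affine ha ha1 hb hb1 hab
    have e2 := five_term_affine hb hb1 ha ha1 hab.symm
    have r1 : b / a = p := by simp only [b]; field_simp
    have r1' : a / b = p⁻¹ := by rw [← r1, inv_div]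
    have r2 : (1 - b) / (1 - a) = q := by rw [h1a, h1b]; field_simp
    have r2' : (1 - a) / (1 - b) = q⁻¹ := by rw [← r2, inv_div]
    have r3 : a * (1 - b) / (b * (1 - a)) = q / p := by
      rw [mul_div_mul_comm, r1', r2, div_eq_inv_mul]
    have r3' : b * (1 - a) / (a * (1 - b)) = p / q := by
      rw [mul_div_mul_comm, r1, r2', div_eq_mul_inv]
    rw [r1, r2, r3] at e1
    rw [r1', r2', r3'] at e2
    rw [← neg_eq_zero, ← add_zero (0 : B2 F)]
    nth_rewrite 1 [← e1]
    rw [← e2]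
    abel
  obtain ⟨y, hy, hy1, hyx⟩ := hF.exists_ne x⁻¹
  have hp : x * y ≠ 0 := mul_ne_zero hx hy
  have hp1 : x * y ≠ 1 := fun h => hyx (eq_inv_of_mul_eq_one_right h)
  have hpq : x * y ≠ y := fun h => hx1 (mul_right_cancel₀ hy (h.trans (one_mul y).symm))
  have e1 := key _ _ hp hp1 hy hy1 hpq
  have e2 := key _ _ hy hy1 hp hp1 hpq.symm
  have r : x * y / y = x := by field_simp
  have r' : y / (x * y) = x⁻¹ := by field_simp
  rw [r, r'] at e1 e2
  have h2 : sym2 x + sym2 x⁻¹ = 0 := by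
    refine eq_zero_of_eq_neg (eq_neg_of_add_eq_zero_left ?_)
    rw [← add_zero (0 : B2 F)]
    nth_rewrite 1 [← e1]
    rw [← e2]
    abel
  exact eq_neg_of_add_eq_zero_right h2

/-- Comparing the five-term relations for `(a, b)` and for `(1 - a, 1 - b)` shows that
`{x} + {1 - x}` does not depend on `x`; this constant is killed by `3`. -/
lemma sym2_one_sub (hF : HasFourElements F) (x : F) : sym2 (1 - x) = -sym2 x := by
  have key : ∀ a b : F, a ≠ 0 → a ≠ 1 → b ≠ 0 → b ≠ 1 →
      sym2 a + sym2 (1 - a) = sym2 b + sym2 (1 - b) := by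
    intro a b ha ha1 hb hb1
    by_cases hab : a = b
    · rw [hab]
    have e1 := five_term_affine ha ha1 hb hb1 hab
    have e2 := five_term_affine (a := 1 - a) (b := 1 - b) (sub_ne_zero.2 ha1.symm)
      (fun h => ha (by linear_combination -h)) (sub_ne_zero.2 hb1.symm)
      (fun h => hb (by linear_combination -h)) (fun h => hab (by linear_combination -h))
    simp only [sub_sub_cancel] at e2
    have r : (1 - a) * b / ((1 - b) * a) = (a * (1 - b) / (b * (1 - a)))⁻¹ := by
      rw [inv_div]; congr 1 <;> ring
    rw [r, sym2_inv hF] at e2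
    refine sub_eq_zero.1 ?_
    rw [← neg_eq_zero, ← add_zero (0 : B2 F)]
    nth_rewrite 1 [← e1]
    rw [← e2]
    abel
  by_cases hx : x = 0
  · simp [hx]
  by_cases hx1 : x = 1
  · simp [hx1]
  have hx' := sub_ne_zero.2 hx1
  have h1 := key x x⁻¹ hx hx1 (inv_ne_zero hx) (fun h => hx1 (inv_eq_one.1 h))
  have h2 := key x (x / (x - 1)) hx hx1 (div_ne_zero hx hx')
    (fun h => by rw [div_eq_one_iff_eq hx'] at h; exact one_ne_zero (by linear_combination h))
  have r1 : 1 - x⁻¹ = (x / (x - 1))⁻¹ := by rw [inv_div]; field_simp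
  have r2 : 1 - x / (x - 1) = (1 - x)⁻¹ := by
    have : (1 - x) ≠ 0 := sub_ne_zero.2 (Ne.symm hx1)
    field_simp
    ring
  rw [r1, sym2_inv hF, sym2_inv hF] at h1
  rw [r2, sym2_inv hF] at h2
  have h3 : (3 : ℚ) • (sym2 x + sym2 (1 - x)) = 0 := by
    have : (3 : ℚ) • (sym2 x + sym2 (1 - x)) =
      (sym2 x + sym2 (1 - x)) + (sym2 x + sym2 (1 - x)) + (sym2 x + sym2 (1 - x)) := by module
    rw [this]
    nth_rewrite 1 [h1]
    nth_rewrite 1 [h2]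
    abel
  have h4 : sym2 x + sym2 (1 - x) = 0 := (smul_eq_zero_iff_right three_ne_zero).1 h3
  exact eq_neg_of_add_eq_zero_right h4

/-- The five-term relation in affine form; it holds for all nonzero `a` and `b`, because of
`{0} = {1} = 0` and since division by zero gives zero. -/
lemma sym2_five_term (hF : HasFourElements F) {a b : F} (ha : a ≠ 0) (hb : b ≠ 0) :
    -sym2 a + sym2 b - sym2 (b / a) + sym2 ((1 - b) / (1 - a)) -
      sym2 (a * (1 - b) / (b * (1 - a))) = 0 := by
  by_cases ha1 : a = 1
  · simp [ha1]
  by_cases hb1 : b = 1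
  · simp [hb1, sym2_inv hF]
  by_cases hab : a = b
  · have : 1 - b ≠ 0 := sub_ne_zero.2 (Ne.symm hb1)
    subst hab
    rw [div_self ha, div_self this, div_self (mul_ne_zero ha this)]
    simp
  exact five_term_affine ha ha1 hb hb1 hab

end BlochGroup

/-! ### Cross-ratios of points in general position -/

section CrossRatios

variable {F V W : Type*} [Field F] [AddCommGroup V] [Module F V] [AddCommGroup W] [Module F W]
  {n m k : ℕ}

lemma Generic.ne_zero₂ {ω : V [⋀^Fin 2]→ₗ[F] F} {x : Fin m → V} (hx : Generic ω x) {i j : Fin m}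
    (h : i ≠ j) : ω ![x i, x j] ≠ 0 := by
  have := hx.ne_zero (e := ![i, j]) (by
    intro a b hab
    fin_cases a <;> fin_cases b <;> first | rfl | exact absurd hab h | exact absurd hab.symm h)
  simpa [comp_vecCons, comp_vecEmpty] using this

lemma map_swap₂ (ω : V [⋀^Fin 2]→ₗ[F] F) (u v : V) : ω ![u, v] = -ω ![v, u] := by
  have := ω.map_swap ![v, u] (i := 0) (j := 1) (by decide)
  rw [← this]
  congr 1
  funext i
  fin_cases i <;> rfl

/-- Plücker's relation. -/
lemma Generic.plucker {ω : V [⋀^Fin 2]→ₗ[F] F} {x : Fin m → V} (hx : Generic ω x)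
    (i j k l : Fin m) :
    ω ![x i, x j] * ω ![x k, x l] - ω ![x i, x k] * ω ![x j, x l] +
      ω ![x i, x l] * ω ![x j, x k] = 0 := by
  obtain ⟨y, -, μ, r, -, -, h⟩ := hx
  have h1 : ∀ i j, ω ![x i, x j] = μ * (r i * r j) * (y i 0 * y j 1 - y i 1 * y j 0) := by
    intro i j
    have := h ![i, j]
    simpa [Fin.prod_univ_succ, comp_vecCons, comp_vecEmpty, stdVol_two] using this
  simp only [h1]
  ring

lemma crossRatio_swap_zero_one (ω : V [⋀^Fin 2]→ₗ[F] F) (x : Fin 4 → V) :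
    crossRatio ω (x ∘ swap 0 1) = (crossRatio ω x)⁻¹ := by
  rw [crossRatio, crossRatio, inv_div]
  change ω ![x 1, x 2] * ω ![x 0, x 3] / (ω ![x 1, x 3] * ω ![x 0, x 2]) = _
  congr 1 <;> ring

lemma crossRatio_swap_two_three (ω : V [⋀^Fin 2]→ₗ[F] F) (x : Fin 4 → V) :
    crossRatio ω (x ∘ swap 2 3) = (crossRatio ω x)⁻¹ := by
  rw [crossRatio, crossRatio, inv_div]
  rfl

lemma one_sub_crossRatio {ω : V [⋀^Fin 2]→ₗ[F] F} {x : Fin 4 → V} (hx : Generic ω x) :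
    1 - crossRatio ω x =
      -(ω ![x 0, x 1] * ω ![x 2, x 3]) / (ω ![x 0, x 3] * ω ![x 1, x 2]) := by
  have h03 := hx.ne_zero₂ (show (0 : Fin 4) ≠ 3 by decide)
  have h12 := hx.ne_zero₂ (show (1 : Fin 4) ≠ 2 by decide)
  rw [crossRatio, eq_div_iff (mul_ne_zero h03 h12), sub_mul,
    div_mul_cancel₀ _ (mul_ne_zero h03 h12)]
  linear_combination hx.plucker 0 1 2 3

lemma crossRatio_swap_one_two {ω : V [⋀^Fin 2]→ₗ[F] F} {x : Fin 4 → V} (hx : Generic ω x) :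
    crossRatio ω (x ∘ swap 1 2) = 1 - crossRatio ω x := by
  rw [one_sub_crossRatio hx, crossRatio]
  change ω ![x 0, x 1] * ω ![x 2, x 3] / (ω ![x 0, x 3] * ω ![x 2, x 1]) = _
  rw [map_swap₂ ω (x 2) (x 1), mul_neg, div_neg, neg_div]

lemma crossRatio_ne_zero {ω : V [⋀^Fin 2]→ₗ[F] F} {x : Fin 4 → V} (hx : Generic ω x) :
    crossRatio ω x ≠ 0 := by
  refine div_ne_zero (mul_ne_zero ?_ ?_) (mul_ne_zero ?_ ?_) <;> exact hx.ne_zero₂ (by decide)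

lemma crossRatio_ne_one {ω : V [⋀^Fin 2]→ₗ[F] F} {x : Fin 4 → V} (hx : Generic ω x) :
    crossRatio ω x ≠ 1 := by
  intro h
  have h1 := one_sub_crossRatio hx
  rw [h, sub_self] at h1
  refine div_ne_zero (neg_ne_zero.2 (mul_ne_zero ?_ ?_)) (mul_ne_zero ?_ ?_) h1.symm <;>
    exact hx.ne_zero₂ (by decide)

/-- Five points in general position on the line exist only if the field has at least four
elements: two of the cross-ratios which they determine are distinct. -/
lemma Generic.hasFourElements {ω : V [⋀^Fin 2]→ₗ[F] F} {x : Fin 5 → V} (hx : Generic ω x) :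
    HasFourElements F := by
  have h1 : Generic ω (x ∘ ![0, 1, 2, 3]) := hx.comp (by decide)
  have h2 : Generic ω (x ∘ ![0, 1, 2, 4]) := hx.comp (by decide)
  refine ⟨_, _, crossRatio_ne_zero h1, crossRatio_ne_one h1, crossRatio_ne_zero h2,
    crossRatio_ne_one h2, fun h => ?_⟩
  simp only [crossRatio, Function.comp, Matrix.cons_val] at h
  have e02 := hx.ne_zero₂ (show (0 : Fin 5) ≠ 2 by decide)
  have e03 := hx.ne_zero₂ (show (0 : Fin 5) ≠ 3 by decide)
  have e04 := hx.ne_zero₂ (show (0 : Fin 5) ≠ 4 by decide)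
  have e12 := hx.ne_zero₂ (show (1 : Fin 5) ≠ 2 by decide)
  have e01 := hx.ne_zero₂ (show (0 : Fin 5) ≠ 1 by decide)
  have e34 := hx.ne_zero₂ (show (3 : Fin 5) ≠ 4 by decide)
  rw [div_eq_div_iff (mul_ne_zero e03 e12) (mul_ne_zero e04 e12)] at h
  have h3 := hx.plucker 0 1 3 4
  have h4 : ω ![x 0, x 2] * ω ![x 1, x 2] * (ω ![x 0, x 1] * ω ![x 3, x 4]) = 0 := by
    linear_combination ω ![x 0, x 2] * ω ![x 1, x 2] * h3 - h
  exact mul_ne_zero (mul_ne_zero e02 e12) (mul_ne_zero e01 e34) h4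

/-- The class of the cross-ratio in `B₂(F)` is skew-symmetric. -/
lemma sym2_crossRatio_perm (hF : HasFourElements F) {ω : V [⋀^Fin 2]→ₗ[F] F} (σ : Perm (Fin 4)) :
    ∀ {x : Fin 4 → V}, Generic ω x →
      sym2 (crossRatio ω (x ∘ σ)) = sgn σ • sym2 (crossRatio ω x) := by
  have hσ : σ ∈ Submonoid.closure (Set.range fun i : Fin 3 => swap i.castSucc i.succ) := by
    rw [Perm.mclosure_swap_castSucc_succ]
    trivial
  induction hσ using Submonoid.closure_induction with
  | mem τ hτ =>
    intro x hx
    obtain ⟨i, rfl⟩ := hτ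
    rw [sgn_swap (by simp [Fin.ext_iff]), neg_smul, one_smul]
    fin_cases i
    · exact (congrArg sym2 (crossRatio_swap_zero_one ω x)).trans (sym2_inv hF _)
    · exact (congrArg sym2 (crossRatio_swap_one_two hx)).trans (sym2_one_sub hF _)
    · exact (congrArg sym2 (crossRatio_swap_two_three ω x)).trans (sym2_inv hF _)
  | one => intro x _; simp
  | mul τ τ' _ _ h h' =>
    intro x hx
    have h1 : x ∘ (τ * τ' : Perm (Fin 4)) = (x ∘ τ) ∘ τ' := rfl
    rw [h1, h' (hx.comp τ.injective), h hx, smul_smul, sgn_mul, mul_comm]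

/-- The five-term relation, in the form of a substitution formula. -/
lemma sym2_crossRatio_subst (hF : HasFourElements F) {ω : V [⋀^Fin 2]→ₗ[F] F} {x : Fin 5 → V}
    (hx : Generic ω x) :
    sym2 (crossRatio ω (x ∘ ![0, 1, 2, 3])) = sym2 (crossRatio ω (x ∘ ![4, 1, 2, 3])) +
      sym2 (crossRatio ω (x ∘ ![0, 4, 2, 3])) + sym2 (crossRatio ω (x ∘ ![0, 1, 4, 3])) +
        sym2 (crossRatio ω (x ∘ ![0, 1, 2, 4])) := by
  have h := five_term hx
  have key : ∀ (e e' : Fin 4 → Fin 5) (τ : Perm (Fin 4)) (z : ℤˣ), Function.Injective e →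
      e' = e ∘ τ → Perm.sign τ = z →
      sym2 (crossRatio ω (x ∘ e')) = ((z : ℤ) : ℚ) • sym2 (crossRatio ω (x ∘ e)) := by
    rintro e _ τ z he rfl hz
    rw [← sgn_eq τ hz]
    exact sym2_crossRatio_perm hF τ (hx.comp he)
  rw [Fin.sum_univ_five, key ![4, 1, 2, 3] (Fin.succAbove 0)
      (swap 0 1 * swap 1 2 * swap 2 3) (-1) (by decide) (by decide) (by decide),
    key ![0, 4, 2, 3] (Fin.succAbove 1) (swap 1 2 * swap 2 3) 1 (by decide) (by decide) (by decide),
    key ![0, 1, 4, 3] (Fin.succAbove 2) (swap 2 3) (-1) (by decide) (by decide) (by decide),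
    key ![0, 1, 2, 4] (Fin.succAbove 3) 1 1 (by decide) (by decide) (by decide),
    key ![0, 1, 2, 3] (Fin.succAbove 4) 1 1 (by decide) (by decide) (by decide)] at h
  norm_num at h
  rw [← sub_eq_zero, ← h]
  abel

/-- The dual five-term relation: by Gale duality it is the five-term relation. -/
lemma dual_five_term {ω : V [⋀^Fin 3]→ₗ[F] F} {x : Fin 5 → V} (hx : Generic ω x) :
    ∑ i : Fin 5, (-1 : ℚ) ^ (i : ℕ) •
      sym2 (crossRatio (ω.curryLeft (x i)) (x ∘ i.succAbove)) = 0 := by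
  obtain ⟨y, hy, hs⟩ := hx
  obtain ⟨z, c, hz, hc, key⟩ := exists_gale_dual (a := 3) (b := 2) y hy
  rw [← five_term hz.generic]
  refine Finset.sum_congr rfl fun i _ => ?_
  rw [(hs.curryLeft i).crossRatio_eq i.succAbove]
  congr 2
  have h0 : i = i.cycleRange.symm 0 := (Fin.cycleRange_symm_zero i).symm
  have h1 : i.succAbove = i.cycleRange.symm ∘ Fin.succ := by
    funext k
    simp
  set π := i.cycleRange.symm
  rw [h1]
  conv_lhs => rw [h0]
  simp only [crossRatio, AlternatingMap.curryLeft_apply_apply, Function.comp]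
  set ε : F := ((Perm.sign π : ℤ) : F) with hε
  have hε0 : ε ≠ 0 := by
    rcases Int.units_eq_one_or (Perm.sign π) with h | h <;> simp [hε, h]
  have t : ∀ (τ : Perm (Fin 5)) (s : ℤˣ), Perm.sign τ = s →
      stdVol F 3 ![y (π (τ 0)), y (π (τ 1)), y (π (τ 2))] =
        c * (ε * ((s : ℤ) : F)) * stdVol F 2 ![z (π (τ 3)), z (π (τ 4))] := by
    rintro τ _ rfl
    have h := key (π * τ)
    rw [Perm.sign_mul, Units.val_mul, Int.cast_mul] at h
    convert h using 2
    · funext j; fin_cases j <;> rfl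
    · congr 1; funext j; fin_cases j <;> rfl
  have t1 := t (swap 2 3) (-1) (by decide)
  have t2 := t (swap 1 2 * swap 2 4 * swap 4 3) (-1) (by decide)
  have t3 := t (swap 2 4 * swap 4 3) 1 (by decide)
  have t4 := t (swap 1 2 * swap 2 3) 1 (by decide)
  have u1 := hz.generic.ne_zero₂ (π.injective.ne (show (1 : Fin 5) ≠ 4 by decide))
  have u2 := hz.generic.ne_zero₂ (π.injective.ne (show (2 : Fin 5) ≠ 3 by decide))
  change stdVol F 3 ![y (π 0), y (π 1), y (π 3)] =
    c * (ε * ((-1 : ℤ) : F)) * stdVol F 2 ![z (π 2), z (π 4)] at t1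
  change stdVol F 3 ![y (π 0), y (π 2), y (π 4)] =
    c * (ε * ((-1 : ℤ) : F)) * stdVol F 2 ![z (π 1), z (π 3)] at t2
  change stdVol F 3 ![y (π 0), y (π 1), y (π 4)] =
    c * (ε * ((1 : ℤ) : F)) * stdVol F 2 ![z (π 2), z (π 3)] at t3
  change stdVol F 3 ![y (π 0), y (π 2), y (π 3)] =
    c * (ε * ((1 : ℤ) : F)) * stdVol F 2 ![z (π 1), z (π 4)] at t4
  change stdVol F 3 ![y (π 0), y (π 1), y (π 3)] * stdVol F 3 ![y (π 0), y (π 2), y (π 4)] /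
    (stdVol F 3 ![y (π 0), y (π 1), y (π 4)] * stdVol F 3 ![y (π 0), y (π 2), y (π 3)]) =
    stdVol F 2 ![z (π 1), z (π 3)] * stdVol F 2 ![z (π 2), z (π 4)] /
    (stdVol F 2 ![z (π 1), z (π 4)] * stdVol F 2 ![z (π 2), z (π 3)])
  rw [t1, t2, t3, t4]
  push_cast
  field_simp

/-- The dual five-term relation, in the form of a substitution formula. -/
lemma sym2_crossRatio_dual_subst (hF : HasFourElements F) {ω : V [⋀^Fin 3]→ₗ[F] F} {x : Fin 5 → V}
    (hx : Generic ω x) :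
    sym2 (crossRatio (ω.curryLeft (x 0)) (x ∘ ![1, 2, 3, 4])) =
      sym2 (crossRatio (ω.curryLeft (x 1)) (x ∘ ![0, 2, 3, 4])) +
      sym2 (crossRatio (ω.curryLeft (x 2)) (x ∘ ![1, 0, 3, 4])) +
      sym2 (crossRatio (ω.curryLeft (x 3)) (x ∘ ![1, 2, 0, 4])) +
      sym2 (crossRatio (ω.curryLeft (x 4)) (x ∘ ![1, 2, 3, 0])) := by
  have h := dual_five_term hx
  have key : ∀ (i : Fin 5) (e e' : Fin 4 → Fin 5) (τ : Perm (Fin 4)) (z : ℤˣ),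
      Function.Injective e → (∀ j, e j ≠ i) → e' = e ∘ τ → Perm.sign τ = z →
      sym2 (crossRatio (ω.curryLeft (x i)) (x ∘ e')) =
        ((z : ℤ) : ℚ) • sym2 (crossRatio (ω.curryLeft (x i)) (x ∘ e)) := by
    rintro i e _ τ z he hi rfl hz
    rw [← sgn_eq τ hz]
    exact sym2_crossRatio_perm hF τ (hx.proj i he hi (by norm_num))
  rw [Fin.sum_univ_five,
    key 0 ![1, 2, 3, 4] (Fin.succAbove 0) 1 1 (by decide) (by decide) (by decide) (by decide),
    key 1 ![0, 2, 3, 4] (Fin.succAbove 1) 1 1 (by decide) (by decide) (by decide) (by decide),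
    key 2 ![1, 0, 3, 4] (Fin.succAbove 2) (swap 0 1) (-1) (by decide) (by decide) (by decide)
      (by decide),
    key 3 ![1, 2, 0, 4] (Fin.succAbove 3) (swap 0 2 * swap 2 1) 1 (by decide) (by decide)
      (by decide) (by decide),
    key 4 ![1, 2, 3, 0] (Fin.succAbove 4) (swap 0 3 * swap 3 2 * swap 2 1) (-1) (by decide)
      (by decide) (by decide) (by decide)] at h
  norm_num at h
  rw [← sub_eq_zero, ← h]
  abel

end CrossRatios

/-! ### The generalized cross-ratio of six points of the plane -/

section TripleRatios

variable {F V W : Type*} [Field F] [AddCommGroup V] [Module F V] [AddCommGroup W] [Module F W]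
  {n m k : ℕ}

lemma Generic.ne_zero₃ {ω : V [⋀^Fin 3]→ₗ[F] F} {x : Fin m → V} (hx : Generic ω x)
    {i j k : Fin m} (hij : i ≠ j) (hik : i ≠ k) (hjk : j ≠ k) : ω ![x i, x j, x k] ≠ 0 := by
  have := hx.ne_zero (e := ![i, j, k]) (by
    intro a b hab
    fin_cases a <;> fin_cases b <;>
      first
        | rfl
        | exact absurd hab hij
        | exact absurd hab.symm hij
        | exact absurd hab hik
        | exact absurd hab.symm hik
        | exact absurd hab hjk
        | exact absurd hab.symm hjk)
  simpa [comp_vecCons, comp_vecEmpty] using this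

lemma ScaledBy.tripleRatio_eq {ω : V [⋀^Fin 3]→ₗ[F] F} {ω' : W [⋀^Fin 3]→ₗ[F] F} {x : Fin m → V}
    {x' : Fin m → W} (h : ScaledBy ω ω' x x') (e : Fin 6 → Fin m) :
    tripleRatio ω' (x' ∘ e) = tripleRatio ω (x ∘ e) := by
  obtain ⟨μ, l, hμ, hl, h⟩ := h
  have h1 : ∀ i j k : Fin 6, ω' ![(x' ∘ e) i, (x' ∘ e) j, (x' ∘ e) k] =
      μ * (l (e i) * l (e j) * l (e k)) * ω ![(x ∘ e) i, (x ∘ e) j, (x ∘ e) k] := by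
    intro i j k
    have := h ![e i, e j, e k]
    simpa [Fin.prod_univ_succ, comp_vecCons, comp_vecEmpty, mul_assoc] using this
  have hl' := fun i => hl (e i)
  simp only [tripleRatio, h1]
  have hc : μ ^ 3 * ((l (e 0) * l (e 1) * l (e 2)) ^ 2 * (l (e 3) * l (e 4) * l (e 5))) ≠ 0 :=
    mul_ne_zero (pow_ne_zero _ hμ) (mul_ne_zero
      (pow_ne_zero _ (mul_ne_zero (mul_ne_zero (hl' 0) (hl' 1)) (hl' 2)))
      (mul_ne_zero (mul_ne_zero (hl' 3) (hl' 4)) (hl' 5)))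
  conv_rhs => rw [← mul_div_mul_left _ _ hc]
  congr 1 <;> ring

lemma ScaledBy.preR3_eq {ω : V [⋀^Fin 3]→ₗ[F] F} {ω' : W [⋀^Fin 3]→ₗ[F] F} {x : Fin m → V}
    {x' : Fin m → W} (h : ScaledBy ω ω' x x') (e : Fin 6 → Fin m) :
    preR3 ω' (x' ∘ e) = preR3 ω (x ∘ e) := by
  rw [preR3, preR3]
  refine congrArg (fun t => (1 / 15 : ℚ) • t) (Finset.sum_congr rfl fun σ _ => ?_)
  exact congrArg (fun t => ((Perm.sign σ : ℤ) : ℚ) • pre3 t) (h.tripleRatio_eq (e ∘ σ))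

lemma ScaledBy.r3_eq {ω : V [⋀^Fin 3]→ₗ[F] F} {ω' : W [⋀^Fin 3]→ₗ[F] F} {x : Fin m → V}
    {x' : Fin m → W} (h : ScaledBy ω ω' x x') (e : Fin 6 → Fin m) :
    r3 ω' (x' ∘ e) = r3 ω (x ∘ e) := by
  rw [r3, r3, h.preR3_eq]

lemma r3_perm (ω : V [⋀^Fin 3]→ₗ[F] F) (x : Fin 6 → V) (τ : Perm (Fin 6)) :
    r3 ω (x ∘ τ) = sgn τ • r3 ω x := by
  rw [r3, r3, ← map_smul]
  refine congrArg (R3 F).mkQ ?_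
  rw [preR3, preR3, smul_comm (sgn τ)]
  refine congrArg (fun t : Fˣ →₀ ℚ => (1 / 15 : ℚ) • t) ?_
  rw [Finset.smul_sum]
  refine Fintype.sum_equiv (Equiv.mulLeft τ) _ _ fun σ => ?_
  change sgn σ • _ = sgn τ • sgn (τ * σ) • _
  rw [smul_smul, sgn_mul, ← mul_assoc, sgn_mul_self, one_mul]
  rfl

/-- The seven-term relation for seven points of a projected configuration. -/
lemma seven_term {ω : V [⋀^Fin 3]→ₗ[F] F} {x : Fin 7 → V} (hx : Generic ω x) :
    ∑ i : Fin 7, (-1 : ℚ) ^ (i : ℕ) • r3 ω (x ∘ i.succAbove) = 0 := by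
  obtain ⟨y, hy, hs⟩ := hx
  simp only [hs.r3_eq]
  simp only [r3, ← map_smul, ← map_sum]
  exact (Submodule.Quotient.mk_eq_zero _).2 (Submodule.subset_span (Or.inl (Or.inr ⟨y, hy, rfl⟩)))

/-- Complementary volumes being proportional, the triple ratio of six projected points equals a
triple ratio of the Gale dual points. -/
lemma tripleRatio_gale_dual {y : Fin 7 → (Fin 4 → F)} {z : Fin 7 → (Fin 3 → F)} {c : F}
    (hz : GenericVectors z) (hc : c ≠ 0)
    (key : ∀ σ : Perm (Fin 7), stdVol F 4 (y ∘ σ ∘ Fin.castAdd 3) =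
        c * ((Perm.sign σ : ℤ) : F) * stdVol F 3 (z ∘ σ ∘ Fin.natAdd 4)) (P : Perm (Fin 7)) :
    tripleRatio ((stdVol F 4).curryLeft (y (P 0))) (fun k : Fin 6 => y (P k.succ)) =
      tripleRatio (stdVol F 3)
        (fun k : Fin 6 => z (P ((swap 0 4 * swap 1 3 * swap 2 5 : Perm (Fin 6)) k).succ)) := by
  simp only [tripleRatio, AlternatingMap.curryLeft_apply_apply]
  set ε : F := ((Perm.sign P : ℤ) : F) with hε
  have hε0 : ε ≠ 0 := by
    rcases Int.units_eq_one_or (Perm.sign P) with h | h <;> simp [hε, h]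
  have t : ∀ (τ : Perm (Fin 7)) (s : ℤˣ), Perm.sign τ = s →
      stdVol F 4 ![y (P (τ 0)), y (P (τ 1)), y (P (τ 2)), y (P (τ 3))] =
        c * (ε * ((s : ℤ) : F)) * stdVol F 3 ![z (P (τ 4)), z (P (τ 5)), z (P (τ 6))] := by
    rintro τ _ rfl
    have h := key (P * τ)
    rw [Perm.sign_mul, Units.val_mul, Int.cast_mul] at h
    convert h using 2
    · funext j; fin_cases j <;> rfl
    · refine congrArg _ ?_; funext j; fin_cases j <;> rfl
  have t1 := t ⟨![0, 1, 2, 4, 6, 5, 3], ![0, 1, 2, 6, 3, 5, 4], by decide, by decide⟩ 1 (by decide)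
  change stdVol F 4 ![y (P 0), y (P 1), y (P 2), y (P 4)] =
    c * (ε * ((1 : ℤ) : F)) * stdVol F 3 ![z (P 6), z (P 5), z (P 3)] at t1
  have t2 := t ⟨![0, 2, 3, 5, 4, 6, 1], ![0, 6, 1, 2, 4, 3, 5], by decide, by decide⟩ 1 (by decide)
  change stdVol F 4 ![y (P 0), y (P 2), y (P 3), y (P 5)] =
    c * (ε * ((1 : ℤ) : F)) * stdVol F 3 ![z (P 4), z (P 6), z (P 1)] at t2
  have t3 := t ⟨![0, 3, 1, 6, 5, 4, 2], ![0, 2, 6, 1, 5, 4, 3], by decide, by decide⟩ 1 (by decide)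
  change stdVol F 4 ![y (P 0), y (P 3), y (P 1), y (P 6)] =
    c * (ε * ((1 : ℤ) : F)) * stdVol F 3 ![z (P 5), z (P 4), z (P 2)] at t3
  have t4 := t ⟨![0, 1, 2, 5, 4, 6, 3], ![0, 1, 2, 6, 4, 3, 5], by decide, by decide⟩ 1 (by decide)
  change stdVol F 4 ![y (P 0), y (P 1), y (P 2), y (P 5)] =
    c * (ε * ((1 : ℤ) : F)) * stdVol F 3 ![z (P 4), z (P 6), z (P 3)] at t4
  have t5 := t ⟨![0, 2, 3, 6, 5, 4, 1], ![0, 6, 1, 2, 5, 4, 3], by decide, by decide⟩ 1 (by decide)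
  change stdVol F 4 ![y (P 0), y (P 2), y (P 3), y (P 6)] =
    c * (ε * ((1 : ℤ) : F)) * stdVol F 3 ![z (P 5), z (P 4), z (P 1)] at t5
  have t6 := t ⟨![0, 3, 1, 4, 6, 5, 2], ![0, 2, 6, 1, 3, 5, 4], by decide, by decide⟩ 1 (by decide)
  change stdVol F 4 ![y (P 0), y (P 3), y (P 1), y (P 4)] =
    c * (ε * ((1 : ℤ) : F)) * stdVol F 3 ![z (P 6), z (P 5), z (P 2)] at t6
  change (stdVol F 4 ![y (P 0), y (P 1), y (P 2), y (P 4)] *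
      stdVol F 4 ![y (P 0), y (P 2), y (P 3), y (P 5)] *
      stdVol F 4 ![y (P 0), y (P 3), y (P 1), y (P 6)]) /
    (stdVol F 4 ![y (P 0), y (P 1), y (P 2), y (P 5)] *
      stdVol F 4 ![y (P 0), y (P 2), y (P 3), y (P 6)] *
      stdVol F 4 ![y (P 0), y (P 3), y (P 1), y (P 4)]) =
    (stdVol F 3 ![z (P 5), z (P 4), z (P 2)] *
      stdVol F 3 ![z (P 4), z (P 6), z (P 1)] *
      stdVol F 3 ![z (P 6), z (P 5), z (P 3)]) /
    (stdVol F 3 ![z (P 5), z (P 4), z (P 1)] *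
      stdVol F 3 ![z (P 4), z (P 6), z (P 3)] *
      stdVol F 3 ![z (P 6), z (P 5), z (P 2)])
  have u : ∀ {i j k : Fin 7}, i ≠ j → i ≠ k → j ≠ k → stdVol F 3 ![z (P i), z (P j), z (P k)] ≠ 0 :=
    fun hij hik hjk => hz.generic.ne_zero₃ (P.injective.ne hij) (P.injective.ne hik)
      (P.injective.ne hjk)
  have u4 := u (show (4 : Fin 7) ≠ 6 by decide) (show (4 : Fin 7) ≠ 3 by decide) (by decide)
  have u5 := u (show (5 : Fin 7) ≠ 4 by decide) (show (5 : Fin 7) ≠ 1 by decide) (by decide)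
  have u6 := u (show (6 : Fin 7) ≠ 5 by decide) (show (6 : Fin 7) ≠ 2 by decide) (by decide)
  rw [t1, t2, t3, t4, t5, t6]
  push_cast
  field_simp

/-- The dual seven-term relation. Gale duality turns the triple ratio of six points into a triple
ratio of the dual points, with the points permuted by the odd permutation `(0 4)(1 3)(2 5)`. So
this is the seven-term relation for the dual configuration. -/
lemma dual_seven_term {ω : V [⋀^Fin 4]→ₗ[F] F} {x : Fin 7 → V} (hx : Generic ω x) :
    ∑ i : Fin 7, (-1 : ℚ) ^ (i : ℕ) • r3 (ω.curryLeft (x i)) (x ∘ i.succAbove) = 0 := by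
  obtain ⟨y, hy, hs⟩ := hx
  obtain ⟨z, c, hz, hc, key⟩ := exists_gale_dual (a := 4) (b := 3) y hy
  rw [← neg_eq_zero, ← seven_term hz.generic, ← Finset.sum_neg_distrib]
  refine Finset.sum_congr rfl fun i _ => ?_
  rw [(hs.curryLeft i).r3_eq i.succAbove, ← smul_neg]
  refine congrArg (fun t : B3 F => (-1 : ℚ) ^ (i : ℕ) • t) ?_
  let ρ : Perm (Fin 6) := swap 0 4 * swap 1 3 * swap 2 5
  rw [r3, r3, ← map_neg]
  refine congrArg (R3 F).mkQ ?_
  rw [preR3, preR3, ← smul_neg]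
  refine congrArg (fun t : Fˣ →₀ ℚ => (1 / 15 : ℚ) • t) ?_
  rw [← Finset.sum_neg_distrib]
  refine Fintype.sum_equiv (Equiv.mulRight ρ) _ _ fun σ => ?_
  let P : Perm (Fin 7) := i.cycleRange.symm * Perm.decomposeFin.symm (0, σ)
  have h0 : P 0 = i := cycleRange_symm_mul_zero i σ
  have h1 : ∀ k, P k.succ = i.succAbove (σ k) := fun k => cycleRange_symm_mul_succ i σ k
  have h2 := tripleRatio_gale_dual hz hc key P
  simp only [h0, h1] at h2
  rw [Equiv.coe_mulRight, ← neg_smul]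
  have h3 : sgn (σ * ρ) = -sgn σ := by
    rw [sgn_mul, sgn_eq ρ (z := -1) (by decide)]
    simp
  change (-sgn σ) • (_ : Fˣ →₀ ℚ) = sgn (σ * ρ) • (_ : Fˣ →₀ ℚ)
  rw [h3]
  exact congrArg (fun t : F => (-sgn σ) • pre3 t) h2

end TripleRatios

open scoped Pointwise

/-! ### The map `a₃` under the alternating sum -/

section BlockPermutations

/-- The permutation of eight indices which permutes the first four by `α`, the last four by `β`. -/
def blockPerm (α β : Perm (Fin 4)) : Perm (Fin 8) :=
  (finSumFinEquiv (m := 4) (n := 4)).permCongr (sumCongr α β)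

lemma blockPerm_castAdd (α β : Perm (Fin 4)) (k : Fin 4) :
    blockPerm α β (Fin.castAdd 4 k) = Fin.castAdd 4 (α k) := by
  rw [blockPerm, Equiv.permCongr_apply, finSumFinEquiv_symm_apply_castAdd]
  rfl

lemma blockPerm_natAdd (α β : Perm (Fin 4)) (k : Fin 4) :
    blockPerm α β (Fin.natAdd 4 k) = Fin.natAdd 4 (β k) := by
  rw [blockPerm, Equiv.permCongr_apply, finSumFinEquiv_symm_apply_natAdd]
  rfl

lemma sgn_blockPerm (α β : Perm (Fin 4)) : sgn (blockPerm α β) = sgn α * sgn β := by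
  have h : Perm.sign (blockPerm α β) = Perm.sign α * Perm.sign β := by
    rw [blockPerm, Perm.sign_permCongr, Perm.sign_sumCongr]
  simp [sgn, h]

lemma blockPerm_smul_left (α β : Perm (Fin 4)) :
    blockPerm α β • ({0, 1, 2, 3} : Finset (Fin 8)) = {0, 1, 2, 3} := by
  have h : ({0, 1, 2, 3} : Finset (Fin 8)) = Finset.univ.image (Fin.castAdd 4) := by decide
  rw [h, Finset.smul_finset_def, Finset.image_image]
  have : (fun k => blockPerm α β • k) ∘ Fin.castAdd 4 = Fin.castAdd 4 ∘ α := by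
    funext k
    exact blockPerm_castAdd α β k
  rw [this, ← Finset.image_image, Finset.image_univ_equiv]

lemma blockPerm_smul_right (α β : Perm (Fin 4)) :
    blockPerm α β • ({4, 5, 6, 7} : Finset (Fin 8)) = {4, 5, 6, 7} := by
  have h : ({4, 5, 6, 7} : Finset (Fin 8)) = Finset.univ.image (Fin.natAdd 4 : Fin 4 → Fin 8) := by
    decide
  rw [h, Finset.smul_finset_def, Finset.image_image]
  have : (fun k => blockPerm α β • k) ∘ (Fin.natAdd 4 : Fin 4 → Fin 8) = Fin.natAdd 4 ∘ β := by
    funext k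
    exact blockPerm_natAdd α β k
  rw [this, ← Finset.image_image, Finset.image_univ_equiv]

/-- Signed sums over permutations which do not change the second factor are absorbed by the
alternating sum. -/
lemma sum_tmul_absorb {A B : Type*} [AddCommGroup A] [Module ℚ A] [AddCommGroup B] [Module ℚ B]
    {m : ℕ} {ι : Type*} [Fintype ι] (τ : ι → Perm (Fin m)) (q : Perm (Fin m) → A)
    (U : Perm (Fin m) → B) (hU : ∀ σ i, U (σ * τ i) = U σ) :
    ∑ σ, sgn σ • ((∑ i, sgn (τ i) • q (σ * τ i)) ⊗ₜ[ℚ] U σ) =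
      (Fintype.card ι : ℚ) • ∑ σ, sgn σ • (q σ ⊗ₜ[ℚ] U σ) := by
  have h : ∀ σ, sgn σ • ((∑ i, sgn (τ i) • q (σ * τ i)) ⊗ₜ[ℚ] U σ) =
      ∑ i, sgn (σ * τ i) • (q (σ * τ i) ⊗ₜ[ℚ] U (σ * τ i)) := by
    intro σ
    rw [TensorProduct.sum_tmul, Finset.smul_sum]
    refine Finset.sum_congr rfl fun i _ => ?_
    rw [hU, sgn_mul, mul_smul, TensorProduct.smul_tmul']
    rfl
  simp only [h]
  rw [Finset.sum_comm]
  have h' : ∀ i, ∑ σ, sgn (σ * τ i) • (q (σ * τ i) ⊗ₜ[ℚ] U (σ * τ i)) =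
      ∑ σ, sgn σ • (q σ ⊗ₜ[ℚ] U σ) := fun i =>
    Fintype.sum_equiv (Equiv.mulRight (τ i)) _ _ fun σ => rfl
  simp only [h', Finset.sum_const, Finset.card_univ]
  rw [← Nat.cast_smul_eq_nsmul ℚ]

lemma sum_blockPerm {A : Type*} [AddCommGroup A] [Module ℚ A]
    (G : Perm (Fin 4) → Perm (Fin 4) → A) :
    ∑ p : Perm (Fin 4) × Perm (Fin 4), sgn (blockPerm p.1 p.2) • G p.1 p.2 =
      ∑ i : Fin 4, ∑ j : Fin 4, (-1 : ℚ) ^ ((i : ℕ) + (j : ℕ)) •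
        ∑ α : Perm (Fin 3), ∑ β : Perm (Fin 3), (sgn α * sgn β) •
          G (i.cycleRange.symm * Perm.decomposeFin.symm (0, α))
            (j.cycleRange.symm * Perm.decomposeFin.symm (0, β)) := by
  rw [Fintype.sum_prod_type]
  have h : ∀ P : Perm (Fin 4), ∑ Q : Perm (Fin 4), sgn (blockPerm P Q) • G P Q =
      sgn P • ∑ Q : Perm (Fin 4), sgn Q • G P Q := by
    intro P
    rw [Finset.smul_sum]
    exact Finset.sum_congr rfl fun Q _ => by rw [sgn_blockPerm, mul_smul]
  simp only [h]
  rw [sum_perm_succ]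
  refine Finset.sum_congr rfl fun i _ => ?_
  simp only [pow_add, mul_smul]
  rw [← Finset.smul_sum]
  congr 1
  have h' : ∀ α : Perm (Fin 3), ∑ Q : Perm (Fin 4), sgn Q •
      G (i.cycleRange.symm * Perm.decomposeFin.symm (0, α)) Q = _ := fun α => sum_perm_succ _
  simp only [h', Finset.smul_sum]
  rw [Finset.sum_comm]
  refine Finset.sum_congr rfl fun j _ => Finset.sum_congr rfl fun α _ =>
    Finset.sum_congr rfl fun β _ => smul_comm _ _ _

lemma sum_sgn_mul_right {A : Type*} [AddCommGroup A] [Module ℚ A] {m : ℕ}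
    (f : Perm (Fin m) → A) (τ : Perm (Fin m)) :
    ∑ σ, sgn σ • f (σ * τ) = sgn τ • ∑ σ, sgn σ • f σ := by
  rw [Finset.smul_sum]
  refine Fintype.sum_equiv (Equiv.mulRight τ) _ _ fun σ => ?_
  rw [Equiv.coe_mulRight, smul_smul, sgn_mul, mul_comm (sgn σ), ← mul_assoc, sgn_mul_self, one_mul]

end BlockPermutations

section Reduction

variable {F V W : Type*} [Field F] [AddCommGroup V] [Module F V] [AddCommGroup W] [Module F W]
  {m : ℕ}

/-- `r₃(x_{e₀} | x_{e₁}, …, x_{e₆})`. -/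
noncomputable def projR3 (ω : V [⋀^Fin 4]→ₗ[F] F) (x : Fin m → V) (e : Fin 7 → Fin m) : B3 F :=
  r3 (ω.curryLeft (x (e 0))) (fun k : Fin 6 => x (e k.succ))

/-- The cross-ratio `r(x_{e₀}, x_{e₁} | x_{e₂}, …, x_{e₅})`. -/
noncomputable def projRatio (ω : V [⋀^Fin 4]→ₗ[F] F) (x : Fin m → V) (e : Fin 6 → Fin m) : F :=
  crossRatio ((ω.curryLeft (x (e 0))).curryLeft (x (e 1))) (fun k : Fin 4 => x (e k.succ.succ))

/-- The sum which defines `a₃'` consists of relabellings of one value of `r₃` by permutations of the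
vertices of the two tetrahedra. -/
lemma a3'_eq_sum (ω : V [⋀^Fin 4]→ₗ[F] F) (x : Fin 8 → V) (σ : Perm (Fin 8)) :
    a3' ω (fun k => x (σ (Fin.castAdd 4 k)))
      (fun k => x (σ (Fin.natAdd 4 k))) = ∑ p : Fin 4 × Fin 4,
        sgn (blockPerm p.1.cycleRange.symm p.2.cycleRange.symm) •
          projR3 ω x ((σ * blockPerm p.1.cycleRange.symm p.2.cycleRange.symm) •
            ![0, 1, 2, 3, 5, 6, 7]) := by
  rw [a3', Fintype.sum_prod_type]
  refine Finset.sum_congr rfl fun i _ => Finset.sum_congr rfl fun j _ => ?_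
  have hs : sgn (blockPerm i.cycleRange.symm j.cycleRange.symm) =
      (-1 : ℚ) ^ ((i : ℕ) + (j : ℕ)) := by
    rw [sgn_blockPerm, pow_add]
    simp [sgn, Fin.sign_cycleRange]
  rw [hs]
  refine congrArg (fun t : B3 F => (-1 : ℚ) ^ ((i : ℕ) + (j : ℕ)) • t) ?_
  have hl : ∀ k : Fin 4, blockPerm i.cycleRange.symm j.cycleRange.symm (Fin.castAdd 4 k) =
      Fin.castAdd 4 (i.cycleRange.symm k) := blockPerm_castAdd _ _
  have hr : ∀ k : Fin 4, blockPerm i.cycleRange.symm j.cycleRange.symm (Fin.natAdd 4 k) =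
      Fin.natAdd 4 (j.cycleRange.symm k) := blockPerm_natAdd _ _
  have hl' : ∀ k : Fin 3, blockPerm i.cycleRange.symm j.cycleRange.symm (Fin.castAdd 4 k.succ) =
      Fin.castAdd 4 (i.succAbove k) := fun k => by rw [hl, Fin.cycleRange_symm_succ]
  have hr' : ∀ k : Fin 3, blockPerm i.cycleRange.symm j.cycleRange.symm (Fin.natAdd 4 k.succ) =
      Fin.natAdd 4 (j.succAbove k) := fun k => by rw [hr, Fin.cycleRange_symm_succ]
  have h0 := hl 0
  rw [Fin.cycleRange_symm_zero] at h0
  set B := blockPerm i.cycleRange.symm j.cycleRange.symm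
  rw [projR3]
  have e0 : ((σ * B) • (![0, 1, 2, 3, 5, 6, 7] : Fin 7 → Fin 8)) 0 = σ (Fin.castAdd 4 i) :=
    congrArg σ h0
  rw [e0]
  refine congrArg (r3 _) ?_
  funext k
  fin_cases k
  · exact congrArg (fun t => x (σ t)) (hl' 0).symm
  · exact congrArg (fun t => x (σ t)) (hl' 1).symm
  · exact congrArg (fun t => x (σ t)) (hl' 2).symm
  · exact congrArg (fun t => x (σ t)) (hr' 0).symm
  · exact congrArg (fun t => x (σ t)) (hr' 1).symm
  · exact congrArg (fun t => x (σ t)) (hr' 2).symm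

/-- The sums over `i`, `j` and over the permutations in the definition of `μ₃` combine to a sum over
all permutations of the vertices of the two tetrahedra. -/
lemma a3''_eq_sum (ω : V [⋀^Fin 4]→ₗ[F] F) (x : Fin 8 → V) (σ : Perm (Fin 8)) :
    a3'' ω (fun k => x (σ (Fin.castAdd 4 k)))
      (fun k => x (σ (Fin.natAdd 4 k))) = (1 / 4 : ℚ) • ∑ p : Perm (Fin 4) × Perm (Fin 4),
        sgn (blockPerm p.1 p.2) • (sym3 (projRatio ω x ((σ * blockPerm p.1 p.2) •
            ![0, 4, 1, 6, 2, 5])) -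
          sym3 (projRatio ω x ((σ * blockPerm p.1 p.2 * swap 5 6) • ![0, 4, 1, 6, 2, 5]))) := by
  have hG : ∀ (i j : Fin 4) (α β : Perm (Fin 3)) (e : Fin 6 → Fin 8) (f : Fin 6 → V),
      (∀ k, x ((σ * blockPerm (i.cycleRange.symm * Perm.decomposeFin.symm (0, α))
        (j.cycleRange.symm * Perm.decomposeFin.symm (0, β))) (e k)) = f k) →
      projRatio ω x ((σ * blockPerm (i.cycleRange.symm * Perm.decomposeFin.symm (0, α))
        (j.cycleRange.symm * Perm.decomposeFin.symm (0, β))) • e) =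
      crossRatio ((ω.curryLeft (f 0)).curryLeft (f 1)) ![f 2, f 3, f 4, f 5] := by
    intro i j α β e f h
    rw [projRatio, ← h 0, ← h 1, ← h 2, ← h 3, ← h 4, ← h 5]
    refine congrArg (crossRatio _) ?_
    funext k
    fin_cases k <;> rfl
  have hl : ∀ (i j : Fin 4) (α β : Perm (Fin 3)),
      x ((σ * blockPerm (i.cycleRange.symm * Perm.decomposeFin.symm (0, α))
        (j.cycleRange.symm * Perm.decomposeFin.symm (0, β))) (Fin.castAdd 4 0)) =
          x (σ (Fin.castAdd 4 i)) ∧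
      x ((σ * blockPerm (i.cycleRange.symm * Perm.decomposeFin.symm (0, α))
        (j.cycleRange.symm * Perm.decomposeFin.symm (0, β))) (Fin.natAdd 4 (0 : Fin 4))) =
          x (σ (Fin.natAdd 4 j)) ∧
      (∀ k : Fin 3, x ((σ * blockPerm (i.cycleRange.symm * Perm.decomposeFin.symm (0, α))
        (j.cycleRange.symm * Perm.decomposeFin.symm (0, β))) (Fin.castAdd 4 k.succ)) =
          x (σ (Fin.castAdd 4 (i.succAbove (α k))))) ∧
      ∀ k : Fin 3, x ((σ * blockPerm (i.cycleRange.symm * Perm.decomposeFin.symm (0, α))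
        (j.cycleRange.symm * Perm.decomposeFin.symm (0, β))) (Fin.natAdd 4 k.succ)) =
          x (σ (Fin.natAdd 4 (j.succAbove (β k)))) := by
    intro i j α β
    refine ⟨?_, ?_, fun k => ?_, fun k => ?_⟩
    · rw [Perm.mul_apply, blockPerm_castAdd, cycleRange_symm_mul_zero]
    · rw [Perm.mul_apply, blockPerm_natAdd, cycleRange_symm_mul_zero]
    · rw [Perm.mul_apply, blockPerm_castAdd, cycleRange_symm_mul_succ]
    · rw [Perm.mul_apply, blockPerm_natAdd, cycleRange_symm_mul_succ]
  have e1 : ∀ (i j : Fin 4) (α β : Perm (Fin 3)),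
      projRatio ω x ((σ * blockPerm (i.cycleRange.symm * Perm.decomposeFin.symm (0, α))
        (j.cycleRange.symm * Perm.decomposeFin.symm (0, β))) • ![0, 4, 1, 6, 2, 5]) =
      crossRatio ((ω.curryLeft (x (σ (Fin.castAdd 4 i)))).curryLeft (x (σ (Fin.natAdd 4 j))))
        ![x (σ (Fin.castAdd 4 (i.succAbove (α 0)))), x (σ (Fin.natAdd 4 (j.succAbove (β 1)))),
          x (σ (Fin.castAdd 4 (i.succAbove (α 1)))),
          x (σ (Fin.natAdd 4 (j.succAbove (β 0))))] := by
    intro i j α β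
    obtain ⟨h0, h4, hl, hr⟩ := hl i j α β
    refine hG i j α β ![0, 4, 1, 6, 2, 5] ![_, _, _, _, _, _] fun k => ?_
    fin_cases k
    exacts [h0, h4, hl 0, hr 1, hl 1, hr 0]
  have e2 : ∀ (i j : Fin 4) (α β : Perm (Fin 3)),
      projRatio ω x ((σ * blockPerm (i.cycleRange.symm * Perm.decomposeFin.symm (0, α))
        (j.cycleRange.symm * Perm.decomposeFin.symm (0, β)) * swap 5 6) •
          ![0, 4, 1, 6, 2, 5]) =
      crossRatio ((ω.curryLeft (x (σ (Fin.castAdd 4 i)))).curryLeft (x (σ (Fin.natAdd 4 j))))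
        ![x (σ (Fin.castAdd 4 (i.succAbove (α 0)))), x (σ (Fin.natAdd 4 (j.succAbove (β 0)))),
          x (σ (Fin.castAdd 4 (i.succAbove (α 1)))),
          x (σ (Fin.natAdd 4 (j.succAbove (β 1))))] := by
    intro i j α β
    obtain ⟨h0, h4, hl, hr⟩ := hl i j α β
    rw [mul_smul, show swap (5 : Fin 8) 6 • (![0, 4, 1, 6, 2, 5] : Fin 6 → Fin 8) =
      ![0, 4, 1, 5, 2, 6] by decide]
    refine hG i j α β ![0, 4, 1, 5, 2, 6] ![_, _, _, _, _, _] fun k => ?_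
    fin_cases k
    exacts [h0, h4, hl 0, hr 0, hl 1, hr 1]
  rw [a3'', sum_blockPerm (fun P Q => sym3 (projRatio ω x ((σ * blockPerm P Q) •
    ![0, 4, 1, 6, 2, 5])) - sym3 (projRatio ω x ((σ * blockPerm P Q * swap 5 6) •
      ![0, 4, 1, 6, 2, 5]))), Finset.smul_sum]
  refine Finset.sum_congr rfl fun i _ => ?_
  rw [Finset.smul_sum]
  refine Finset.sum_congr rfl fun j _ => ?_
  rw [smul_comm, mu3]
  simp only [e1, e2]
  rfl

/-- Under an alternating sum whose second factor only depends on the two tetrahedra, the map `a₃`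
can be replaced by one value of `r₃` and one class of a cross-ratio. The coefficients are
`16 / 6` and `2 * 576 / (3 * 4)`: `16` choices of `i` and `j`, and `576` permutations of the
vertices of the two tetrahedra, for which both cross-ratios in `μ₃` contribute the same. -/
lemma sum_a3Vec_tmul {B : Type*} [AddCommGroup B] [Module ℚ B] (ω : V [⋀^Fin 4]→ₗ[F] F)
    (x : Fin 8 → V) (U : Perm (Fin 8) → B) (hU : ∀ σ α β, U (σ * blockPerm α β) = U σ) :
    ∑ σ : Perm (Fin 8), sgn σ • (a3Vec ω (fun k => x (σ (Fin.castAdd 4 k)))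
        (fun k => x (σ (Fin.natAdd 4 k))) ⊗ₜ[ℚ] U σ) =
      (8 / 3 : ℚ) • ∑ σ : Perm (Fin 8),
        sgn σ • (projR3 ω x (σ • ![0, 1, 2, 3, 5, 6, 7]) ⊗ₜ[ℚ] U σ) -
      (96 : ℚ) • ∑ σ : Perm (Fin 8),
        sgn σ • (sym3 (projRatio ω x (σ • ![0, 4, 1, 6, 2, 5])) ⊗ₜ[ℚ] U σ) := by
  have hs : ∀ (q : Perm (Fin 8) → B3 F),
      ∑ σ, sgn σ • ((∑ p : Perm (Fin 4) × Perm (Fin 4),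
        sgn (blockPerm p.1 p.2) • q (σ * blockPerm p.1 p.2)) ⊗ₜ[ℚ] U σ) =
      (576 : ℚ) • ∑ σ, sgn σ • (q σ ⊗ₜ[ℚ] U σ) := by
    intro q
    rw [sum_tmul_absorb (fun p : Perm (Fin 4) × Perm (Fin 4) => blockPerm p.1 p.2) q U
      fun σ p => hU σ p.1 p.2]
    have hc : (Fintype.card (Perm (Fin 4) × Perm (Fin 4)) : ℚ) = 576 := by
      rw [Fintype.card_prod, Fintype.card_perm, Fintype.card_fin]
      norm_num [Nat.factorial]
    rw [hc]
  have hr := sum_tmul_absorb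
    (fun p : Fin 4 × Fin 4 => blockPerm p.1.cycleRange.symm p.2.cycleRange.symm)
    (fun σ => projR3 ω x (σ • ![0, 1, 2, 3, 5, 6, 7])) U fun σ p => hU σ _ _
  have hw : ∑ σ : Perm (Fin 8), sgn σ •
      (sym3 (projRatio ω x ((σ * swap 5 6) • ![0, 4, 1, 6, 2, 5])) ⊗ₜ[ℚ] U σ) =
      -∑ σ : Perm (Fin 8), sgn σ •
        (sym3 (projRatio ω x (σ • ![0, 4, 1, 6, 2, 5])) ⊗ₜ[ℚ] U σ) := by
    have h56 : swap (5 : Fin 8) 6 = blockPerm 1 (swap 1 2) := by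
      decide
    have hσ : ∀ σ, U σ = U (σ * swap 5 6) := fun σ => by rw [h56, hU]
    simp only [fun σ => congrArg (fun u : B => sym3 (projRatio ω x ((σ * swap 5 6) •
      ![0, 4, 1, 6, 2, 5])) ⊗ₜ[ℚ] u) (hσ σ)]
    rw [sum_sgn_mul_right (fun σ => sym3 (projRatio ω x (σ • ![0, 4, 1, 6, 2, 5])) ⊗ₜ[ℚ] U σ),
      sgn_swap (by decide), neg_one_smul]
  have hq := hs fun σ => sym3 (projRatio ω x (σ • ![0, 4, 1, 6, 2, 5])) -
    sym3 (projRatio ω x ((σ * swap 5 6) • ![0, 4, 1, 6, 2, 5]))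
  simp only [TensorProduct.sub_tmul, smul_sub, Finset.sum_sub_distrib] at hq
  rw [hw] at hq
  have hc : (Fintype.card (Fin 4 × Fin 4) : ℚ) = 16 := by
    rw [Fintype.card_prod, Fintype.card_fin]
    norm_num
  rw [hc] at hr
  have ha : ∀ σ : Perm (Fin 8), sgn σ • (a3Vec ω (fun k => x (σ (Fin.castAdd 4 k)))
      (fun k => x (σ (Fin.natAdd 4 k))) ⊗ₜ[ℚ] U σ) =
      (1 / 6 : ℚ) • (sgn σ • (a3' ω (fun k => x (σ (Fin.castAdd 4 k)))
        (fun k => x (σ (Fin.natAdd 4 k))) ⊗ₜ[ℚ] U σ)) -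
      (1 / 3 : ℚ) • (sgn σ • (a3'' ω (fun k => x (σ (Fin.castAdd 4 k)))
        (fun k => x (σ (Fin.natAdd 4 k))) ⊗ₜ[ℚ] U σ)) := by
    intro σ
    rw [a3Vec, TensorProduct.sub_tmul, ← TensorProduct.smul_tmul', ← TensorProduct.smul_tmul',
      smul_sub, smul_comm (sgn σ), smul_comm (sgn σ)]
  have ha' : ∀ σ : Perm (Fin 8), a3'' ω (fun k => x (σ (Fin.castAdd 4 k)))
      (fun k => x (σ (Fin.natAdd 4 k))) ⊗ₜ[ℚ] U σ = (1 / 4 : ℚ) •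
        ((∑ p : Perm (Fin 4) × Perm (Fin 4), sgn (blockPerm p.1 p.2) •
          (sym3 (projRatio ω x ((σ * blockPerm p.1 p.2) • ![0, 4, 1, 6, 2, 5])) -
          sym3 (projRatio ω x ((σ * blockPerm p.1 p.2 * swap 5 6) •
            ![0, 4, 1, 6, 2, 5])))) ⊗ₜ[ℚ] U σ) := by
    intro σ
    rw [a3''_eq_sum, TensorProduct.smul_tmul']
  simp only [ha, Finset.sum_sub_distrib, ← Finset.smul_sum, ha', smul_comm (sgn _) (1 / 4 : ℚ)]
  simp only [a3'_eq_sum]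
  rw [hr]
  simp only [smul_sub, TensorProduct.sub_tmul, Finset.sum_sub_distrib] at hq ⊢
  linear_combination (norm := module) (-(1 / 12) : ℚ) • hq

end Reduction

/-! ### Symbols attached to projections of a configuration -/

section ProjectedSymbols

variable {F V W : Type*} [Field F] [AddCommGroup V] [Module F V] [AddCommGroup W] [Module F W]
  {n m k : ℕ}

lemma curryLeft_curryLeft_swap (ω : V [⋀^Fin (n + 2)]→ₗ[F] F) (a b : V) :
    (ω.curryLeft b).curryLeft a = -(ω.curryLeft a).curryLeft b := by
  ext v
  have h := ω.map_swap (Matrix.vecCons a (Matrix.vecCons b v)) (i := 0) (j := 1)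
    (by simp)
  rw [AlternatingMap.neg_apply]
  simp only [AlternatingMap.curryLeft_apply_apply]
  rw [← h]
  congr 1
  funext j
  refine Fin.cases ?_ (fun j => Fin.cases ?_ (fun j => ?_) j) j
  · simp
  · simp
  · rw [Function.comp_apply, swap_apply_of_ne_of_ne (Fin.succ_ne_zero _)
      (by simp [Fin.ext_iff])]
    simp

lemma scaledBy_curryLeft_swap (ω : V [⋀^Fin (n + 2)]→ₗ[F] F) (a b : V) (x : Fin m → V) :
    ScaledBy ((ω.curryLeft a).curryLeft b) ((ω.curryLeft b).curryLeft a) x x :=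
  ⟨-1, 1, by simp, fun _ => one_ne_zero, fun e => by
    rw [curryLeft_curryLeft_swap, AlternatingMap.neg_apply]
    simp⟩

lemma ScaledBy.projR3_eq {ω : V [⋀^Fin 4]→ₗ[F] F} {ω' : W [⋀^Fin 4]→ₗ[F] F} {x : Fin m → V}
    {x' : Fin m → W} (h : ScaledBy ω ω' x x') (e : Fin 7 → Fin m) :
    projR3 ω' x' e = projR3 ω x e :=
  (h.curryLeft (e 0)).r3_eq fun k => e k.succ

lemma ScaledBy.projRatio_eq {ω : V [⋀^Fin 4]→ₗ[F] F} {ω' : W [⋀^Fin 4]→ₗ[F] F} {x : Fin m → V}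
    {x' : Fin m → W} (h : ScaledBy ω ω' x x') (e : Fin 6 → Fin m) :
    projRatio ω' x' e = projRatio ω x e :=
  ((h.curryLeft (e 0)).curryLeft (e 1)).crossRatio_eq fun k => e k.succ.succ

/-- Rescaling changes the class of each determinant by a constant and a contribution of each of the
vectors. -/
lemma ScaledBy.exists_vol {ω : V [⋀^Fin n]→ₗ[F] F} {ω' : W [⋀^Fin n]→ₗ[F] F} {x : Fin m → V}
    {x' : Fin m → W} (h : ScaledBy ω ω' x x') (hx : Generic ω x) :
    ∃ (μ : MultQ F) (l : Fin m → MultQ F), ∀ I : Finset (Fin m), I.card = n →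
      vol ω' x' I = vol ω x I + (μ + ∑ i ∈ I, l i) := by
  obtain ⟨μ, l, hμ, hl, h⟩ := h
  refine ⟨unitClass μ, fun i => unitClass (l i), fun I hI => ?_⟩
  have hinj : Function.Injective (I.orderEmbOfFin hI) := (I.orderEmbOfFin hI).injective
  have hp : (∏ i, l (I.orderEmbOfFin hI i)) ≠ 0 := Finset.prod_ne_zero_iff.2 fun i _ => hl _
  rw [vol, dif_pos hI, vol, dif_pos hI, h, unitClass_mul (mul_ne_zero hμ hp) (hx.ne_zero hinj),
    unitClass_mul hμ hp, unitClass_prod _ _ fun i _ => hl _, add_comm]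
  congr 2
  have him : I = Finset.univ.image (I.orderEmbOfFin hI) := by
    ext a
    simp
  conv_rhs => rw [him]
  rw [Finset.sum_image fun a _ b _ hab => hinj hab]

lemma sgn_cycleRange_symm (i : Fin (n + 1)) : sgn i.cycleRange.symm = (-1) ^ (i : ℕ) := by
  simp [sgn, Fin.sign_cycleRange]

lemma projR3_perm (ω : V [⋀^Fin 4]→ₗ[F] F) (x : Fin m → V) (e : Fin 7 → Fin m)
    (ρ : Perm (Fin 6)) :
    projR3 ω x (e ∘ Perm.decomposeFin.symm (0, ρ)) = sgn ρ • projR3 ω x e := by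
  rw [projR3, projR3, ← r3_perm]
  simp only [Function.comp_apply, Perm.decomposeFin_symm_apply_zero]
  refine congrArg (r3 _) (funext fun k => ?_)
  simp

lemma exists_cycleRange_symm_eq (i : Fin (n + 1)) :
    ∃ ρ : Perm (Fin n), i.cycleRange.symm = swap 0 i * Perm.decomposeFin.symm (0, ρ) ∧
      (-1 : ℚ) ^ (i : ℕ) * sgn ρ = sgn (swap 0 i) := by
  obtain ⟨⟨p, ρ⟩, h⟩ := Perm.decomposeFin.symm.surjective i.cycleRange.symm
  have hp : p = i := by
    have := congrArg (fun τ : Perm (Fin (n + 1)) => τ 0) h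
    simpa using this
  subst hp
  have h1 : p.cycleRange.symm = swap 0 p * Perm.decomposeFin.symm (0, ρ) := by
    rw [← h]
    ext j
    refine Fin.cases ?_ (fun j => ?_) j <;> simp
  refine ⟨ρ, h1, ?_⟩
  have h2 := congrArg sgn h1
  rw [sgn_cycleRange_symm, sgn_mul, sgn_eq (Perm.decomposeFin.symm (0, ρ))
    (Perm.decomposeFin.symm_sign 0 ρ)] at h2
  rw [h2, if_pos rfl, one_mul]
  change sgn (swap 0 p) * sgn ρ * sgn ρ = _
  rw [mul_assoc, sgn_mul_self, mul_one]

/-- The dual seven-term relation for seven points of a configuration in `ℙ³`: the value of `r₃` is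
the sum of the six values obtained by exchanging the centre with one of the other points. -/
lemma projR3_dual {ω : V [⋀^Fin 4]→ₗ[F] F} {x : Fin m → V} (hx : Generic ω x)
    {e : Fin 7 → Fin m} (he : Function.Injective e) :
    ∑ i : Fin 7, sgn (swap 0 i) • projR3 ω x (e ∘ swap 0 i) = 0 := by
  rw [← dual_seven_term (hx.comp he)]
  refine Finset.sum_congr rfl fun i _ => ?_
  obtain ⟨ρ, h, hs⟩ := exists_cycleRange_symm_eq i
  have h1 := projR3_perm ω x (e ∘ swap 0 i) ρ
  rw [← hs, mul_smul, ← h1, Function.comp_assoc, ← Perm.coe_mul, ← h, projR3]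
  simp only [Function.comp_apply, Fin.cycleRange_symm_zero, Fin.cycleRange_symm_succ]
  rfl

/-- The seven-term relation for the projection of seven points of a configuration in `ℙ³`. -/
lemma projR3_seven_term {ω : V [⋀^Fin 4]→ₗ[F] F} {x : Fin m → V} (hx : Generic ω x)
    {a : Fin m} {e : Fin 7 → Fin m} (he : Function.Injective e) (ha : ∀ j, e j ≠ a) :
    ∑ i : Fin 7, (-1 : ℚ) ^ (i : ℕ) • projR3 ω x (Matrix.vecCons a (e ∘ i.succAbove)) = 0 := by
  rw [← seven_term (hx.proj a he ha (by decide))]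
  rfl

lemma altSum_comp_smul {T X : Type*} [AddCommGroup T] [Module ℚ T] [MulAction (Perm (Fin m)) X]
    (g f : X → T) (τ : Perm (Fin m)) (h : ∀ y, g y = f (τ • y)) (x : X) :
    altSum m g x = sgn τ • altSum m f x := by
  rw [altSum, altSum, Finset.smul_sum]
  refine Fintype.sum_equiv (Equiv.mulLeft τ) _ _ fun σ => ?_
  rw [Equiv.coe_mulLeft, h, ← mul_smul τ σ, smul_smul, sgn_mul, ← mul_assoc, sgn_mul_self, one_mul]

lemma exists_perm_smul_eq_comp {e : Fin k → Fin m} (he : Function.Injective e)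
    (ρ : Perm (Fin k)) : ∃ τ : Perm (Fin m), sgn τ = sgn ρ ∧ τ • e = e ∘ ρ := by
  refine ⟨Perm.viaFintypeEmbedding ρ ⟨e, he⟩, ?_, funext fun j => ?_⟩
  · rw [sgn, Perm.viaFintypeEmbedding_sign]
    rfl
  · exact Perm.viaFintypeEmbedding_apply_image ρ ⟨e, he⟩ j

/-- If the values of `f` on some relabellings of `x` are linearly dependent, then the alternating
sum of `f` vanishes, provided that the signs do not cancel. -/
lemma altSum_eq_zero_of_relation {T X ι : Type*} [AddCommGroup T] [Module ℚ T]
    [MulAction (Perm (Fin m)) X] [Fintype ι] (f : X → T) (x : X) (c : ι → ℚ) (y : ι → X)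
    (h : ∀ σ : Perm (Fin m), ∑ i, c i • f (σ • y i) = 0) (d : ι → ℚ)
    (hy : ∀ i, altSum m f (y i) = d i • altSum m f x) (hc : ∑ i, c i * d i ≠ 0) :
    altSum m f x = 0 := by
  have h1 : ∑ i, c i • altSum m f (y i) = 0 := by
    simp only [altSum, Finset.smul_sum]
    rw [Finset.sum_comm]
    refine Finset.sum_eq_zero fun σ _ => ?_
    simp only [smul_comm _ (sgn σ)]
    rw [← Finset.smul_sum, h, smul_zero]
  simp only [hy, smul_smul, ← Finset.sum_smul] at h1
  exact (smul_eq_zero.1 h1).resolve_left hc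

/-- The alternating sum of the classes of configurations obtained by omitting one of the indices
is an alternating sum over one more index. -/
lemma sum_altSum_succAbove {T X Y : Type*} [AddCommGroup T] [Module ℚ T]
    [MulAction (Perm (Fin n)) X] [MulAction (Perm (Fin (n + 1))) Y] (g : Fin (n + 1) → X → T)
    (f : Y → T) (x : X) (y : Y)
    (h : ∀ (i : Fin (n + 1)) (σ : Perm (Fin n)),
      g i (σ • x) = f ((i.cycleRange.symm * Perm.decomposeFin.symm (0, σ)) • y)) :
    ∑ i : Fin (n + 1), (-1 : ℚ) ^ (i : ℕ) • altSum n (g i) x = altSum (n + 1) f y := by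
  rw [altSum, sum_perm_succ]
  refine Finset.sum_congr rfl fun i _ => ?_
  rw [altSum]
  simp only [h]

lemma cycleRange_symm_smul_succ (i : Fin (n + 1)) (σ : Perm (Fin n)) (e : Fin k → Fin n) :
    (i.cycleRange.symm * Perm.decomposeFin.symm (0, σ)) • (Fin.succ ∘ e) =
      i.succAbove ∘ (σ • e) := by
  funext j
  exact cycleRange_symm_mul_succ i σ (e j)

lemma cycleRange_symm_smul_vecCons (i : Fin (n + 1)) (σ : Perm (Fin n)) (e : Fin k → Fin n) :
    (i.cycleRange.symm * Perm.decomposeFin.symm (0, σ)) • (Matrix.vecCons 0 (Fin.succ ∘ e)) =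
      Matrix.vecCons i (i.succAbove ∘ (σ • e)) := by
  funext j
  refine Fin.cases ?_ (fun j => ?_) j
  · exact cycleRange_symm_mul_zero i σ
  · exact cycleRange_symm_mul_succ i σ (e j)

lemma cycleRange_symm_smul_image (i : Fin (n + 1)) (σ : Perm (Fin n)) (I : Finset (Fin n)) :
    (i.cycleRange.symm * Perm.decomposeFin.symm (0, σ)) • (I.image Fin.succ) =
      (σ • I).image i.succAbove := by
  rw [Finset.smul_finset_def, Finset.smul_finset_def, Finset.image_image, Finset.image_image]
  refine Finset.image_congr fun j _ => ?_
  exact cycleRange_symm_mul_succ i σ j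

lemma cycleRange_symm_smul_insert (i : Fin (n + 1)) (σ : Perm (Fin n)) (I : Finset (Fin n)) :
    (i.cycleRange.symm * Perm.decomposeFin.symm (0, σ)) • (insert 0 (I.image Fin.succ)) =
      insert i ((σ • I).image i.succAbove) := by
  rw [← cycleRange_symm_smul_image, Finset.smul_finset_def, Finset.image_insert,
    Finset.smul_finset_def]
  congr 1
  exact cycleRange_symm_mul_zero i σ

end ProjectedSymbols

/-! ### The component in `B₃ ⊗ F*` -/

section FirstComponent

variable {F V W : Type*} [Field F] [AddCommGroup V] [Module F V] [AddCommGroup W] [Module F W]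
  {m : ℕ}

/-- `r₃(x_{e₀} | x_{e₁}, …, x_{e₆}) ⊗ Δ(I)`. -/
noncomputable def r3Vol (ω : V [⋀^Fin 4]→ₗ[F] F) (x : Fin m → V)
    (p : (Fin 7 → Fin m) × Finset (Fin m)) : B3 F ⊗[ℚ] MultQ F :=
  projR3 ω x p.1 ⊗ₜ vol ω x p.2

/-- `{r(x_{e₀}, x_{e₁} | x_{e₂}, …, x_{e₅})}₃ ⊗ Δ(I)`. -/
noncomputable def ratioVol (ω : V [⋀^Fin 4]→ₗ[F] F) (x : Fin m → V)
    (p : (Fin 6 → Fin m) × Finset (Fin m)) : B3 F ⊗[ℚ] MultQ F :=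
  sym3 (projRatio ω x p.1) ⊗ₜ vol ω x p.2

/-- The component of the cobracket in `B₃ ⊗ F*`, in the form which `sum_a3Vec_tmul` gives to it. The
part of `δ₁,₃` is the one with `Δ(x₀, x₁, x₂, x₃)`. -/
noncomputable def cobracket31 (ω : V [⋀^Fin 4]→ₗ[F] F) (x : Fin 8 → V) : B3 F ⊗[ℚ] MultQ F :=
  (8 / 3 : ℚ) • (altSum 8 (r3Vol ω x) (![0, 1, 2, 3, 5, 6, 7], {4, 5, 6, 7}) +
      altSum 8 (r3Vol ω x) (![0, 1, 2, 3, 5, 6, 7], {0, 1, 2, 3})) -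
    (96 : ℚ) • (altSum 8 (ratioVol ω x) (![0, 4, 1, 6, 2, 5], {4, 5, 6, 7}) +
      altSum 8 (ratioVol ω x) (![0, 4, 1, 6, 2, 5], {0, 1, 2, 3}))

/-- In the dual seven-term relation all summands are relabellings of each other, with signs which do
not cancel. -/
lemma altSum_projR3 {ω : V [⋀^Fin 4]→ₗ[F] F} {x : Fin 8 → V} (hx : Generic ω x) :
    altSum 8 (projR3 ω x) ![0, 1, 2, 3, 5, 6, 7] = 0 := by
  let e : Fin 7 → Fin 8 := ![0, 1, 2, 3, 5, 6, 7]
  refine altSum_eq_zero_of_relation (projR3 ω x) e (fun i => sgn (swap (0 : Fin 7) i))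
    (fun i => e ∘ swap 0 i)
    (fun σ => projR3_dual hx (e := σ • e) (σ.injective.comp (by decide)))
    (fun i => sgn (swap (0 : Fin 7) i)) (fun i => ?_) ?_
  · obtain ⟨τ, hτ, h⟩ := exists_perm_smul_eq_comp (e := e) (by decide) (swap 0 i)
    rw [altSum_relabel _ τ h, hτ]
  · simp [sgn_mul_self]

lemma altSum_sym3_projRatio (ω : V [⋀^Fin 4]→ₗ[F] F) (x : Fin 8 → V) :
    altSum 8 (fun e => sym3 (projRatio ω x e)) ![0, 4, 1, 6, 2, 5] = 0 :=
  altSum_eq_zero_of_fixed _ (swap 3 7) (by decide) (by decide)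

/-- The component in `B₃ ⊗ F*` does not depend on the choice of the vectors and of the volume
form: only `Δ(I) + Δ(Iᶜ)` enters, which a rescaling changes by a constant. -/
lemma ScaledBy.cobracket31_eq {ω : V [⋀^Fin 4]→ₗ[F] F} {ω' : W [⋀^Fin 4]→ₗ[F] F} {x : Fin 8 → V}
    {x' : Fin 8 → W} (h : ScaledBy ω ω' x x') (hx : Generic ω x) :
    cobracket31 ω' x' = cobracket31 ω x := by
  obtain ⟨μ, l, hv⟩ := h.exists_vol hx
  let C : MultQ F := (2 : ℚ) • μ + ∑ i, l i
  have hI : ∀ σ : Perm (Fin 8), vol ω' x' (σ • {4, 5, 6, 7}) + vol ω' x' (σ • {0, 1, 2, 3}) =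
      vol ω x (σ • {4, 5, 6, 7}) + vol ω x (σ • {0, 1, 2, 3}) + C := by
    intro σ
    rw [hv _ (by rw [Finset.card_smul_finset]; rfl), hv _ (by rw [Finset.card_smul_finset]; rfl)]
    have hs : ∑ i ∈ σ • ({4, 5, 6, 7} : Finset (Fin 8)), l i +
        ∑ i ∈ σ • ({0, 1, 2, 3} : Finset (Fin 8)), l i = ∑ i, l i := by
      have hd : Disjoint (σ • ({4, 5, 6, 7} : Finset (Fin 8))) (σ • {0, 1, 2, 3}) :=
        (Finset.disjoint_image σ.injective).2 (by decide)
      rw [← Finset.sum_union hd,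
        ← Finset.smul_finset_union]
      have : ({4, 5, 6, 7} ∪ {0, 1, 2, 3} : Finset (Fin 8)) = Finset.univ := by decide
      rw [this, Finset.smul_finset_univ]
    simp only [C]
    rw [← hs]
    module
  have h1 : altSum 8 (r3Vol ω' x') (![0, 1, 2, 3, 5, 6, 7], {4, 5, 6, 7}) +
      altSum 8 (r3Vol ω' x') (![0, 1, 2, 3, 5, 6, 7], {0, 1, 2, 3}) =
      altSum 8 (r3Vol ω x) (![0, 1, 2, 3, 5, 6, 7], {4, 5, 6, 7}) +
      altSum 8 (r3Vol ω x) (![0, 1, 2, 3, 5, 6, 7], {0, 1, 2, 3}) +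
      altSum 8 (projR3 ω x) ![0, 1, 2, 3, 5, 6, 7] ⊗ₜ C := by
    simp only [altSum, TensorProduct.sum_tmul, ← Finset.sum_add_distrib]
    refine Finset.sum_congr rfl fun σ _ => ?_
    simp only [r3Vol, Prod.smul_mk, h.projR3_eq, ← TensorProduct.smul_tmul', ← smul_add,
      ← TensorProduct.tmul_add, hI]
  have h2 : altSum 8 (ratioVol ω' x') (![0, 4, 1, 6, 2, 5], {4, 5, 6, 7}) +
      altSum 8 (ratioVol ω' x') (![0, 4, 1, 6, 2, 5], {0, 1, 2, 3}) =
      altSum 8 (ratioVol ω x) (![0, 4, 1, 6, 2, 5], {4, 5, 6, 7}) +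
      altSum 8 (ratioVol ω x) (![0, 4, 1, 6, 2, 5], {0, 1, 2, 3}) +
      altSum 8 (fun e => sym3 (projRatio ω x e)) ![0, 4, 1, 6, 2, 5] ⊗ₜ C := by
    simp only [altSum, TensorProduct.sum_tmul, ← Finset.sum_add_distrib]
    refine Finset.sum_congr rfl fun σ _ => ?_
    simp only [ratioVol, Prod.smul_mk, h.projRatio_eq, ← TensorProduct.smul_tmul', ← smul_add,
      ← TensorProduct.tmul_add, hI]
  rw [cobracket31, cobracket31, h1, h2, altSum_projR3 hx, altSum_sym3_projRatio]
  simp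

lemma cobracket31_perm (ω : V [⋀^Fin 4]→ₗ[F] F) (x : Fin 8 → V) (τ : Perm (Fin 8)) :
    cobracket31 ω (x ∘ τ) = sgn τ • cobracket31 ω x := by
  have h1 : ∀ p : (Fin 7 → Fin 8) × Finset (Fin 8),
      altSum 8 (r3Vol ω (x ∘ τ)) p = sgn τ • altSum 8 (r3Vol ω x) p := fun p =>
    altSum_comp_smul _ _ τ (fun q => by
      rw [r3Vol, vol_comp _ _ τ.injective]; rfl) p
  have h2 : ∀ p : (Fin 6 → Fin 8) × Finset (Fin 8),
      altSum 8 (ratioVol ω (x ∘ τ)) p = sgn τ • altSum 8 (ratioVol ω x) p := fun p =>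
    altSum_comp_smul _ _ τ (fun q => by
      rw [ratioVol, vol_comp _ _ τ.injective]; rfl) p
  rw [cobracket31, cobracket31, h1, h1, h2, h2]
  module

end FirstComponent

section NineTermFirst

variable {F V W : Type*} [Field F] [AddCommGroup V] [Module F V] [AddCommGroup W] [Module F W]
  {m n k : ℕ}

lemma r3Vol_comp (ω : V [⋀^Fin 4]→ₗ[F] F) (x : Fin m → V) {s : Fin k → Fin m}
    (hs : Function.Injective s) (p : (Fin 7 → Fin k) × Finset (Fin k)) :
    r3Vol ω (x ∘ s) p = r3Vol ω x (s ∘ p.1, p.2.image s) := by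
  rw [r3Vol, vol_comp _ _ hs]
  rfl

lemma ratioVol_comp (ω : V [⋀^Fin 4]→ₗ[F] F) (x : Fin m → V) {s : Fin k → Fin m}
    (hs : Function.Injective s) (p : (Fin 6 → Fin k) × Finset (Fin k)) :
    ratioVol ω (x ∘ s) p = ratioVol ω x (s ∘ p.1, p.2.image s) := by
  rw [ratioVol, vol_comp _ _ hs]
  rfl

lemma sum_altSum_r3Vol (ω : V [⋀^Fin 4]→ₗ[F] F) (x : Fin (n + 1) → V) (e : Fin 7 → Fin n)
    (I : Finset (Fin n)) :
    ∑ i : Fin (n + 1), (-1 : ℚ) ^ (i : ℕ) • altSum n (r3Vol ω (x ∘ i.succAbove)) (e, I) =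
      altSum (n + 1) (r3Vol ω x) (Fin.succ ∘ e, I.image Fin.succ) :=
  sum_altSum_succAbove _ _ _ _ fun i σ => by
    rw [r3Vol_comp _ _ Fin.succAbove_right_injective, Prod.smul_mk, Prod.smul_mk,
      cycleRange_symm_smul_succ, cycleRange_symm_smul_image]

lemma sum_altSum_ratioVol (ω : V [⋀^Fin 4]→ₗ[F] F) (x : Fin (n + 1) → V) (e : Fin 6 → Fin n)
    (I : Finset (Fin n)) :
    ∑ i : Fin (n + 1), (-1 : ℚ) ^ (i : ℕ) • altSum n (ratioVol ω (x ∘ i.succAbove)) (e, I) =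
      altSum (n + 1) (ratioVol ω x) (Fin.succ ∘ e, I.image Fin.succ) :=
  sum_altSum_succAbove _ _ _ _ fun i σ => by
    rw [ratioVol_comp _ _ Fin.succAbove_right_injective, Prod.smul_mk, Prod.smul_mk,
      cycleRange_symm_smul_succ, cycleRange_symm_smul_image]

/-- The alternating sum of `r₃(x₁ | x₂, x₃, x₄, x₆, x₇, x₈) ⊗ Δ(x₅, x₆, x₇, x₈)` over nine indices
vanishes: in the seven-term relation for the projections of `x₂, x₃, x₄, x₆, x₇, x₈, x₀` from `x₁`
a summand either is a relabelling of this one or does not change if two indices are exchanged. -/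
lemma altSum_r3Vol_nine {ω : V [⋀^Fin 4]→ₗ[F] F} {x : Fin 9 → V} (hx : Generic ω x) :
    altSum 9 (r3Vol ω x) (![1, 2, 3, 4, 6, 7, 8], {5, 6, 7, 8}) = 0 := by
  let e : Fin 7 → Fin 9 := ![0, 2, 3, 4, 6, 7, 8]
  refine altSum_eq_zero_of_relation (r3Vol ω x) _ (fun i : Fin 7 => (-1 : ℚ) ^ (i : ℕ))
    (fun i => (Matrix.vecCons 1 (e ∘ i.succAbove), {5, 6, 7, 8})) (fun σ => ?_)
    ![1, -1, 1, -1, 0, 0, 0] (fun i => ?_) ?_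
  · have h := projR3_seven_term hx (a := σ 1) (e := σ • e) (σ.injective.comp (by decide))
      (fun j hj => absurd (σ.injective hj) (by clear hj; revert j; decide))
    have h' := congrArg (fun t : B3 F => t ⊗ₜ[ℚ] vol ω x (σ • {5, 6, 7, 8})) h
    simp only [TensorProduct.sum_tmul, ← TensorProduct.smul_tmul', TensorProduct.zero_tmul] at h'
    rw [← h']
    refine Finset.sum_congr rfl fun i _ => ?_
    rw [r3Vol, Prod.smul_mk]
    refine congrArg (fun t => (-1 : ℚ) ^ (i : ℕ) • (projR3 ω x t ⊗ₜ[ℚ] _)) ?_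
    funext j
    refine Fin.cases rfl (fun j => rfl) j
  · have hr : ∀ (τ : Perm (Fin 9)) (z : ℤˣ) (i : Fin 7), Perm.sign τ = z →
        τ • ((![1, 2, 3, 4, 6, 7, 8] : Fin 7 → Fin 9), ({5, 6, 7, 8} : Finset (Fin 9))) =
          (Matrix.vecCons 1 (e ∘ i.succAbove), {5, 6, 7, 8}) →
        altSum 9 (r3Vol ω x) (Matrix.vecCons 1 (e ∘ i.succAbove), {5, 6, 7, 8}) =
          ((z : ℤ) : ℚ) • altSum 9 (r3Vol ω x) (![1, 2, 3, 4, 6, 7, 8], {5, 6, 7, 8}) := by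
      intro τ z i hz h
      rw [altSum_relabel _ τ h, sgn_eq _ hz]
    have h0 : ∀ (τ : Perm (Fin 9)) (i : Fin 7), Perm.sign τ = -1 →
        τ • (Matrix.vecCons 1 (e ∘ i.succAbove), ({5, 6, 7, 8} : Finset (Fin 9))) =
          (Matrix.vecCons 1 (e ∘ i.succAbove), {5, 6, 7, 8}) →
        altSum 9 (r3Vol ω x) (Matrix.vecCons 1 (e ∘ i.succAbove), {5, 6, 7, 8}) =
          (0 : ℚ) • altSum 9 (r3Vol ω x) (![1, 2, 3, 4, 6, 7, 8], {5, 6, 7, 8}) := by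
      intro τ i hτ h
      rw [altSum_eq_zero_of_fixed _ τ h hτ, zero_smul]
    fin_cases i
    · exact (hr 1 1 0 (by decide) (by decide)).trans (congrArg (· • _) (by simp))
    · exact (hr (swap 0 2) (-1) 1 (by decide) (by decide)).trans (congrArg (· • _) (by simp))
    · exact (hr ⟨![3, 1, 0, 2, 4, 5, 6, 7, 8], ![2, 1, 3, 0, 4, 5, 6, 7, 8], by decide,
        by decide⟩ 1 2 (by decide) (by decide)).trans (congrArg (· • _) (by simp))
    · exact (hr ⟨![4, 1, 0, 2, 3, 5, 6, 7, 8], ![2, 1, 3, 4, 0, 5, 6, 7, 8], by decide,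
        by decide⟩ (-1) 3 (by decide) (by decide)).trans (congrArg (· • _) (by simp))
    · exact h0 (swap 5 6) 4 (by decide) (by decide)
    · exact h0 (swap 5 7) 5 (by decide) (by decide)
    · exact h0 (swap 5 8) 6 (by decide) (by decide)
  · simp [Fin.sum_univ_succ]
    norm_num

/-- The nine-term relation for the component in `B₃ ⊗ F*`: except for the alternating sum of
`altSum_r3Vol_nine`, two of the nine indices can be exchanged without changing the summands. -/
lemma cobracket31_nine_term {ω : V [⋀^Fin 4]→ₗ[F] F} {x : Fin 9 → V} (hx : Generic ω x) :
    ∑ i : Fin 9, (-1 : ℚ) ^ (i : ℕ) • cobracket31 ω (x ∘ i.succAbove) = 0 := by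
  have h1 := altSum_r3Vol_nine hx
  have h2 : altSum 9 (r3Vol ω x) (![1, 2, 3, 4, 6, 7, 8], {1, 2, 3, 4}) = 0 :=
    altSum_eq_zero_of_fixed _ (swap 0 5) (by decide) (by decide)
  have h3 : altSum 9 (ratioVol ω x) (![1, 5, 2, 7, 3, 6], {5, 6, 7, 8}) = 0 :=
    altSum_eq_zero_of_fixed _ (swap 0 4) (by decide) (by decide)
  have h4 : altSum 9 (ratioVol ω x) (![1, 5, 2, 7, 3, 6], {1, 2, 3, 4}) = 0 :=
    altSum_eq_zero_of_fixed _ (swap 0 8) (by decide) (by decide)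
  have k1 := sum_altSum_r3Vol ω x ![0, 1, 2, 3, 5, 6, 7] {4, 5, 6, 7}
  have k2 := sum_altSum_r3Vol ω x ![0, 1, 2, 3, 5, 6, 7] {0, 1, 2, 3}
  have k3 := sum_altSum_ratioVol ω x ![0, 4, 1, 6, 2, 5] {4, 5, 6, 7}
  have k4 := sum_altSum_ratioVol ω x ![0, 4, 1, 6, 2, 5] {0, 1, 2, 3}
  have e1 : Fin.succ ∘ (![0, 1, 2, 3, 5, 6, 7] : Fin 7 → Fin 8) = ![1, 2, 3, 4, 6, 7, 8] := by
    decide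
  have e2 : Fin.succ ∘ (![0, 4, 1, 6, 2, 5] : Fin 6 → Fin 8) = ![1, 5, 2, 7, 3, 6] := by decide
  have e3 : ({4, 5, 6, 7} : Finset (Fin 8)).image Fin.succ = {5, 6, 7, 8} := by decide
  have e4 : ({0, 1, 2, 3} : Finset (Fin 8)).image Fin.succ = {1, 2, 3, 4} := by decide
  rw [e1, e3, h1] at k1
  rw [e1, e4, h2] at k2
  rw [e2, e3, h3] at k3
  rw [e2, e4, h4] at k4
  simp only [cobracket31, smul_sub, smul_add, smul_comm _ (8 / 3 : ℚ), smul_comm _ (96 : ℚ),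
    Finset.sum_sub_distrib, Finset.sum_add_distrib, ← Finset.smul_sum]
  rw [k1, k2, k3, k4]
  simp

/-- `r₃(x_{e₀}, x_{e₁} | x_{e₂}, …, x_{e₇})` for a configuration in `ℙ⁴`. -/
noncomputable def projProjR3 (Ω : V [⋀^Fin 5]→ₗ[F] F) (x : Fin m → V) (e : Fin 8 → Fin m) : B3 F :=
  projR3 (Ω.curryLeft (x (e 0))) x (Fin.tail e)

/-- The cross-ratio `r(x_{e₀}, x_{e₁}, x_{e₂} | x_{e₃}, …, x_{e₆})` for a configuration in `ℙ⁴`. -/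
noncomputable def projProjRatio (Ω : V [⋀^Fin 5]→ₗ[F] F) (x : Fin m → V) (e : Fin 7 → Fin m) : F :=
  projRatio (Ω.curryLeft (x (e 0))) x (Fin.tail e)

lemma projProjR3_swap (Ω : V [⋀^Fin 5]→ₗ[F] F) (x : Fin m → V) (e : Fin 8 → Fin m) :
    projProjR3 Ω x (e ∘ swap 0 1) = projProjR3 Ω x e :=
  (scaledBy_curryLeft_swap Ω (x (e 0)) (x (e 1)) x).r3_eq fun k => e k.succ.succ

lemma projProjRatio_swap₀₁ (Ω : V [⋀^Fin 5]→ₗ[F] F) (x : Fin m → V) (e : Fin 7 → Fin m) :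
    projProjRatio Ω x (e ∘ swap 0 1) = projProjRatio Ω x e :=
  ((scaledBy_curryLeft_swap Ω (x (e 0)) (x (e 1)) x).curryLeft (e 2)).crossRatio_eq
    fun k => e k.succ.succ.succ

lemma projProjRatio_swap₁₂ (Ω : V [⋀^Fin 5]→ₗ[F] F) (x : Fin m → V) (e : Fin 7 → Fin m) :
    projProjRatio Ω x (e ∘ swap 1 2) = projProjRatio Ω x e :=
  (scaledBy_curryLeft_swap (Ω.curryLeft (x (e 0))) (x (e 1)) (x (e 2)) x).crossRatio_eq
    fun k => e k.succ.succ.succ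

/-- `r₃(x_{e₀}, x_{e₁} | x_{e₂}, …, x_{e₇}) ⊗ Δ(I)` for a configuration in `ℙ⁴`. -/
noncomputable def projR3Vol (Ω : V [⋀^Fin 5]→ₗ[F] F) (x : Fin m → V)
    (p : (Fin 8 → Fin m) × Finset (Fin m)) : B3 F ⊗[ℚ] MultQ F :=
  projProjR3 Ω x p.1 ⊗ₜ vol Ω x p.2

/-- `{r(x_{e₀}, x_{e₁}, x_{e₂} | x_{e₃}, …, x_{e₆})}₃ ⊗ Δ(I)` for a configuration in `ℙ⁴`. -/
noncomputable def projRatioVol (Ω : V [⋀^Fin 5]→ₗ[F] F) (x : Fin m → V)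
    (p : (Fin 7 → Fin m) × Finset (Fin m)) : B3 F ⊗[ℚ] MultQ F :=
  sym3 (projProjRatio Ω x p.1) ⊗ₜ vol Ω x p.2

lemma projR3Vol_smul_swap (Ω : V [⋀^Fin 5]→ₗ[F] F) (x : Fin m → V) (σ : Perm (Fin m))
    (e : Fin 8 → Fin m) (I : Finset (Fin m)) :
    projR3Vol Ω x (σ • (e ∘ swap 0 1, I)) = projR3Vol Ω x (σ • (e, I)) := by
  rw [Prod.smul_mk, Prod.smul_mk, projR3Vol, projR3Vol]
  exact congrArg (· ⊗ₜ[ℚ] _) (projProjR3_swap Ω x (σ • e))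

lemma projRatioVol_smul_swap₀₁ (Ω : V [⋀^Fin 5]→ₗ[F] F) (x : Fin m → V) (σ : Perm (Fin m))
    (e : Fin 7 → Fin m) (I : Finset (Fin m)) :
    projRatioVol Ω x (σ • (e ∘ swap 0 1, I)) = projRatioVol Ω x (σ • (e, I)) := by
  rw [Prod.smul_mk, Prod.smul_mk, projRatioVol, projRatioVol]
  exact congrArg (fun t => sym3 t ⊗ₜ[ℚ] _) (projProjRatio_swap₀₁ Ω x (σ • e))

lemma projRatioVol_smul_swap₁₂ (Ω : V [⋀^Fin 5]→ₗ[F] F) (x : Fin m → V) (σ : Perm (Fin m))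
    (e : Fin 7 → Fin m) (I : Finset (Fin m)) :
    projRatioVol Ω x (σ • (e ∘ swap 1 2, I)) = projRatioVol Ω x (σ • (e, I)) := by
  rw [Prod.smul_mk, Prod.smul_mk, projRatioVol, projRatioVol]
  exact congrArg (fun t => sym3 t ⊗ₜ[ℚ] _) (projProjRatio_swap₁₂ Ω x (σ • e))

lemma notMem_image_succAbove (i : Fin (n + 1)) (I : Finset (Fin n)) :
    i ∉ I.image i.succAbove := by
  simp [Fin.succAbove_ne]

lemma sum_altSum_projR3Vol (Ω : V [⋀^Fin 5]→ₗ[F] F) (x : Fin (n + 1) → V) (e : Fin 7 → Fin n)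
    (I : Finset (Fin n)) :
    ∑ i : Fin (n + 1), (-1 : ℚ) ^ (i : ℕ) •
      altSum n (r3Vol (Ω.curryLeft (x i)) (x ∘ i.succAbove)) (e, I) =
      altSum (n + 1) (projR3Vol Ω x)
        (Matrix.vecCons 0 (Fin.succ ∘ e), insert 0 (I.image Fin.succ)) :=
  sum_altSum_succAbove _ _ _ _ fun i σ => by
    rw [r3Vol_comp _ _ Fin.succAbove_right_injective, Prod.smul_mk, Prod.smul_mk,
      cycleRange_symm_smul_vecCons, cycleRange_symm_smul_insert, r3Vol,
      vol_curryLeft _ _ (notMem_image_succAbove _ _)]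
    rfl

lemma sum_altSum_projRatioVol (Ω : V [⋀^Fin 5]→ₗ[F] F) (x : Fin (n + 1) → V) (e : Fin 6 → Fin n)
    (I : Finset (Fin n)) :
    ∑ i : Fin (n + 1), (-1 : ℚ) ^ (i : ℕ) •
      altSum n (ratioVol (Ω.curryLeft (x i)) (x ∘ i.succAbove)) (e, I) =
      altSum (n + 1) (projRatioVol Ω x)
        (Matrix.vecCons 0 (Fin.succ ∘ e), insert 0 (I.image Fin.succ)) :=
  sum_altSum_succAbove _ _ _ _ fun i σ => by
    rw [ratioVol_comp _ _ Fin.succAbove_right_injective, Prod.smul_mk, Prod.smul_mk,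
      cycleRange_symm_smul_vecCons, cycleRange_symm_smul_insert, ratioVol,
      vol_curryLeft _ _ (notMem_image_succAbove _ _)]
    rfl

/-- The alternating sum of `r₃(x₁, x₀ | x₂, x₃, x₄, x₆, x₇, x₈) ⊗ Δ(x₀, x₅, x₆, x₇, x₈)` over nine
indices vanishes: in the dual seven-term relation for the projections of
`x₀, x₂, x₃, x₄, x₆, x₇, x₈` from `x₁` the second centre of a summand either is one of `x₀`, `x₆`,
`x₇`, `x₈`, which is a relabelling of the first case, or can be exchanged with `x₁`. -/
lemma altSum_projR3Vol_nine {Ω : V [⋀^Fin 5]→ₗ[F] F} {x : Fin 9 → V} (hx : Generic Ω x) :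
    altSum 9 (projR3Vol Ω x) (![1, 0, 2, 3, 4, 6, 7, 8], {0, 5, 6, 7, 8}) = 0 := by
  let e : Fin 7 → Fin 9 := ![0, 2, 3, 4, 6, 7, 8]
  refine altSum_eq_zero_of_relation (projR3Vol Ω x) _ (fun i => sgn (swap (0 : Fin 7) i))
    (fun i => (Matrix.vecCons 1 (e ∘ swap 0 i), {0, 5, 6, 7, 8})) (fun σ => ?_)
    ![1, 0, 0, 0, -1, -1, -1] (fun i => ?_) ?_
  · have h := projR3_dual (hx.proj (σ 1) (f := σ • e) (σ.injective.comp (by decide))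
      (fun j hj => absurd (σ.injective hj) (by clear hj; revert j; decide)) (by decide))
      (e := id) Function.injective_id
    have h' := congrArg (fun t : B3 F => t ⊗ₜ[ℚ] vol Ω x (σ • {0, 5, 6, 7, 8})) h
    simp only [TensorProduct.sum_tmul, ← TensorProduct.smul_tmul', TensorProduct.zero_tmul] at h'
    rw [← h']
    rfl
  · have hr : ∀ (τ : Perm (Fin 9)) (z : ℤˣ) (i : Fin 7), Perm.sign τ = z →
        τ • ((![1, 0, 2, 3, 4, 6, 7, 8] : Fin 8 → Fin 9), ({0, 5, 6, 7, 8} : Finset (Fin 9))) =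
          (Matrix.vecCons 1 (e ∘ swap 0 i), {0, 5, 6, 7, 8}) →
        altSum 9 (projR3Vol Ω x) (Matrix.vecCons 1 (e ∘ swap 0 i), {0, 5, 6, 7, 8}) =
          ((z : ℤ) : ℚ) •
            altSum 9 (projR3Vol Ω x) (![1, 0, 2, 3, 4, 6, 7, 8], {0, 5, 6, 7, 8}) := by
      intro τ z i hz h
      rw [altSum_relabel _ τ h, sgn_eq _ hz]
    have h0 : ∀ (τ : Perm (Fin 9)) (i : Fin 7), Perm.sign τ = -1 →
        τ • (Matrix.vecCons 1 (e ∘ swap 0 i), ({0, 5, 6, 7, 8} : Finset (Fin 9))) =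
          ((Matrix.vecCons 1 (e ∘ swap 0 i) ∘ swap 0 1, {0, 5, 6, 7, 8}) :
            (Fin 8 → Fin 9) × Finset (Fin 9)) →
        altSum 9 (projR3Vol Ω x) (Matrix.vecCons 1 (e ∘ swap 0 i), {0, 5, 6, 7, 8}) =
          (0 : ℚ) • altSum 9 (projR3Vol Ω x) (![1, 0, 2, 3, 4, 6, 7, 8], {0, 5, 6, 7, 8}) := by
      intro τ i hτ h
      rw [zero_smul]
      refine altSum_eq_zero _ τ _ fun σ => ?_
      rw [h, sgn_eq τ hτ]
      simp only [Units.val_neg, Units.val_one, Int.cast_neg, Int.cast_one, neg_smul, one_smul,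
        neg_neg]
      rw [projR3Vol_smul_swap]
    fin_cases i
    · exact (hr 1 1 0 (by decide) (by decide)).trans (congrArg (· • _) (by simp))
    · exact h0 (swap 1 2) 1 (by decide) (by decide)
    · exact h0 (swap 1 3) 2 (by decide) (by decide)
    · exact h0 (swap 1 4) 3 (by decide) (by decide)
    · exact (hr (swap 0 6) (-1) 4 (by decide) (by decide)).trans (congrArg (· • _) (by simp))
    · exact (hr (swap 0 7) (-1) 5 (by decide) (by decide)).trans (congrArg (· • _) (by simp))
    · exact (hr (swap 0 8) (-1) 6 (by decide) (by decide)).trans (congrArg (· • _) (by simp))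
  · have hs : ∀ i : Fin 7, i ≠ 0 → sgn (swap 0 i) = -1 := fun i hi => sgn_swap hi.symm
    have hs0 : sgn (Equiv.refl (Fin 7)) = 1 := sgn_one
    simp [Fin.sum_univ_succ, hs, hs0]
    norm_num

/-- The dual nine-term relation for the component in `B₃ ⊗ F*`: except for the alternating sum of
`altSum_projR3Vol_nine`, exchanging two of the centres does not change the summands. -/
lemma cobracket31_dual_nine_term {Ω : V [⋀^Fin 5]→ₗ[F] F} {x : Fin 9 → V} (hx : Generic Ω x) :
    ∑ i : Fin 9, (-1 : ℚ) ^ (i : ℕ) • cobracket31 (Ω.curryLeft (x i)) (x ∘ i.succAbove) = 0 := by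
  have h1 : altSum 9 (projR3Vol Ω x) (![0, 1, 2, 3, 4, 6, 7, 8], {0, 5, 6, 7, 8}) = 0 := by
    rw [← altSum_projR3Vol_nine hx]
    have e0 : (![1, 0, 2, 3, 4, 6, 7, 8] : Fin 8 → Fin 9) =
      ![0, 1, 2, 3, 4, 6, 7, 8] ∘ swap 0 1 := by decide
    rw [e0, altSum, altSum]
    simp only [projR3Vol_smul_swap]
  have h2 : altSum 9 (projR3Vol Ω x) (![0, 1, 2, 3, 4, 6, 7, 8], {0, 1, 2, 3, 4}) = 0 := by
    refine altSum_eq_zero _ (swap 0 1) _ fun σ => ?_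
    rw [sgn_swap (by decide), neg_one_smul, neg_neg, show swap (0 : Fin 9) 1 •
      ((![0, 1, 2, 3, 4, 6, 7, 8], {0, 1, 2, 3, 4}) : (Fin 8 → Fin 9) × Finset (Fin 9)) =
        (![0, 1, 2, 3, 4, 6, 7, 8] ∘ swap 0 1, {0, 1, 2, 3, 4}) by decide]
    rw [projR3Vol_smul_swap]
  have h3 : altSum 9 (projRatioVol Ω x) (![0, 1, 5, 2, 7, 3, 6], {0, 5, 6, 7, 8}) = 0 := by
    refine altSum_eq_zero _ (swap 0 5) _ fun σ => ?_
    rw [sgn_swap (by decide), neg_one_smul, neg_neg, show swap (0 : Fin 9) 5 •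
      ((![0, 1, 5, 2, 7, 3, 6], {0, 5, 6, 7, 8}) : (Fin 7 → Fin 9) × Finset (Fin 9)) =
        (((![0, 1, 5, 2, 7, 3, 6] ∘ swap 0 1) ∘ swap 1 2) ∘ swap 0 1, {0, 5, 6, 7, 8}) by decide]
    rw [projRatioVol_smul_swap₀₁, projRatioVol_smul_swap₁₂, projRatioVol_smul_swap₀₁]
  have h4 : altSum 9 (projRatioVol Ω x) (![0, 1, 5, 2, 7, 3, 6], {0, 1, 2, 3, 4}) = 0 := by
    refine altSum_eq_zero _ (swap 0 1) _ fun σ => ?_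
    rw [sgn_swap (by decide), neg_one_smul, neg_neg, show swap (0 : Fin 9) 1 •
      ((![0, 1, 5, 2, 7, 3, 6], {0, 1, 2, 3, 4}) : (Fin 7 → Fin 9) × Finset (Fin 9)) =
        (![0, 1, 5, 2, 7, 3, 6] ∘ swap 0 1, {0, 1, 2, 3, 4}) by decide]
    rw [projRatioVol_smul_swap₀₁]
  have k1 := sum_altSum_projR3Vol Ω x ![0, 1, 2, 3, 5, 6, 7] {4, 5, 6, 7}
  have k2 := sum_altSum_projR3Vol Ω x ![0, 1, 2, 3, 5, 6, 7] {0, 1, 2, 3}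
  have k3 := sum_altSum_projRatioVol Ω x ![0, 4, 1, 6, 2, 5] {4, 5, 6, 7}
  have k4 := sum_altSum_projRatioVol Ω x ![0, 4, 1, 6, 2, 5] {0, 1, 2, 3}
  have e1 : Matrix.vecCons 0 (Fin.succ ∘ (![0, 1, 2, 3, 5, 6, 7] : Fin 7 → Fin 8)) =
    ![0, 1, 2, 3, 4, 6, 7, 8] := by decide
  have e2 : Matrix.vecCons 0 (Fin.succ ∘ (![0, 4, 1, 6, 2, 5] : Fin 6 → Fin 8)) =
    ![0, 1, 5, 2, 7, 3, 6] := by decide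
  have e3 : insert 0 (({4, 5, 6, 7} : Finset (Fin 8)).image Fin.succ) = {0, 5, 6, 7, 8} := by decide
  have e4 : insert 0 (({0, 1, 2, 3} : Finset (Fin 8)).image Fin.succ) = {0, 1, 2, 3, 4} := by decide
  rw [e1, e3, h1] at k1
  rw [e1, e4, h2] at k2
  rw [e2, e3, h3] at k3
  rw [e2, e4, h4] at k4
  simp only [cobracket31, smul_sub, smul_add, smul_comm _ (8 / 3 : ℚ), smul_comm _ (96 : ℚ),
    Finset.sum_sub_distrib, Finset.sum_add_distrib, ← Finset.smul_sum]
  rw [k1, k2, k3, k4]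
  simp

end NineTermFirst

/-! ### The component in `Λ² B₂` -/

section Wedge

variable {M : Type*} [AddCommGroup M] [Module ℚ M]

lemma wedge_add_left (a b c : M) : wedge (a + b) c = wedge a c + wedge b c := by
  have h := (exteriorPower.ιMulti ℚ 2 (M := M)).map_update_add ![0, c] 0 a b
  have hu : ∀ t : M, Function.update ![0, c] 0 t = ![t, c] := fun t => by
    funext i
    fin_cases i <;> rfl
  rwa [hu, hu, hu] at h

lemma wedge_smul_left (r : ℚ) (a b : M) : wedge (r • a) b = r • wedge a b := by
  have h := (exteriorPower.ιMulti ℚ 2 (M := M)).map_update_smul ![0, b] 0 r a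
  have hu : ∀ t : M, Function.update ![0, b] 0 t = ![t, b] := fun t => by
    funext i
    fin_cases i <;> rfl
  rwa [hu, hu] at h

lemma wedge_self (a : M) : wedge a a = 0 :=
  (exteriorPower.ιMulti ℚ 2 (M := M)).map_eq_zero_of_eq ![a, a] (i := 0) (j := 1) rfl (by decide)

lemma wedge_swap (a b : M) : wedge a b = -wedge b a := by
  have h := (exteriorPower.ιMulti ℚ 2 (M := M)).map_swap ![b, a] (i := 0) (j := 1) (by decide)
  rw [wedge, wedge, ← h]
  congr 1
  funext i
  fin_cases i <;> rfl

lemma wedge_add_right (a b c : M) : wedge a (b + c) = wedge a b + wedge a c := by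
  rw [wedge_swap, wedge_add_left, wedge_swap b, wedge_swap c, neg_add_rev, neg_neg, neg_neg,
    add_comm]

lemma wedge_smul_right (r : ℚ) (a b : M) : wedge a (r • b) = r • wedge a b := by
  rw [wedge_swap, wedge_smul_left, wedge_swap b, smul_neg, neg_neg]

end Wedge

section SecondComponent

variable {F V W : Type*} [Field F] [AddCommGroup V] [Module F V] [AddCommGroup W] [Module F W]
  {m n k : ℕ}

/-- `{r(x_{e₀}, x_{e₁} | …)}₂ ∧ {r(x_{f₀}, x_{f₁} | …)}₂`. -/
noncomputable def ratioWedge (ω : V [⋀^Fin 4]→ₗ[F] F) (x : Fin m → V)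
    (p : (Fin 6 → Fin m) × (Fin 6 → Fin m)) : ⋀[ℚ]^2 (B2 F) :=
  wedge (sym2 (projRatio ω x p.1)) (sym2 (projRatio ω x p.2))

/-- `{r(x_{e₀}, x_{e₁}, x_{e₂} | …)}₂ ∧ {r(x_{f₀}, x_{f₁}, x_{f₂} | …)}₂` for a configuration in
`ℙ⁴`. -/
noncomputable def projRatioWedge (Ω : V [⋀^Fin 5]→ₗ[F] F) (x : Fin m → V)
    (p : (Fin 7 → Fin m) × (Fin 7 → Fin m)) : ⋀[ℚ]^2 (B2 F) :=
  wedge (sym2 (projProjRatio Ω x p.1)) (sym2 (projProjRatio Ω x p.2))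

lemma delta22_eq (ω : (Fin 4 → F) [⋀^Fin 4]→ₗ[F] F) (x : Fin 8 → (Fin 4 → F)) :
    delta22 ω x =
      (-144 / 7 : ℚ) • altSum 8 (ratioWedge ω x) (![0, 1, 2, 3, 4, 5], ![2, 3, 0, 1, 4, 6]) := by
  rw [delta22, altSum]
  refine congrArg (fun t : ⋀[ℚ]^2 (B2 F) => (-144 / 7 : ℚ) • t)
    (Finset.sum_congr rfl fun σ _ => ?_)
  have h : ∀ e : Fin 6 → Fin 8, (fun k : Fin 4 => x ((σ • e) k.succ.succ)) =
      ![x (σ (e 2)), x (σ (e 3)), x (σ (e 4)), x (σ (e 5))] := by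
    intro e
    funext k
    fin_cases k <;> rfl
  rw [Prod.smul_mk, ratioWedge, projRatio, projRatio, h, h]
  rfl

lemma ratioWedge_comp (ω : V [⋀^Fin 4]→ₗ[F] F) (x : Fin m → V) (s : Fin k → Fin m)
    (p : (Fin 6 → Fin k) × (Fin 6 → Fin k)) :
    ratioWedge ω (x ∘ s) p = ratioWedge ω x (s ∘ p.1, s ∘ p.2) := rfl

lemma ScaledBy.ratioWedge_eq {ω : V [⋀^Fin 4]→ₗ[F] F} {ω' : W [⋀^Fin 4]→ₗ[F] F} {x : Fin m → V}
    {x' : Fin m → W} (h : ScaledBy ω ω' x x') : ratioWedge ω' x' = ratioWedge ω x := by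
  funext p
  rw [ratioWedge, ratioWedge, h.projRatio_eq, h.projRatio_eq]

/-- The nine-term relation for the component in `Λ² B₂`: the summands only involve seven of the nine
indices. -/
lemma ratioWedge_nine_term (ω : V [⋀^Fin 4]→ₗ[F] F) (x : Fin 9 → V) :
    ∑ i : Fin 9, (-1 : ℚ) ^ (i : ℕ) • altSum 8 (ratioWedge ω (x ∘ i.succAbove))
      (![0, 1, 2, 3, 4, 5], ![2, 3, 0, 1, 4, 6]) = 0 := by
  rw [sum_altSum_succAbove _ (ratioWedge ω x) _
    ((Fin.succ ∘ ![0, 1, 2, 3, 4, 5], Fin.succ ∘ ![2, 3, 0, 1, 4, 6]) :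
      (Fin 6 → Fin 9) × (Fin 6 → Fin 9)) fun i σ => by
    rw [ratioWedge_comp, Prod.smul_mk, Prod.smul_mk, cycleRange_symm_smul_succ,
      cycleRange_symm_smul_succ]]
  exact altSum_eq_zero_of_fixed _ (swap 0 8) (by decide) (by decide)

lemma Generic.projRatio₂ {ω : V [⋀^Fin 4]→ₗ[F] F} {x : Fin m → V} (hx : Generic ω x)
    {e : Fin (k + 2) → Fin m} (he : Function.Injective e) (hk : 3 ≤ k) :
    Generic ((ω.curryLeft (x (e 0))).curryLeft (x (e 1))) (fun j : Fin k => x (e j.succ.succ)) := by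
  have h1 := hx.proj (e 0) (f := fun j : Fin (k + 1) => e j.succ)
    (he.comp (Fin.succ_injective _)) (fun j h => Fin.succ_ne_zero _ (he h)) (by omega)
  exact h1.proj 0 (f := Fin.succ) (Fin.succ_injective _) (fun j h => Fin.succ_ne_zero _ h)
    (by omega)

lemma Generic.projRatio₃ {Ω : V [⋀^Fin 5]→ₗ[F] F} {x : Fin m → V} (hx : Generic Ω x)
    {e : Fin (k + 3) → Fin m} (he : Function.Injective e) (hk : 3 ≤ k) :
    Generic (((Ω.curryLeft (x (e 0))).curryLeft (x (e 1))).curryLeft (x (e 2)))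
      (fun j : Fin k => x (e j.succ.succ.succ)) := by
  have h1 := hx.proj (e 0) (f := fun j : Fin (k + 2) => e j.succ)
    (he.comp (Fin.succ_injective _)) (fun j h => Fin.succ_ne_zero _ (he h)) (by omega)
  exact h1.projRatio₂ (e := id) Function.injective_id hk

lemma sym2_projProjRatio_perm (hF : HasFourElements F) {Ω : V [⋀^Fin 5]→ₗ[F] F} {x : Fin m → V}
    (hx : Generic Ω x) {e : Fin 7 → Fin m} (he : Function.Injective e) :
    sym2 (projProjRatio Ω x (e ∘ swap 5 6)) = -sym2 (projProjRatio Ω x e) := by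
  have h := sym2_crossRatio_perm hF (swap 2 3) (hx.projRatio₃ (k := 4) he (by decide))
  rw [sgn_swap (by decide), neg_one_smul] at h
  rw [projProjRatio, projProjRatio, projRatio, projRatio]
  refine Eq.trans ?_ h
  refine congrArg (fun t => sym2 (crossRatio _ t)) (funext fun k => ?_)
  fin_cases k <;> rfl

/-- The dual five-term relation for the projection of five points with two fixed centres. -/
lemma sym2_projProjRatio_dual (hF : HasFourElements F) {Ω : V [⋀^Fin 5]→ₗ[F] F} {x : Fin m → V}
    (hx : Generic Ω x) {e : Fin 7 → Fin m} (he : Function.Injective e) :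
    sym2 (projProjRatio Ω x e) = sym2 (projProjRatio Ω x (e ∘ swap 2 3)) +
      sym2 (projProjRatio Ω x (e ∘ swap 2 4)) + sym2 (projProjRatio Ω x (e ∘ swap 2 5)) +
      sym2 (projProjRatio Ω x (e ∘ swap 2 6)) := by
  have h1 := hx.proj (e 0) (f := fun j : Fin 6 => e j.succ)
    (he.comp (Fin.succ_injective _)) (fun j h => Fin.succ_ne_zero _ (he h)) (by decide)
  have h2 := h1.proj 0 (f := Fin.succ) (Fin.succ_injective _) (fun j h => Fin.succ_ne_zero _ h)
    (by decide)
  have h := sym2_crossRatio_dual_subst hF h2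
  have key : ∀ (e' : Fin 7 → Fin m) (y : Fin 4 → V) , e' 0 = e 0 → e' 1 = e 1 →
      (∀ k : Fin 4, x (e' k.succ.succ.succ) = y k) → projProjRatio Ω x e' =
      crossRatio (((Ω.curryLeft (x (e 0))).curryLeft (x (e 1))).curryLeft (x (e' 2))) y := by
    intro e' y h0 h1 hk
    rw [← h0, ← h1, projProjRatio, projRatio]
    exact congrArg (crossRatio _) (funext hk)
  refine Eq.trans (congrArg sym2 (key e _ rfl rfl fun k => ?_)) (h.trans ?_)
  · fin_cases k <;> rfl
  · refine congrArg₂ (· + ·) (congrArg₂ (· + ·) (congrArg₂ (· + ·) ?_ ?_) ?_) ?_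
    · exact congrArg sym2 (key (e ∘ swap 2 3) _ rfl rfl fun k => by fin_cases k <;> rfl).symm
    · exact congrArg sym2 (key (e ∘ swap 2 4) _ rfl rfl fun k => by fin_cases k <;> rfl).symm
    · exact congrArg sym2 (key (e ∘ swap 2 5) _ rfl rfl fun k => by fin_cases k <;> rfl).symm
    · exact congrArg sym2 (key (e ∘ swap 2 6) _ rfl rfl fun k => by fin_cases k <;> rfl).symm

/-- The five-term relation for the projections of five points with three fixed centres. -/
lemma sym2_projProjRatio_subst (hF : HasFourElements F) {Ω : V [⋀^Fin 5]→ₗ[F] F} {x : Fin m → V}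
    (hx : Generic Ω x) {e : Fin 8 → Fin m} (he : Function.Injective e) :
    sym2 (projProjRatio Ω x (e ∘ ![0, 1, 2, 3, 4, 5, 6])) =
      sym2 (projProjRatio Ω x (e ∘ ![0, 1, 2, 7, 4, 5, 6])) +
      sym2 (projProjRatio Ω x (e ∘ ![0, 1, 2, 3, 7, 5, 6])) +
      sym2 (projProjRatio Ω x (e ∘ ![0, 1, 2, 3, 4, 7, 6])) +
      sym2 (projProjRatio Ω x (e ∘ ![0, 1, 2, 3, 4, 5, 7])) := by
  have h := sym2_crossRatio_subst hF (hx.projRatio₃ (k := 5) he (by decide))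
  have key : ∀ (g : Fin 7 → Fin 8) (y : Fin 4 → V) , g 0 = 0 → g 1 = 1 → g 2 = 2 →
      (∀ k : Fin 4, x (e (g k.succ.succ.succ)) = y k) → projProjRatio Ω x (e ∘ g) =
      crossRatio (((Ω.curryLeft (x (e 0))).curryLeft (x (e 1))).curryLeft (x (e 2))) y := by
    intro g y h0 h1 h2 hk
    rw [← h0, ← h1, ← h2, projProjRatio, projRatio]
    exact congrArg (crossRatio _) (funext hk)
  refine Eq.trans (congrArg sym2 (key _ _ rfl rfl rfl fun k => ?_)) (h.trans ?_)
  · fin_cases k <;> rfl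
  · refine congrArg₂ (· + ·) (congrArg₂ (· + ·) (congrArg₂ (· + ·) ?_ ?_) ?_) ?_ <;>
    exact congrArg sym2 (key _ _ rfl rfl rfl fun k => by fin_cases k <;> rfl).symm

lemma sym2_projProjRatio_smul_swap₀₁ (Ω : V [⋀^Fin 5]→ₗ[F] F) (x : Fin m → V) (σ : Perm (Fin m))
    (e : Fin 7 → Fin m) :
    sym2 (projProjRatio Ω x (σ • (e ∘ swap 0 1))) = sym2 (projProjRatio Ω x (σ • e)) :=
  congrArg sym2 (projProjRatio_swap₀₁ Ω x (σ • e))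

lemma sym2_projProjRatio_smul_swap₁₂ (Ω : V [⋀^Fin 5]→ₗ[F] F) (x : Fin m → V) (σ : Perm (Fin m))
    (e : Fin 7 → Fin m) :
    sym2 (projProjRatio Ω x (σ • (e ∘ swap 1 2))) = sym2 (projProjRatio Ω x (σ • e)) :=
  congrArg sym2 (projProjRatio_swap₁₂ Ω x (σ • e))

set_option maxHeartbeats 800000 in
/-- The dual nine-term relation for the component in `Λ² B₂`. After an expansion of the second
factor by the dual five-term relation and of the first factor by the five-term relation, each
summand is a relabelling of a known one, or is changed into its opposite by a relabelling which
exchanges the two factors, or does not involve two of the indices. -/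
lemma altSum_projRatioWedge {Ω : V [⋀^Fin 5]→ₗ[F] F} {x : Fin 9 → V} (hx : Generic Ω x) :
    altSum 9 (projRatioWedge Ω x) (![0, 1, 2, 3, 4, 5, 6], ![3, 4, 0, 1, 2, 5, 7]) = 0 := by
  have hF : HasFourElements F := Generic.hasFourElements
    (hx.projRatio₃ (k := 5) (e := ![0, 1, 2, 3, 4, 5, 6, 7]) (by decide) (by decide))
  set f := projRatioWedge Ω x with hf
  have s01 := sym2_projProjRatio_smul_swap₀₁ Ω x
  have s12 := sym2_projProjRatio_smul_swap₁₂ Ω x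
  have s56 : ∀ (σ : Perm (Fin 9)) (e : Fin 7 → Fin 9), Function.Injective e →
      sym2 (projProjRatio Ω x (σ • (e ∘ swap 5 6))) = -sym2 (projProjRatio Ω x (σ • e)) :=
    fun σ e he => sym2_projProjRatio_perm hF hx (e := σ • e) (σ.injective.comp he)
  -- an even permutation exchanges the two factors
  have hA : altSum 9 f (![0, 1, 2, 3, 4, 5, 6], ![3, 4, 5, 1, 2, 0, 7]) = 0 := by
    refine altSum_eq_zero _ ⟨![5, 3, 4, 1, 2, 0, 7, 6, 8], ![5, 3, 4, 1, 2, 0, 7, 6, 8], by decide,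
      by decide⟩ _ fun σ => ?_
    rw [sgn_eq (z := 1) _ (by decide), show (⟨![5, 3, 4, 1, 2, 0, 7, 6, 8],
      ![5, 3, 4, 1, 2, 0, 7, 6, 8], by decide, by decide⟩ : Perm (Fin 9)) •
      ((![0, 1, 2, 3, 4, 5, 6], ![3, 4, 5, 1, 2, 0, 7]) : (Fin 7 → Fin 9) × (Fin 7 → Fin 9)) =
      ((![3, 4, 5, 1, 2, 0, 7] ∘ swap 1 2) ∘ swap 0 1,
        (![0, 1, 2, 3, 4, 5, 6] ∘ swap 0 1) ∘ swap 1 2) by decide, Prod.smul_mk, Prod.smul_mk, hf,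
      projRatioWedge, projRatioWedge, s01, s12, s12, s01, wedge_swap]
    simp
  -- an even permutation exchanges the two factors and changes the sign of both
  have hC : altSum 9 f (![0, 1, 2, 3, 4, 7, 6], ![3, 4, 7, 1, 2, 5, 0]) = 0 := by
    refine altSum_eq_zero _ ⟨![7, 3, 4, 1, 2, 6, 5, 0, 8], ![7, 3, 4, 1, 2, 6, 5, 0, 8], by decide,
      by decide⟩ _ fun σ => ?_
    rw [sgn_eq (z := 1) _ (by decide), show (⟨![7, 3, 4, 1, 2, 6, 5, 0, 8],
      ![7, 3, 4, 1, 2, 6, 5, 0, 8], by decide, by decide⟩ : Perm (Fin 9)) •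
      ((![0, 1, 2, 3, 4, 7, 6], ![3, 4, 7, 1, 2, 5, 0]) : (Fin 7 → Fin 9) × (Fin 7 → Fin 9)) =
      (((![3, 4, 7, 1, 2, 5, 0] ∘ swap 5 6) ∘ swap 1 2) ∘ swap 0 1,
        ((![0, 1, 2, 3, 4, 7, 6] ∘ swap 5 6) ∘ swap 0 1) ∘ swap 1 2) by decide, Prod.smul_mk,
      Prod.smul_mk, hf, projRatioWedge, projRatioWedge, s01, s12, s12, s01,
      s56 _ _ (by decide), s56 _ _ (by decide), wedge_swap]
    simp only [← neg_one_smul ℚ (sym2 _), wedge_smul_left, wedge_smul_right]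
    simp only [Units.val_one, Int.cast_one, one_smul, smul_smul, neg_mul_neg, mul_one]
  -- the indices `6` and `8` do not occur
  have hE : altSum 9 f (![0, 1, 2, 3, 4, 5, 7], ![3, 4, 7, 1, 2, 5, 0]) = 0 :=
    altSum_eq_zero_of_fixed _ (swap 6 8) (by decide) (by decide)
  -- the five-term relation for the first factor, with `x₇` as the additional point
  have hB : altSum 9 f (![0, 1, 2, 3, 4, 5, 6], ![3, 4, 7, 1, 2, 5, 0]) = 0 := by
    have h1 : altSum 9 f (![0, 1, 2, 7, 4, 5, 6], ![3, 4, 7, 1, 2, 5, 0]) =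
        -altSum 9 f (![0, 1, 2, 3, 4, 5, 6], ![3, 4, 7, 1, 2, 5, 0]) := by
      rw [← neg_one_smul ℚ, ← sgn_swap (show (3 : Fin 9) ≠ 7 by decide), ← altSum_smul,
        show swap (3 : Fin 9) 7 • ((![0, 1, 2, 3, 4, 5, 6], ![3, 4, 7, 1, 2, 5, 0]) :
          (Fin 7 → Fin 9) × (Fin 7 → Fin 9)) = (![0, 1, 2, 7, 4, 5, 6],
            ((![3, 4, 7, 1, 2, 5, 0] ∘ swap 0 1) ∘ swap 1 2) ∘ swap 0 1) by decide]
      refine altSum_congr fun σ => ?_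
      rw [Prod.smul_mk, Prod.smul_mk, hf, projRatioWedge, projRatioWedge, s01, s12, s01]
    have h2 : altSum 9 f (![0, 1, 2, 3, 7, 5, 6], ![3, 4, 7, 1, 2, 5, 0]) =
        -altSum 9 f (![0, 1, 2, 3, 4, 5, 6], ![3, 4, 7, 1, 2, 5, 0]) := by
      rw [← neg_one_smul ℚ, ← sgn_swap (show (4 : Fin 9) ≠ 7 by decide), ← altSum_smul,
        show swap (4 : Fin 9) 7 • ((![0, 1, 2, 3, 4, 5, 6], ![3, 4, 7, 1, 2, 5, 0]) :
          (Fin 7 → Fin 9) × (Fin 7 → Fin 9)) = (![0, 1, 2, 3, 7, 5, 6],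
            ![3, 4, 7, 1, 2, 5, 0] ∘ swap 1 2) by decide]
      refine altSum_congr fun σ => ?_
      rw [Prod.smul_mk, Prod.smul_mk, hf, projRatioWedge, projRatioWedge, s12]
    have h : altSum 9 f (![0, 1, 2, 3, 4, 5, 6], ![3, 4, 7, 1, 2, 5, 0]) =
        altSum 9 f (![0, 1, 2, 7, 4, 5, 6], ![3, 4, 7, 1, 2, 5, 0]) +
        altSum 9 f (![0, 1, 2, 3, 7, 5, 6], ![3, 4, 7, 1, 2, 5, 0]) +
        altSum 9 f (![0, 1, 2, 3, 4, 7, 6], ![3, 4, 7, 1, 2, 5, 0]) +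
        altSum 9 f (![0, 1, 2, 3, 4, 5, 7], ![3, 4, 7, 1, 2, 5, 0]) := by
      simp only [altSum, ← Finset.sum_add_distrib, ← smul_add]
      refine Finset.sum_congr rfl fun σ _ => congrArg (fun t => sgn σ • t) ?_
      simp only [Prod.smul_mk, hf, projRatioWedge, ← wedge_add_left]
      have hd := sym2_projProjRatio_subst hF hx
        (e := σ • ![0, 1, 2, 3, 4, 5, 6, 7]) (σ.injective.comp (by decide))
      have hs : ∀ (g : Fin 7 → Fin 8) (e : Fin 7 → Fin 9), ![0, 1, 2, 3, 4, 5, 6, 7] ∘ g = e →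
          (σ • ![0, 1, 2, 3, 4, 5, 6, 7]) ∘ g = σ • e := by
        rintro g _ rfl
        rfl
      rw [hs ![0, 1, 2, 3, 4, 5, 6] ![0, 1, 2, 3, 4, 5, 6] (by decide),
        hs ![0, 1, 2, 7, 4, 5, 6] ![0, 1, 2, 7, 4, 5, 6] (by decide),
        hs ![0, 1, 2, 3, 7, 5, 6] ![0, 1, 2, 3, 7, 5, 6] (by decide),
        hs ![0, 1, 2, 3, 4, 7, 6] ![0, 1, 2, 3, 4, 7, 6] (by decide),
        hs ![0, 1, 2, 3, 4, 5, 7] ![0, 1, 2, 3, 4, 5, 7] (by decide)] at hd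
      rw [hd]
    rw [h1, h2, hC, hE] at h
    linear_combination (norm := module) (1 / 3 : ℚ) • h
  -- the dual five-term relation for the second factor: the first two of its four terms
  have h1 : altSum 9 f (![0, 1, 2, 3, 4, 5, 6], ![3, 4, 1, 0, 2, 5, 7]) =
      -altSum 9 f (![0, 1, 2, 3, 4, 5, 6], ![3, 4, 0, 1, 2, 5, 7]) := by
    rw [← neg_one_smul ℚ, ← sgn_swap (show (0 : Fin 9) ≠ 1 by decide), ← altSum_smul,
      show swap (0 : Fin 9) 1 • ((![0, 1, 2, 3, 4, 5, 6], ![3, 4, 0, 1, 2, 5, 7]) :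
        (Fin 7 → Fin 9) × (Fin 7 → Fin 9)) = (![0, 1, 2, 3, 4, 5, 6] ∘ swap 0 1,
          ![3, 4, 1, 0, 2, 5, 7]) by decide]
    refine altSum_congr fun σ => ?_
    rw [Prod.smul_mk, Prod.smul_mk, hf, projRatioWedge, projRatioWedge, s01]
  have h2 : altSum 9 f (![0, 1, 2, 3, 4, 5, 6], ![3, 4, 2, 1, 0, 5, 7]) =
      -altSum 9 f (![0, 1, 2, 3, 4, 5, 6], ![3, 4, 0, 1, 2, 5, 7]) := by
    rw [← neg_one_smul ℚ, ← sgn_swap (show (0 : Fin 9) ≠ 2 by decide), ← altSum_smul,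
      show swap (0 : Fin 9) 2 • ((![0, 1, 2, 3, 4, 5, 6], ![3, 4, 0, 1, 2, 5, 7]) :
        (Fin 7 → Fin 9) × (Fin 7 → Fin 9)) =
          (((![0, 1, 2, 3, 4, 5, 6] ∘ swap 0 1) ∘ swap 1 2) ∘ swap 0 1,
            ![3, 4, 2, 1, 0, 5, 7]) by decide]
    refine altSum_congr fun σ => ?_
    rw [Prod.smul_mk, Prod.smul_mk, hf, projRatioWedge, projRatioWedge, s01, s12, s01]
  have h : altSum 9 f (![0, 1, 2, 3, 4, 5, 6], ![3, 4, 0, 1, 2, 5, 7]) =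
      altSum 9 f (![0, 1, 2, 3, 4, 5, 6], ![3, 4, 1, 0, 2, 5, 7]) +
      altSum 9 f (![0, 1, 2, 3, 4, 5, 6], ![3, 4, 2, 1, 0, 5, 7]) +
      altSum 9 f (![0, 1, 2, 3, 4, 5, 6], ![3, 4, 5, 1, 2, 0, 7]) +
      altSum 9 f (![0, 1, 2, 3, 4, 5, 6], ![3, 4, 7, 1, 2, 5, 0]) := by
    simp only [altSum, ← Finset.sum_add_distrib, ← smul_add]
    refine Finset.sum_congr rfl fun σ _ => congrArg (fun t => sgn σ • t) ?_
    simp only [Prod.smul_mk, hf, projRatioWedge, ← wedge_add_right]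
    have hd := sym2_projProjRatio_dual hF hx (e := σ • ![3, 4, 0, 1, 2, 5, 7])
      (σ.injective.comp (by decide))
    have hs : ∀ (τ : Perm (Fin 7)) (e : Fin 7 → Fin 9), ![3, 4, 0, 1, 2, 5, 7] ∘ τ = e →
        (σ • ![3, 4, 0, 1, 2, 5, 7]) ∘ τ = σ • e := by
      rintro τ _ rfl
      rfl
    rw [hs (swap 2 3) ![3, 4, 1, 0, 2, 5, 7] (by decide),
      hs (swap 2 4) ![3, 4, 2, 1, 0, 5, 7] (by decide),
      hs (swap 2 5) ![3, 4, 5, 1, 2, 0, 7] (by decide),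
      hs (swap 2 6) ![3, 4, 7, 1, 2, 5, 0] (by decide)] at hd
    rw [hd]
  rw [h1, h2, hA, hB] at h
  linear_combination (norm := module) (1 / 3 : ℚ) • h

lemma ratioWedge_dual_nine_term {Ω : V [⋀^Fin 5]→ₗ[F] F} {x : Fin 9 → V} (hx : Generic Ω x) :
    ∑ i : Fin 9, (-1 : ℚ) ^ (i : ℕ) • altSum 8 (ratioWedge (Ω.curryLeft (x i)) (x ∘ i.succAbove))
      (![0, 1, 2, 3, 4, 5], ![2, 3, 0, 1, 4, 6]) = 0 := by
  rw [sum_altSum_succAbove _ (projRatioWedge Ω x) _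
    ((Matrix.vecCons 0 (Fin.succ ∘ ![0, 1, 2, 3, 4, 5]),
      Matrix.vecCons 0 (Fin.succ ∘ ![2, 3, 0, 1, 4, 6])) :
      (Fin 7 → Fin 9) × (Fin 7 → Fin 9)) fun i σ => by
    rw [ratioWedge_comp, Prod.smul_mk, Prod.smul_mk, cycleRange_symm_smul_vecCons,
      cycleRange_symm_smul_vecCons]
    rfl]
  rw [← altSum_projRatioWedge hx, show Matrix.vecCons 0 (Fin.succ ∘
      (![0, 1, 2, 3, 4, 5] : Fin 6 → Fin 8)) = ![0, 1, 2, 3, 4, 5, 6] by decide,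
    show Matrix.vecCons 0 (Fin.succ ∘ (![2, 3, 0, 1, 4, 6] : Fin 6 → Fin 8)) =
      (![3, 4, 0, 1, 2, 5, 7] ∘ swap 1 2) ∘ swap 0 1 by decide]
  refine altSum_congr fun σ => ?_
  rw [Prod.smul_mk, Prod.smul_mk, projRatioWedge, projRatioWedge, sym2_projProjRatio_smul_swap₀₁,
    sym2_projProjRatio_smul_swap₁₂]

end SecondComponent

/-! ### The cobracket -/

section Cobracket

variable {F V W : Type*} [Field F] [AddCommGroup V] [Module F V] [AddCommGroup W] [Module F W]
  {m n k : ℕ}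

/-- The cobracket of a configuration of eight vectors in a space with a volume form. -/
noncomputable def cobracket (ω : V [⋀^Fin 4]→ₗ[F] F) (x : Fin 8 → V) : Target F :=
  (cobracket31 ω x, (-144 / 7 : ℚ) •
    altSum 8 (ratioWedge ω x) (![0, 1, 2, 3, 4, 5], ![2, 3, 0, 1, 4, 6]))

lemma ScaledBy.cobracket_eq {ω : V [⋀^Fin 4]→ₗ[F] F} {ω' : W [⋀^Fin 4]→ₗ[F] F} {x : Fin 8 → V}
    {x' : Fin 8 → W} (h : ScaledBy ω ω' x x') (hx : Generic ω x) :
    cobracket ω' x' = cobracket ω x := by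
  rw [cobracket, cobracket, h.cobracket31_eq hx, h.ratioWedge_eq]

lemma cobracket_perm (ω : V [⋀^Fin 4]→ₗ[F] F) (x : Fin 8 → V) (τ : Perm (Fin 8)) :
    cobracket ω (x ∘ τ) = sgn τ • cobracket ω x := by
  rw [cobracket, cobracket, cobracket31_perm, Prod.smul_mk, smul_comm (sgn τ)]
  rw [altSum_comp_smul (ratioWedge ω (x ∘ τ)) (ratioWedge ω x) τ fun y => rfl]

lemma cobracket_nine_term {ω : V [⋀^Fin 4]→ₗ[F] F} {x : Fin 9 → V} (hx : Generic ω x) :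
    ∑ i : Fin 9, (-1 : ℚ) ^ (i : ℕ) • cobracket ω (x ∘ i.succAbove) = 0 := by
  refine Prod.ext ?_ ?_
  · rw [Prod.fst_sum]
    exact cobracket31_nine_term hx
  · have h := congrArg (fun t : ⋀[ℚ]^2 (B2 F) => (-144 / 7 : ℚ) • t) (ratioWedge_nine_term ω x)
    simp only [Finset.smul_sum, smul_comm (-144 / 7 : ℚ), smul_zero] at h
    rw [Prod.snd_sum]
    exact h

lemma cobracket_dual_nine_term {Ω : V [⋀^Fin 5]→ₗ[F] F} {x : Fin 9 → V} (hx : Generic Ω x) :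
    ∑ i : Fin 9, (-1 : ℚ) ^ (i : ℕ) • cobracket (Ω.curryLeft (x i)) (x ∘ i.succAbove) = 0 := by
  refine Prod.ext ?_ ?_
  · rw [Prod.fst_sum]
    exact cobracket31_dual_nine_term hx
  · have h := congrArg (fun t : ⋀[ℚ]^2 (B2 F) => (-144 / 7 : ℚ) • t)
      (ratioWedge_dual_nine_term hx)
    simp only [Finset.smul_sum, smul_comm (-144 / 7 : ℚ), smul_zero] at h
    rw [Prod.snd_sum]
    exact h

lemma exists_eq_mul_stdVol (ω : (Fin n → F) [⋀^Fin n]→ₗ[F] F) :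
    ∃ μ : F, ∀ v, ω v = μ * stdVol F n v := by
  refine ⟨ω (Pi.basisFun F (Fin n)), fun v => ?_⟩
  have h := congrArg (fun f : (Fin n → F) [⋀^Fin n]→ₗ[F] F => f v)
    (AlternatingMap.eq_smul_basis_det (Pi.basisFun F (Fin n)) ω)
  simp only [AlternatingMap.smul_apply, Pi.basisFun_det, smul_eq_mul] at h
  exact h

/-- Vectors which represent the points of a configuration. -/
noncomputable def Conf.reps (c : Conf F n m) : Fin m → (Fin n → F) := fun j => (c.1 j).rep

lemma Conf.generic (c : Conf F n m) : Generic (stdVol F n) c.reps := by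
  refine GenericVectors.generic fun s => ?_
  have h := Projectivization.independent_iff.1 (c.2 s)
  exact h

lemma scaledBy_of_smul {ω : V [⋀^Fin n]→ₗ[F] F} {ω' : W [⋀^Fin n]→ₗ[F] F} {x : Fin m → V}
    {x' : Fin m → W} (l : Fin m → F) (hl : ∀ j, l j ≠ 0) (μ : F) (hμ : μ ≠ 0) (g : V →ₗ[F] W)
    (hg : ∀ v, ω' (fun i => g (v i)) = μ * ω v) (h : ∀ j, x' j = l j • g (x j)) :
    ScaledBy ω ω' x x' := by
  refine ⟨μ, l, hμ, hl, fun e => ?_⟩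
  have h1 : x' ∘ e = fun i => l (e i) • g (x (e i)) := funext fun i => h (e i)
  rw [h1, ω'.toMultilinearMap.map_smul_univ (fun i => l (e i)) (fun i => g (x (e i))) |>
    fun t => (show ω' (fun i => l (e i) • g (x (e i))) = _ from t), smul_eq_mul]
  have h2 := hg (x ∘ e)
  change _ * ω' (fun i => g (x (e i))) = _
  rw [show (fun i => g (x (e i))) = fun i => g ((x ∘ e) i) from rfl, h2]
  ring

lemma Conf.scaledBy (c : Conf F n m) (v : Fin m → (Fin n → F))
    (ω : (Fin n → F) [⋀^Fin n]→ₗ[F] F) (hω : ω ≠ 0)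
    (hv : ∀ j, ∃ h : v j ≠ 0, c.1 j = Projectivization.mk F (v j) h) :
    ScaledBy (stdVol F n) ω c.reps v := by
  obtain ⟨μ, hμ⟩ := exists_eq_mul_stdVol ω
  have h0 : μ ≠ 0 := by
    rintro rfl
    exact hω (AlternatingMap.ext fun v => by simp [hμ])
  have h1 : ∀ j, ∃ a : Fˣ, v j = a • c.reps j := by
    intro j
    obtain ⟨h, hj⟩ := hv j
    obtain ⟨a, ha⟩ := Projectivization.exists_smul_eq_mk_rep F (v j) h
    refine ⟨a⁻¹, ?_⟩
    rw [Conf.reps, hj, ← ha, inv_smul_smul]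
  choose a ha using h1
  exact scaledBy_of_smul (fun j => (a j : F)) (fun j => (a j).ne_zero) μ h0 LinearMap.id
    (fun v => hμ v) ha

/-- The cobracket of a configuration of points. -/
noncomputable def Conf.cobracket (c : Conf F 4 8) : Target F :=
  Tetralog.cobracket (stdVol F 4) c.reps

lemma Conf.cobracket_perm (c : Conf F 4 8) (σ : Perm (Fin 8)) :
    (c.perm σ).cobracket = sgn σ • c.cobracket :=
  Tetralog.cobracket_perm (stdVol F 4) c.reps σ

lemma Conf.cobracket_smul (c c' : Conf F 4 8) (g : LinearMap.GeneralLinearGroup F (Fin 4 → F))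
    (h : ∀ j, c'.1 j = g • c.1 j) : c'.cobracket = c.cobracket := by
  let g' : (Fin 4 → F) →ₗ[F] (Fin 4 → F) := g
  have hinv : ∀ v, g' ((g⁻¹ : LinearMap.GeneralLinearGroup F (Fin 4 → F)) • v) = v :=
    fun v => smul_inv_smul g v
  obtain ⟨μ, hμ⟩ := exists_eq_mul_stdVol ((stdVol F 4).compLinearMap g')
  have h0 : μ ≠ 0 := by
    rintro rfl
    have h1 := hμ fun i => (g⁻¹ : LinearMap.GeneralLinearGroup F (Fin 4 → F)) •
      (Pi.basisFun F (Fin 4) i)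
    rw [zero_mul, AlternatingMap.compLinearMap_apply] at h1
    simp only [hinv] at h1
    refine (stdVol_ne_zero_iff _).2 (Pi.basisFun F (Fin 4)).linearIndependent h1
  have h1 : ∀ j, ∃ a : Fˣ, c'.reps j = (a : F) • g' (c.reps j) := by
    intro j
    have hne : g' (c.reps j) ≠ 0 := by
      intro h0
      apply (c.1 j).rep_nonzero
      exact (smul_eq_zero_iff_eq g).1 h0
    have hj : c'.1 j = Projectivization.mk F (g' (c.reps j)) hne := by
      rw [h j]
      conv_lhs => rw [← Projectivization.mk_rep (c.1 j)]
      rfl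
    obtain ⟨a, ha⟩ := Projectivization.exists_smul_eq_mk_rep F (g' (c.reps j)) hne
    refine ⟨a, ?_⟩
    rw [Conf.reps, hj, ← ha]
    rfl
  choose a ha using h1
  exact (scaledBy_of_smul (fun j => (a j : F)) (fun j => (a j).ne_zero) μ h0 g'
    (fun v => hμ v) ha).cobracket_eq c.generic

set_option maxRecDepth 4000 in
lemma scaledBy_of_isProjectionFrom (p : Conf F 5 m) (i : Fin m) {s : Fin k → Fin m}
    (hs : Function.Injective s) (hi : ∀ j, s j ≠ i) (hk : 4 ≤ k) (c : Conf F 4 k)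
    (h : IsProjectionFrom (p.1 i) (p.1 ∘ s) c.1) :
    ScaledBy ((stdVol F 5).curryLeft (p.reps i)) (stdVol F 4) (p.reps ∘ s) c.reps := by
  obtain ⟨π, hker, hy⟩ := h
  have hker' : LinearMap.ker π = Submodule.span F {p.reps i} := by
    rw [hker, Projectivization.submodule_eq]
    rfl
  have hsurj : Function.Surjective π := by
    have h1 := LinearMap.finrank_range_add_finrank_ker π
    have h2 : Module.finrank F (Submodule.span F {p.reps i}) = 1 :=
      finrank_span_singleton (p.1 i).rep_nonzero
    rw [hker', h2, Module.finrank_fin_fun] at h1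
    rw [← LinearMap.range_eq_top]
    apply Submodule.eq_top_of_finrank_eq
    rw [Module.finrank_fin_fun]
    omega
  obtain ⟨a, ha⟩ := exists_curryLeft_eq (stdVol F 5) (p.reps i) π hsurj hker'
  have ha0 : a ≠ 0 := by
    rintro rfl
    have h1 := (p.generic.proj i hs hi hk).ne_zero (e := Fin.castLE hk) (Fin.castLE_injective hk)
    rw [ha, zero_mul] at h1
    exact h1 rfl
  have h1 : ∀ j, ∃ b : F, b ≠ 0 ∧ c.reps j = b • π ((p.reps ∘ s) j) := by
    intro j
    have hj := hy j
    rw [Projectivization.submodule_eq, Projectivization.submodule_eq, Submodule.map_span,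
      Set.image_singleton] at hj
    have hmem : (c.1 j).rep ∈ Submodule.span F {(c.1 j).rep} := Submodule.mem_span_singleton_self _
    rw [hj] at hmem
    obtain ⟨b, hb⟩ := Submodule.mem_span_singleton.1 hmem
    refine ⟨b, ?_, hb.symm⟩
    rintro rfl
    rw [zero_smul] at hb
    exact (c.1 j).rep_nonzero hb.symm
  choose b hb hb' using h1
  exact scaledBy_of_smul b hb a⁻¹ (inv_ne_zero ha0) π
    (fun v => by rw [ha, inv_mul_cancel_left₀ ha0]) hb'

lemma neg_one_pow_zsmul {A : Type*} [AddCommGroup A] [Module ℚ A] (i : ℕ) (t : A) :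
    (-1 : ℤ) ^ i • t = (-1 : ℚ) ^ i • t := by
  rw [← Int.cast_smul_eq_zsmul ℚ]
  push_cast
  rfl

/-- The cobracket `δ` on `G̃₄(F)`. -/
lemma exists_cobracket (F : Type*) [Field F] :
    ∃ δ : G4 F →+ Target F, ∀ c : Conf F 4 8, δ (G4.mk c) = c.cobracket := by
  let L : (Conf F 4 8 →₀ ℤ) →ₗ[ℤ] Target F := Finsupp.linearCombination ℤ Conf.cobracket
  have hL : ∀ c, L (Finsupp.single c 1) = c.cobracket := fun c => by
    simp [L, Finsupp.linearCombination_single]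
  have hrel : relG4 F ≤ LinearMap.ker L := by
    rw [relG4, Submodule.span_le]
    rintro z (((⟨c, c', g, h, rfl⟩ | ⟨c, σ, rfl⟩) | ⟨p, c, h, rfl⟩) | ⟨p, c, h, rfl⟩)
    · rw [SetLike.mem_coe, LinearMap.mem_ker, map_sub, hL, hL, c.cobracket_smul c' g h, sub_self]
    · rw [SetLike.mem_coe, LinearMap.mem_ker, map_sub, map_smul, hL, hL, c.cobracket_perm,
        ← Int.cast_smul_eq_zsmul ℚ]
      change _ - sgn σ • sgn σ • _ = _
      rw [smul_smul, sgn_mul_self, one_smul, sub_self]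
    · rw [SetLike.mem_coe, LinearMap.mem_ker, map_sum, ← cobracket_nine_term p.generic]
      refine Finset.sum_congr rfl fun i _ => ?_
      rw [map_smul, hL, neg_one_pow_zsmul]
      refine congrArg (fun t : Target F => (-1 : ℚ) ^ (i : ℕ) • t) ?_
      refine congrArg (cobracket _) (funext fun j => ?_)
      exact congrArg Projectivization.rep (congrFun (h i) j)
    · rw [SetLike.mem_coe, LinearMap.mem_ker, map_sum, ← cobracket_dual_nine_term p.generic]
      refine Finset.sum_congr rfl fun i _ => ?_
      rw [map_smul, hL, neg_one_pow_zsmul]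
      refine congrArg (fun t : Target F => (-1 : ℚ) ^ (i : ℕ) • t) ?_
      have hs : Function.Injective i.succAbove := Fin.succAbove_right_injective
      have hi : ∀ j : Fin 8, i.succAbove j ≠ i := Fin.succAbove_ne i
      have h48 : 4 ≤ 8 := by norm_num
      have hp : ScaledBy ((stdVol F 5).curryLeft (p.reps i)) (stdVol F 4) (p.reps ∘ i.succAbove)
          (c i).reps :=
        scaledBy_of_isProjectionFrom p i hs hi h48
          (c i) (h i)
      exact (hp.symm.cobracket_eq (c i).generic).symm
  refine ⟨((relG4 F).liftQ L hrel).toAddMonoidHom, fun c => ?_⟩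
  change (relG4 F).liftQ L hrel ((relG4 F).mkQ (Finsupp.single c 1)) = _
  rw [Submodule.mkQ_apply, Submodule.liftQ_apply, hL]

lemma vol_smul_right (ω : V [⋀^Fin 4]→ₗ[F] F) (v : Fin 8 → V) (σ : Perm (Fin 8)) :
    vol ω v (σ • {4, 5, 6, 7}) = unitClass (ω ![v (σ 4), v (σ 5), v (σ 6), v (σ 7)]) := by
  rw [vol_eq ω v (σ • ![4, 5, 6, 7]) (σ.injective.comp (by decide))]
  · simp [comp_vecCons, comp_vecEmpty]
  · rw [Finset.smul_finset_def, show ({4, 5, 6, 7} : Finset (Fin 8)) =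
      Finset.univ.image (![4, 5, 6, 7] : Fin 4 → Fin 8) by decide, Finset.image_image]
    rfl

lemma vol_smul_left (ω : V [⋀^Fin 4]→ₗ[F] F) (v : Fin 8 → V) (σ : Perm (Fin 8)) :
    vol ω v (σ • {0, 1, 2, 3}) = unitClass (ω ![v (σ 0), v (σ 1), v (σ 2), v (σ 3)]) := by
  rw [vol_eq ω v (σ • ![0, 1, 2, 3]) (σ.injective.comp (by decide))]
  · simp [comp_vecCons, comp_vecEmpty]
  · rw [Finset.smul_finset_def, show ({0, 1, 2, 3} : Finset (Fin 8)) =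
      Finset.univ.image (![0, 1, 2, 3] : Fin 4 → Fin 8) by decide, Finset.image_image]
    rfl

/-- The cobracket of a configuration is given by the formula which defines `δ`, for any choice of
vectors and of a volume form. -/
lemma throughA3_delta_eq (c : Conf F 4 8) (v : Fin 8 → (Fin 4 → F))
    (ω : (Fin 4 → F) [⋀^Fin 4]→ₗ[F] F) (hω : ω ≠ 0)
    (hv : ∀ j, ∃ h : v j ≠ 0, c.1 j = Projectivization.mk F (v j) h) :
    throughA3 (delta31 ω v c) (delta13 ω v c) (delta22 ω v) = c.cobracket := by
  have hs := c.scaledBy v ω hω hv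
  rw [Conf.cobracket, ← hs.cobracket_eq c.generic]
  refine Prod.ext ?_ (delta22_eq ω v)
  have hU : ∀ σ α β, vol ω v ((σ * blockPerm α β) • {4, 5, 6, 7}) +
      vol ω v ((σ * blockPerm α β) • {0, 1, 2, 3}) =
      vol ω v (σ • {4, 5, 6, 7}) + vol ω v (σ • {0, 1, 2, 3}) := by
    intro σ α β
    rw [mul_smul, mul_smul, blockPerm_smul_right, blockPerm_smul_left]
  have key := sum_a3Vec_tmul (stdVol F 4) c.reps
    (fun σ => vol ω v (σ • {4, 5, 6, 7}) + vol ω v (σ • {0, 1, 2, 3})) hU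
  have ha : ∀ σ : Perm (Fin 8), a3 F (Finsupp.single (c.perm σ) 1) =
      a3Vec (stdVol F 4) (fun k => c.reps (σ (Fin.castAdd 4 k)))
        (fun k => c.reps (σ (Fin.natAdd 4 k))) := by
    intro σ
    rw [a3, Finsupp.linearCombination_single, one_smul]
    rfl
  change TensorProduct.map (a3 F) LinearMap.id (delta31 ω v c) -
    TensorProduct.comm ℚ (MultQ F) (B3 F) (TensorProduct.map LinearMap.id (a3 F) (delta13 ω v c)) =
      cobracket31 ω v
  have h1 : TensorProduct.map (a3 F) LinearMap.id (delta31 ω v c) -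
      TensorProduct.comm ℚ (MultQ F) (B3 F)
        (TensorProduct.map LinearMap.id (a3 F) (delta13 ω v c)) =
      ∑ σ : Perm (Fin 8), sgn σ • (a3Vec (stdVol F 4) (fun k => c.reps (σ (Fin.castAdd 4 k)))
        (fun k => c.reps (σ (Fin.natAdd 4 k))) ⊗ₜ[ℚ]
          (vol ω v (σ • {4, 5, 6, 7}) + vol ω v (σ • {0, 1, 2, 3}))) := by
    simp only [delta31, delta13, map_neg, map_sum, map_smul, TensorProduct.map_tmul,
      TensorProduct.comm_tmul, LinearMap.id_apply, ha, sub_neg_eq_add, ← Finset.sum_add_distrib,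
      ← smul_add, ← TensorProduct.tmul_add, vol_smul_left, vol_smul_right]
    rfl
  rw [h1, key, cobracket31]
  simp only [TensorProduct.tmul_add, smul_add, Finset.sum_add_distrib, altSum, Prod.smul_mk,
    r3Vol, ratioVol, hs.projR3_eq, hs.projRatio_eq]

end Cobracket

/-! ### The differential `B₂ → Λ² F*` -/

section BlochDifferential

variable {F V : Type*} [Field F] [AddCommGroup V] [Module F V]

lemma wedge_zero_left {M : Type*} [AddCommGroup M] [Module ℚ M] (a : M) : wedge 0 a = 0 := by
  have h := wedge_smul_left (0 : ℚ) (0 : M) a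
  rwa [zero_smul, zero_smul] at h

lemma wedge_neg_left {M : Type*} [AddCommGroup M] [Module ℚ M] (a b : M) :
    wedge (-a) b = -wedge a b := by
  rw [← neg_one_smul ℚ a, wedge_smul_left]
  exact neg_one_smul ℚ (wedge a b)

lemma wedge_neg_right {M : Type*} [AddCommGroup M] [Module ℚ M] (a b : M) :
    wedge a (-b) = -wedge a b := by
  rw [wedge_swap, wedge_neg_left, wedge_swap b, neg_neg]

lemma wedge_sub_left {M : Type*} [AddCommGroup M] [Module ℚ M] (a b c : M) :
    wedge (a - b) c = wedge a c - wedge b c := by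
  rw [sub_eq_add_neg, wedge_add_left, wedge_neg_left, sub_eq_add_neg]

lemma wedge_sub_right {M : Type*} [AddCommGroup M] [Module ℚ M] (a b c : M) :
    wedge a (b - c) = wedge a b - wedge a c := by
  rw [sub_eq_add_neg, wedge_add_right, wedge_neg_right, sub_eq_add_neg]

/-- `(1 - x) ∧ x`. -/
noncomputable def logPair (x : F) : ⋀[ℚ]^2 (MultQ F) := wedge (unitClass (1 - x)) (unitClass x)

lemma unitClass_crossRatio {ω : V [⋀^Fin 2]→ₗ[F] F} {x : Fin 4 → V} (hx : Generic ω x) :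
    unitClass (crossRatio ω x) = unitClass (ω ![x 0, x 2]) + unitClass (ω ![x 1, x 3]) -
      unitClass (ω ![x 0, x 3]) - unitClass (ω ![x 1, x 2]) := by
  have h02 := hx.ne_zero₂ (show (0 : Fin 4) ≠ 2 by decide)
  have h13 := hx.ne_zero₂ (show (1 : Fin 4) ≠ 3 by decide)
  have h03 := hx.ne_zero₂ (show (0 : Fin 4) ≠ 3 by decide)
  have h12 := hx.ne_zero₂ (show (1 : Fin 4) ≠ 2 by decide)
  rw [crossRatio, unitClass_div (mul_ne_zero h02 h13) (mul_ne_zero h03 h12),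
    unitClass_mul h02 h13, unitClass_mul h03 h12, sub_sub]

lemma unitClass_one_sub_crossRatio {ω : V [⋀^Fin 2]→ₗ[F] F} {x : Fin 4 → V} (hx : Generic ω x) :
    unitClass (1 - crossRatio ω x) = unitClass (ω ![x 0, x 1]) + unitClass (ω ![x 2, x 3]) -
      unitClass (ω ![x 0, x 3]) - unitClass (ω ![x 1, x 2]) := by
  have h01 := hx.ne_zero₂ (show (0 : Fin 4) ≠ 1 by decide)
  have h23 := hx.ne_zero₂ (show (2 : Fin 4) ≠ 3 by decide)
  have h03 := hx.ne_zero₂ (show (0 : Fin 4) ≠ 3 by decide)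
  have h12 := hx.ne_zero₂ (show (1 : Fin 4) ≠ 2 by decide)
  rw [one_sub_crossRatio hx, neg_div, unitClass_neg,
    unitClass_div (mul_ne_zero h01 h23) (mul_ne_zero h03 h12),
    unitClass_mul h01 h23, unitClass_mul h03 h12, sub_sub]

/-- `Δ(a,b) ∧ Δ(b,c) + Δ(b,c) ∧ Δ(a,c) + Δ(a,c) ∧ Δ(a,b)`. -/
noncomputable def triangle (ω : V [⋀^Fin 2]→ₗ[F] F) (a b c : V) : ⋀[ℚ]^2 (MultQ F) :=
  wedge (unitClass (ω ![a, b])) (unitClass (ω ![b, c])) +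
    wedge (unitClass (ω ![b, c])) (unitClass (ω ![a, c])) +
    wedge (unitClass (ω ![a, c])) (unitClass (ω ![a, b]))

/-- `(1 - r) ∧ r`, for a cross-ratio `r`, is the coboundary of a function of three points. -/
lemma logPair_crossRatio {ω : V [⋀^Fin 2]→ₗ[F] F} {x : Fin 4 → V} (hx : Generic ω x) :
    logPair (crossRatio ω x) = triangle ω (x 1) (x 2) (x 3) - triangle ω (x 0) (x 2) (x 3) +
      triangle ω (x 0) (x 1) (x 3) - triangle ω (x 0) (x 1) (x 2) := by
  rw [logPair, unitClass_crossRatio hx, unitClass_one_sub_crossRatio hx]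
  simp only [triangle, wedge_add_left, wedge_add_right, wedge_sub_left, wedge_sub_right, wedge_self]
  rw [wedge_swap (unitClass (ω ![x 1, x 2])) (unitClass (ω ![x 0, x 3])),
    wedge_swap (unitClass (ω ![x 0, x 1])) (unitClass (ω ![x 0, x 3])),
    wedge_swap (unitClass (ω ![x 0, x 2])) (unitClass (ω ![x 0, x 1])),
    wedge_swap (unitClass (ω ![x 0, x 2])) (unitClass (ω ![x 2, x 3])),
    wedge_swap (unitClass (ω ![x 1, x 2])) (unitClass (ω ![x 2, x 3])),
    wedge_swap (unitClass (ω ![x 1, x 2])) (unitClass (ω ![x 1, x 3])),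
    wedge_swap (unitClass (ω ![x 0, x 3])) (unitClass (ω ![x 1, x 3]))]
  abel

/-- The linear map with `{x} ↦ (1 - x) ∧ x`. -/
noncomputable def logPairHom (F : Type*) [Field F] :
    ({x : F // x ≠ 0 ∧ x ≠ 1} →₀ ℚ) →ₗ[ℚ] ⋀[ℚ]^2 (MultQ F) :=
  Finsupp.linearCombination ℚ fun x => logPair (x : F)

lemma logPairHom_pre2 (x : F) : logPairHom F (pre2 x) = logPair x := by
  by_cases h : x ≠ 0 ∧ x ≠ 1
  · rw [pre2, dif_pos h, logPairHom, Finsupp.linearCombination_single, one_smul]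
  · rw [pre2, dif_neg h, map_zero, logPair]
    by_cases h0 : x = 0
    · rw [h0, sub_zero, unitClass_one, wedge_zero_left]
    · have h1 : x = 1 := by
        by_contra h1
        exact h ⟨h0, h1⟩
      rw [h1, sub_self, unitClass_zero, wedge_zero_left]

/-- The differential `B₂ → Λ² F*` with `{x}₂ ↦ (1 - x) ∧ x`. -/
noncomputable def blochDifferential (F : Type*) [Field F] : B2 F →ₗ[ℚ] ⋀[ℚ]^2 (MultQ F) :=
  (R2 F).liftQ (logPairHom F) <| by
    rw [R2, Submodule.span_le]
    rintro z ⟨x, hx, rfl⟩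
    have h : ∀ i : Fin 5, Generic (stdVol F 2) (x ∘ i.succAbove) := fun i =>
      hx.generic.comp Fin.succAbove_right_injective
    rw [SetLike.mem_coe, LinearMap.mem_ker, map_sum]
    simp only [map_smul, logPairHom_pre2, logPair_crossRatio (h _)]
    have s : ∀ (i : Fin 5) (k : Fin 4), i.succAbove k = (![![1, 2, 3, 4], ![0, 2, 3, 4],
        ![0, 1, 3, 4], ![0, 1, 2, 4], ![0, 1, 2, 3]] : Fin 5 → Fin 4 → Fin 5) i k := by decide
    simp only [Fin.sum_univ_five, Function.comp_apply, s, Matrix.cons_val]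
    norm_num
    module

lemma blochDifferential_sym2 (x : F) : blochDifferential F (sym2 x) = logPair x := by
  rw [sym2, blochDifferential, Submodule.mkQ_apply, Submodule.liftQ_apply, logPairHom_pre2]

end BlochDifferential

section SmallFields

/-- A field with at most three elements is finite, so that its multiplicative group is torsion. -/
lemma subsingleton_multQ_of_not_hasFourElements {F : Type*} [Field F] (h : ¬HasFourElements F) :
    Subsingleton (MultQ F) := by
  classical
  have hfin : Finite F := by
    by_contra hinf
    rw [not_finite_iff_infinite] at hinf
    obtain ⟨a, ha⟩ := Infinite.exists_notMem_finset ({0, 1} : Finset F)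
    obtain ⟨b, hb⟩ := Infinite.exists_notMem_finset ({0, 1, a} : Finset F)
    simp only [Finset.mem_insert, Finset.mem_singleton, not_or] at ha hb
    exact h ⟨a, b, ha.1, ha.2, hb.1, hb.2.1, fun hab => hb.2.2 hab.symm⟩
  refine subsingleton_of_forall_eq 0 fun t => ?_
  induction t using TensorProduct.induction_on with
  | zero => rfl
  | add s t hs ht => rw [hs, ht, add_zero]
  | tmul q u =>
    have hn : (Nat.card Fˣ : ℚ) ≠ 0 := Nat.cast_ne_zero.2 Nat.card_pos.ne'
    have hu : (Nat.card Fˣ : ℤ) • u = 0 := by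
      rw [natCast_zsmul]
      exact congrArg Additive.ofMul (pow_card_eq_one' (x := u.toMul))
    have hq : q = (Nat.card Fˣ : ℤ) • (q / Nat.card Fˣ) := by
      rw [zsmul_eq_mul, Int.cast_natCast, mul_div_cancel₀ _ hn]
    rw [hq, TensorProduct.smul_tmul, hu, TensorProduct.tmul_zero]

end SmallFields

/-! ### The differential `B₃ → B₂ ⊗ F*` -/

section TrilogDifferential

variable {F V : Type*} [Field F] [AddCommGroup V] [Module F V] {m : ℕ}

/-- The linear map with `{x} ↦ {x}₂ ⊗ x`. -/
noncomputable def symTensor (F : Type*) [Field F] : (Fˣ →₀ ℚ) →ₗ[ℚ] B2 F ⊗[ℚ] MultQ F :=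
  Finsupp.linearCombination ℚ fun x => sym2 (x : F) ⊗ₜ unitClass (x : F)

lemma symTensor_pre3 (x : F) : symTensor F (pre3 x) = sym2 x ⊗ₜ unitClass x := by
  by_cases h : x = 0
  · rw [pre3, dif_neg (not_not.2 h), map_zero, h, sym2_zero, TensorProduct.zero_tmul]
  · rw [pre3, dif_pos h, symTensor, Finsupp.linearCombination_single, one_smul]
    rfl

/-- `{(x_{e₀} | x_{e₁}, …, x_{e₄})}₂ ⊗ Δ(I)` for a configuration in the plane. -/
noncomputable def planeTerm (ω : V [⋀^Fin 3]→ₗ[F] F) (x : Fin m → V)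
    (p : (Fin 5 → Fin m) × Finset (Fin m)) : B2 F ⊗[ℚ] MultQ F :=
  sym2 (crossRatio (ω.curryLeft (x (p.1 0))) (fun k : Fin 4 => x (p.1 k.succ))) ⊗ₜ vol ω x p.2

/-- `{R(x_{e₀}, …, x_{e₅})}₂ ⊗ Δ(I)`, where `R` is the triple ratio. -/
noncomputable def tripleTerm (ω : V [⋀^Fin 3]→ₗ[F] F) (x : Fin m → V)
    (p : (Fin 6 → Fin m) × Finset (Fin m)) : B2 F ⊗[ℚ] MultQ F :=
  sym2 (tripleRatio ω (x ∘ p.1)) ⊗ₜ vol ω x p.2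

lemma map_swap₃ (ω : V [⋀^Fin 3]→ₗ[F] F) (u v w : V) : ω ![v, u, w] = -ω ![u, v, w] := by
  have := ω.map_swap ![u, v, w] (i := 0) (j := 1) (by decide)
  rw [← this]
  congr 1
  funext i
  fin_cases i <;> rfl

lemma map_rotate₃ (ω : V [⋀^Fin 3]→ₗ[F] F) (u v w : V) : ω ![v, w, u] = ω ![u, v, w] := by
  have h := ω.map_perm ![u, v, w] (finRotate 3)
  rw [sign_finRotate] at h
  simp only [Nat.reduceSub, even_two, Even.neg_pow, one_pow, one_smul] at h
  rw [← h]
  congr 1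
  funext i
  fin_cases i <;> rfl

lemma tripleRatio_rotate (ω : V [⋀^Fin 3]→ₗ[F] F) (z : Fin 6 → V) :
    tripleRatio ω (z ∘ ![1, 2, 0, 4, 5, 3]) = tripleRatio ω z := by
  change ω ![z 1, z 2, z 4] * ω ![z 2, z 0, z 5] * ω ![z 0, z 1, z 3] /
    (ω ![z 1, z 2, z 5] * ω ![z 2, z 0, z 3] * ω ![z 0, z 1, z 4]) = _
  rw [tripleRatio]
  congr 1 <;> ring

lemma tripleRatio_reflect (ω : V [⋀^Fin 3]→ₗ[F] F) (z : Fin 6 → V) :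
    tripleRatio ω (z ∘ ![1, 0, 2, 4, 3, 5]) = (tripleRatio ω z)⁻¹ := by
  change ω ![z 1, z 0, z 4] * ω ![z 0, z 2, z 3] * ω ![z 2, z 1, z 5] /
    (ω ![z 1, z 0, z 3] * ω ![z 0, z 2, z 5] * ω ![z 2, z 1, z 4]) = _
  rw [tripleRatio, inv_div, map_swap₃ ω (z 0) (z 1), map_swap₃ ω (z 0) (z 1),
    map_swap₃ ω (z 2) (z 0), map_swap₃ ω (z 2) (z 0), map_swap₃ ω (z 1) (z 2),
    map_swap₃ ω (z 1) (z 2), ← neg_div_neg_eq]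
  congr 1 <;> ring

lemma altSum_tripleTerm_rotate (ω : V [⋀^Fin 3]→ₗ[F] F) (x : Fin 6 → V) {I J : Finset (Fin 6)}
    (h : (⟨![1, 2, 0, 4, 5, 3], ![2, 0, 1, 5, 3, 4], by decide, by decide⟩ :
      Perm (Fin 6)) • I = J) :
    altSum 6 (tripleTerm ω x) (![0, 1, 2, 3, 4, 5], J) =
      altSum 6 (tripleTerm ω x) (![0, 1, 2, 3, 4, 5], I) := by
  have h1 := altSum_smul (tripleTerm ω x)
    (⟨![1, 2, 0, 4, 5, 3], ![2, 0, 1, 5, 3, 4], by decide, by decide⟩ : Perm (Fin 6))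
    (![0, 1, 2, 3, 4, 5], I)
  rw [Prod.smul_mk, h, sgn_eq (z := 1) _ (by decide), Units.val_one, Int.cast_one, one_smul] at h1
  rw [← h1]
  refine altSum_congr fun σ => ?_
  rw [Prod.smul_mk, Prod.smul_mk, tripleTerm, tripleTerm]
  refine congrArg (fun t => sym2 t ⊗ₜ[ℚ] _) ?_
  rw [← tripleRatio_rotate]
  refine congrArg (tripleRatio ω) (funext fun k => ?_)
  fin_cases k <;> rfl

lemma altSum_tripleTerm_reflect (hF : HasFourElements F) (ω : V [⋀^Fin 3]→ₗ[F] F) (x : Fin 6 → V)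
    {I J : Finset (Fin 6)}
    (h : (⟨![1, 0, 2, 4, 3, 5], ![1, 0, 2, 4, 3, 5], by decide, by decide⟩ :
      Perm (Fin 6)) • I = J) :
    altSum 6 (tripleTerm ω x) (![0, 1, 2, 3, 4, 5], J) =
      -altSum 6 (tripleTerm ω x) (![0, 1, 2, 3, 4, 5], I) := by
  have h1 := altSum_smul (tripleTerm ω x)
    (⟨![1, 0, 2, 4, 3, 5], ![1, 0, 2, 4, 3, 5], by decide, by decide⟩ : Perm (Fin 6))
    (![0, 1, 2, 3, 4, 5], I)
  rw [Prod.smul_mk, h, sgn_eq (z := 1) _ (by decide), Units.val_one, Int.cast_one, one_smul] at h1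
  rw [← h1, ← altSum_neg]
  refine altSum_congr fun σ => ?_
  rw [Prod.smul_mk, Prod.smul_mk, tripleTerm, tripleTerm, ← TensorProduct.neg_tmul, ← sym2_inv hF,
    ← tripleRatio_reflect]
  refine congrArg (fun t => sym2 (tripleRatio ω t) ⊗ₜ[ℚ] _) (funext fun k => ?_)
  fin_cases k <;> rfl

lemma Generic.hasFourElements₃ {ω : V [⋀^Fin 3]→ₗ[F] F} {x : Fin 6 → V} (hx : Generic ω x) :
    HasFourElements F :=
  (hx.proj 0 (f := Fin.succ) (Fin.succ_injective _) (fun j => Fin.succ_ne_zero j)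
    (by decide)).hasFourElements

lemma unitClass_tripleRatio {ω : V [⋀^Fin 3]→ₗ[F] F} {x : Fin 6 → V} (hx : Generic ω x)
    (σ : Perm (Fin 6)) :
    unitClass (tripleRatio ω (x ∘ σ)) = vol ω x (σ • {0, 1, 3}) + vol ω x (σ • {1, 2, 4}) +
      vol ω x (σ • {2, 0, 5}) - (vol ω x (σ • {0, 1, 4}) + vol ω x (σ • {1, 2, 5}) +
      vol ω x (σ • {2, 0, 3})) := by
  have hv : ∀ i j k : Fin 6, i ≠ j → i ≠ k → j ≠ k →
      ω ![x (σ i), x (σ j), x (σ k)] ≠ 0 ∧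
      unitClass (ω ![x (σ i), x (σ j), x (σ k)]) = vol ω x (σ • {i, j, k}) := by
    intro i j k hij hik hjk
    refine ⟨hx.ne_zero₃ (σ.injective.ne hij) (σ.injective.ne hik) (σ.injective.ne hjk), ?_⟩
    have hinj : Function.Injective ![i, j, k] := by
      intro a b hab
      fin_cases a <;> fin_cases b <;> first | rfl | (exfalso; simp_all)
    have h := vol_image ω x (σ.injective.comp hinj)
    rw [← Finset.image_image] at h
    have himg : Finset.univ.image ![i, j, k] = {i, j, k} := by
      ext a
      simp [Fin.exists_fin_succ, eq_comm]
    rw [himg] at h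
    change vol ω x (σ • {i, j, k}) = _ at h
    rw [h]
    congr 2
    funext a
    fin_cases a <;> rfl
  obtain ⟨n1, v1⟩ := hv 0 1 3 (by decide) (by decide) (by decide)
  obtain ⟨n2, v2⟩ := hv 1 2 4 (by decide) (by decide) (by decide)
  obtain ⟨n3, v3⟩ := hv 2 0 5 (by decide) (by decide) (by decide)
  obtain ⟨n4, v4⟩ := hv 0 1 4 (by decide) (by decide) (by decide)
  obtain ⟨n5, v5⟩ := hv 1 2 5 (by decide) (by decide) (by decide)
  obtain ⟨n6, v6⟩ := hv 2 0 3 (by decide) (by decide) (by decide)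
  simp only [tripleRatio, Function.comp_apply]
  rw [unitClass_div (mul_ne_zero (mul_ne_zero n1 n2) n3) (mul_ne_zero (mul_ne_zero n4 n5) n6),
    unitClass_mul (mul_ne_zero n1 n2) n3, unitClass_mul n1 n2,
    unitClass_mul (mul_ne_zero n4 n5) n6, unitClass_mul n4 n5, v1, v2, v3, v4, v5, v6]

/-- By the symmetries of the triple ratio its six factors contribute the same, whence the
coefficient `6 / 15`. -/
lemma symTensor_preR3_eq_tripleTerm {ω : V [⋀^Fin 3]→ₗ[F] F} {x : Fin 6 → V} (hx : Generic ω x) :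
    symTensor F (preR3 ω x) =
      (2 / 5 : ℚ) • altSum 6 (tripleTerm ω x) (![0, 1, 2, 3, 4, 5], {0, 1, 3}) := by
  have hF := hx.hasFourElements₃
  have h1 : symTensor F (preR3 ω x) = (1 / 15 : ℚ) •
      (altSum 6 (tripleTerm ω x) (![0, 1, 2, 3, 4, 5], {0, 1, 3}) +
      altSum 6 (tripleTerm ω x) (![0, 1, 2, 3, 4, 5], {1, 2, 4}) +
      altSum 6 (tripleTerm ω x) (![0, 1, 2, 3, 4, 5], {2, 0, 5}) -
      (altSum 6 (tripleTerm ω x) (![0, 1, 2, 3, 4, 5], {0, 1, 4}) +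
      altSum 6 (tripleTerm ω x) (![0, 1, 2, 3, 4, 5], {1, 2, 5}) +
      altSum 6 (tripleTerm ω x) (![0, 1, 2, 3, 4, 5], {2, 0, 3}))) := by
    rw [preR3, map_smul, map_sum]
    refine congrArg (fun t => (1 / 15 : ℚ) • t) ?_
    simp only [altSum, ← Finset.sum_add_distrib, ← Finset.sum_sub_distrib, ← smul_add, ← smul_sub]
    refine Finset.sum_congr rfl fun σ _ => ?_
    rw [map_smul, symTensor_pre3, unitClass_tripleRatio hx]
    have he : x ∘ (σ • (![0, 1, 2, 3, 4, 5] : Fin 6 → Fin 6)) = x ∘ σ := by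
      funext k
      fin_cases k <;> rfl
    simp only [Prod.smul_mk, tripleTerm, he, ← TensorProduct.tmul_add, ← TensorProduct.tmul_sub]
    rfl
  rw [h1,
    altSum_tripleTerm_rotate ω x (show _ • ({1, 2, 4} : Finset (Fin 6)) = {2, 0, 5} by decide),
    altSum_tripleTerm_rotate ω x (show _ • ({0, 1, 3} : Finset (Fin 6)) = {1, 2, 4} by decide),
    altSum_tripleTerm_rotate ω x (show _ • ({1, 2, 5} : Finset (Fin 6)) = {2, 0, 3} by decide),
    altSum_tripleTerm_rotate ω x (show _ • ({0, 1, 4} : Finset (Fin 6)) = {1, 2, 5} by decide),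
    altSum_tripleTerm_reflect hF ω x (show _ • ({0, 1, 3} : Finset (Fin 6)) = {0, 1, 4} by decide)]
  module

end TrilogDifferential

section TripleRatioDifferential

variable {F V : Type*} [Field F] [AddCommGroup V] [Module F V] {m : ℕ}

lemma Generic.plane_proj {ω : V [⋀^Fin 3]→ₗ[F] F} {x : Fin m → V} (hx : Generic ω x)
    {e : Fin 5 → Fin m} (he : Function.Injective e) :
    Generic (ω.curryLeft (x (e 0))) (fun k : Fin 4 => x (e k.succ)) :=
  hx.proj (e 0) (f := fun k : Fin 4 => e k.succ) (he.comp (Fin.succ_injective _))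
    (fun j h => Fin.succ_ne_zero j (he h)) (by decide)

/-- Permuting the four projected points changes `planeTerm` by the sign. -/
lemma planeTerm_perm (hF : HasFourElements F) {ω : V [⋀^Fin 3]→ₗ[F] F} {x : Fin m → V}
    (hx : Generic ω x) {e e' : Fin 5 → Fin m} (he : Function.Injective e) (τ : Perm (Fin 4))
    (h : e' = e ∘ Perm.decomposeFin.symm (0, τ)) (I : Finset (Fin m)) (σ : Perm (Fin m)) :
    planeTerm ω x (σ • (e', I)) = sgn τ • planeTerm ω x (σ • (e, I)) := by
  subst h
  rw [Prod.smul_mk, Prod.smul_mk, planeTerm, planeTerm, TensorProduct.smul_tmul',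
    ← sym2_crossRatio_perm hF τ (hx.plane_proj (e := σ • e) (σ.injective.comp he))]
  have h0 : (σ • (e ∘ Perm.decomposeFin.symm (0, τ))) 0 = (σ • e) 0 := by
    change σ (e (Perm.decomposeFin.symm (0, τ) 0)) = σ (e 0)
    rw [Perm.decomposeFin_symm_apply_zero]
  simp only [h0]
  refine congrArg (fun t => sym2 (crossRatio _ t) ⊗ₜ[ℚ] _) (funext fun k => ?_)
  change x (σ (e (Perm.decomposeFin.symm (0, τ) k.succ))) = x (σ (e (τ k).succ))
  simp

/-- Relabelling by a permutation of the four projected points. -/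
lemma altSum_planeTerm_eq (hF : HasFourElements F) {ω : V [⋀^Fin 3]→ₗ[F] F} {x : Fin 6 → V}
    (hx : Generic ω x) (τ : Perm (Fin 4)) (ρ : Perm (Fin 6)) {I J : Finset (Fin 6)}
    (hρ : ρ • (![0, 1, 2, 3, 4] : Fin 5 → Fin 6) =
      ![0, 1, 2, 3, 4] ∘ Perm.decomposeFin.symm (0, τ))
    (hI : ρ • I = J) (hs : Perm.sign ρ = Perm.sign τ) :
    altSum 6 (planeTerm ω x) (![0, 1, 2, 3, 4], J) =
      altSum 6 (planeTerm ω x) (![0, 1, 2, 3, 4], I) := by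
  have h1 := altSum_smul (planeTerm ω x) ρ (![0, 1, 2, 3, 4], I)
  have h2 : altSum 6 (planeTerm ω x) (ρ • ((![0, 1, 2, 3, 4] : Fin 5 → Fin 6), I)) =
      sgn τ • altSum 6 (planeTerm ω x) (![0, 1, 2, 3, 4], J) := by
    rw [← altSum_const_smul, Prod.smul_mk, hI]
    exact altSum_congr fun σ => planeTerm_perm hF hx (by decide) τ hρ J σ
  have hs' : sgn ρ = sgn τ := by rw [sgn, hs, sgn]
  rw [h2, hs'] at h1
  have h3 := congrArg (fun t => sgn τ • t) h1
  simpa only [smul_smul, sgn_mul_self, one_smul] using h3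

/-- The dual five-term relation, multiplied by `Δ(x₀, x₁, x₂)`. -/
lemma altSum_planeTerm_dual {ω : V [⋀^Fin 3]→ₗ[F] F} {x : Fin 6 → V} (hx : Generic ω x) :
    (3 : ℚ) • altSum 6 (planeTerm ω x) (![0, 1, 2, 3, 4], {0, 1, 2}) +
      (2 : ℚ) • altSum 6 (planeTerm ω x) (![0, 1, 2, 3, 4], {1, 2, 3}) = 0 := by
  have hF := hx.hasFourElements₃
  have h : altSum 6 (planeTerm ω x) (![0, 1, 2, 3, 4], {0, 1, 2}) =
      altSum 6 (planeTerm ω x) (![1, 0, 2, 3, 4], {0, 1, 2}) +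
      altSum 6 (planeTerm ω x) (![2, 1, 0, 3, 4], {0, 1, 2}) +
      altSum 6 (planeTerm ω x) (![3, 1, 2, 0, 4], {0, 1, 2}) +
      altSum 6 (planeTerm ω x) (![4, 1, 2, 3, 0], {0, 1, 2}) := by
    simp only [altSum, ← Finset.sum_add_distrib, ← smul_add]
    refine Finset.sum_congr rfl fun σ _ => congrArg (fun t => sgn σ • t) ?_
    have hd := sym2_crossRatio_dual_subst hF
      (hx.comp (f := σ • ![0, 1, 2, 3, 4]) (σ.injective.comp (by decide)))
    have hd' := congrArg (fun t => t ⊗ₜ[ℚ] vol ω x (σ • {0, 1, 2})) hd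
    simp only [TensorProduct.add_tmul] at hd'
    have key : ∀ (e : Fin 5 → Fin 6) (c : V) (y : Fin 4 → V), x (σ (e 0)) = c →
        (∀ k : Fin 4, x (σ (e k.succ)) = y k) → planeTerm ω x (σ • (e, {0, 1, 2})) =
        sym2 (crossRatio (ω.curryLeft c) y) ⊗ₜ[ℚ] vol ω x (σ • {0, 1, 2}) := by
      intro e c y hc hy
      rw [Prod.smul_mk, planeTerm, ← hc]
      exact congrArg (fun t => sym2 (crossRatio _ t) ⊗ₜ[ℚ] _) (funext hy)
    rw [key ![0, 1, 2, 3, 4] _ _ rfl fun k => ?_, key ![1, 0, 2, 3, 4] _ _ rfl fun k => ?_,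
      key ![2, 1, 0, 3, 4] _ _ rfl fun k => ?_, key ![3, 1, 2, 0, 4] _ _ rfl fun k => ?_,
      key ![4, 1, 2, 3, 0] _ _ rfl fun k => ?_]
    · exact hd'
    all_goals fin_cases k <;> rfl
  have hr : ∀ (j : Fin 6) (e : Fin 5 → Fin 6) (I : Finset (Fin 6)), (0 : Fin 6) ≠ j →
      swap 0 j • ((![0, 1, 2, 3, 4], I) : (Fin 5 → Fin 6) × Finset (Fin 6)) = (e, {0, 1, 2}) →
      altSum 6 (planeTerm ω x) (e, {0, 1, 2}) =
        -altSum 6 (planeTerm ω x) (![0, 1, 2, 3, 4], I) := by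
    intro j e I hj h
    rw [altSum_relabel _ _ h, sgn_swap hj, neg_one_smul]
  rw [hr 1 ![1, 0, 2, 3, 4] {0, 1, 2} (by decide) (by decide),
    hr 2 ![2, 1, 0, 3, 4] {0, 1, 2} (by decide) (by decide),
    hr 3 ![3, 1, 2, 0, 4] {1, 2, 3} (by decide) (by decide),
    hr 4 ![4, 1, 2, 3, 0] {1, 2, 4} (by decide) (by decide),
    altSum_planeTerm_eq hF hx (swap 2 3) (swap 3 4) (I := {1, 2, 3}) (J := {1, 2, 4}) (by decide)
      (by decide) (by decide)] at h
  linear_combination (norm := module) h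

/-- The five-term relation for the cross-ratios `(x₀ | x₂, x₁, x₃, x₄)` and `(x₂ | x₁, x₀, x₄, x₅)`,
whose quotient is the triple ratio. -/
lemma sym2_tripleRatio_five_term {ω : V [⋀^Fin 3]→ₗ[F] F} {z : Fin 6 → V} (hz : Generic ω z) :
    -sym2 (crossRatio (ω.curryLeft (z 0)) ![z 2, z 1, z 3, z 4]) +
      sym2 (crossRatio (ω.curryLeft (z 2)) ![z 1, z 0, z 4, z 5]) - sym2 (tripleRatio ω z) +
      sym2 (ω ![z 2, z 4, z 5] * ω ![z 0, z 1, z 3] / (ω ![z 1, z 2, z 5] * ω ![z 0, z 3, z 4])) -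
      sym2 (tripleRatio ω (z ∘ ![4, 0, 2, 1, 3, 5])) = 0 := by
  have hF := hz.hasFourElements₃
  have ga : Generic (ω.curryLeft (z 0)) ![z 2, z 1, z 3, z 4] := by
    have := hz.plane_proj (e := ![0, 2, 1, 3, 4]) (by decide)
    refine (show (fun k : Fin 4 => z ((![0, 2, 1, 3, 4] : Fin 5 → Fin 6) k.succ)) =
      ![z 2, z 1, z 3, z 4] from funext fun k => ?_) ▸ this
    fin_cases k <;> rfl
  have gb : Generic (ω.curryLeft (z 2)) ![z 1, z 0, z 4, z 5] := by
    have := hz.plane_proj (e := ![2, 1, 0, 4, 5]) (by decide)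
    refine (show (fun k : Fin 4 => z ((![2, 1, 0, 4, 5] : Fin 5 → Fin 6) k.succ)) =
      ![z 1, z 0, z 4, z 5] from funext fun k => ?_) ▸ this
    fin_cases k <;> rfl
  have h := sym2_five_term hF (crossRatio_ne_zero ga) (crossRatio_ne_zero gb)
  have sa := one_sub_crossRatio ga
  have sb := one_sub_crossRatio gb
  rw [sa, sb] at h
  have n : ∀ i j k : Fin 6, i ≠ j → i ≠ k → j ≠ k → ω ![z i, z j, z k] ≠ 0 :=
    fun i j k => hz.ne_zero₃
  have c : ∀ a u v : V, (ω.curryLeft a) ![u, v] = ω ![a, u, v] := fun _ _ _ => rfl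
  simp only [crossRatio, Matrix.cons_val, c] at h ⊢
  have n012 := n 0 1 2 (by decide) (by decide) (by decide)
  have n013 := n 0 1 3 (by decide) (by decide) (by decide)
  have n014 := n 0 1 4 (by decide) (by decide) (by decide)
  have n023 := n 0 2 3 (by decide) (by decide) (by decide)
  have n024 := n 0 2 4 (by decide) (by decide) (by decide)
  have n025 := n 0 2 5 (by decide) (by decide) (by decide)
  have n034 := n 0 3 4 (by decide) (by decide) (by decide)
  have n124 := n 1 2 4 (by decide) (by decide) (by decide)
  have n125 := n 1 2 5 (by decide) (by decide) (by decide)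
  have n245 := n 2 4 5 (by decide) (by decide) (by decide)
  have e214 : ω ![z 2, z 1, z 4] = -ω ![z 1, z 2, z 4] := map_swap₃ _ _ _ _
  have e215 : ω ![z 2, z 1, z 5] = -ω ![z 1, z 2, z 5] := map_swap₃ _ _ _ _
  have e205 : ω ![z 2, z 0, z 5] = -ω ![z 0, z 2, z 5] := map_swap₃ _ _ _ _
  have e204 : ω ![z 2, z 0, z 4] = -ω ![z 0, z 2, z 4] := map_swap₃ _ _ _ _
  have e203 : ω ![z 2, z 0, z 3] = -ω ![z 0, z 2, z 3] := map_swap₃ _ _ _ _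
  have e210 : ω ![z 2, z 1, z 0] = -ω ![z 0, z 1, z 2] := by
    rw [map_swap₃, map_rotate₃ ω (z 0) (z 1) (z 2)]
  have e021 : ω ![z 0, z 2, z 1] = -ω ![z 0, z 1, z 2] := by
    rw [map_rotate₃ ω (z 1) (z 0) (z 2), map_swap₃]
  have e401 : ω ![z 4, z 0, z 1] = ω ![z 0, z 1, z 4] := (map_rotate₃ _ _ _ _).symm
  have e403 : ω ![z 4, z 0, z 3] = ω ![z 0, z 3, z 4] := (map_rotate₃ _ _ _ _).symm
  have e241 : ω ![z 2, z 4, z 1] = ω ![z 1, z 2, z 4] := map_rotate₃ _ _ _ _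
  rw [e214, e215, e205, e204, e210, e021] at h
  have r1 : tripleRatio ω z = ω ![z 0, z 1, z 3] * ω ![z 1, z 2, z 4] * ω ![z 0, z 2, z 5] /
      (ω ![z 0, z 1, z 4] * ω ![z 1, z 2, z 5] * ω ![z 0, z 2, z 3]) := by
    rw [tripleRatio, e205, e203, ← neg_div_neg_eq]
    congr 1 <;> ring
  have r2 : tripleRatio ω (z ∘ ![4, 0, 2, 1, 3, 5]) =
      ω ![z 0, z 1, z 4] * ω ![z 0, z 2, z 3] * ω ![z 2, z 4, z 5] /
      (ω ![z 0, z 3, z 4] * ω ![z 0, z 2, z 5] * ω ![z 1, z 2, z 4]) := by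
    change ω ![z 4, z 0, z 1] * ω ![z 0, z 2, z 3] * ω ![z 2, z 4, z 5] /
      (ω ![z 4, z 0, z 3] * ω ![z 0, z 2, z 5] * ω ![z 2, z 4, z 1]) = _
    rw [e401, e403, e241]
  rw [r1, r2, e214, e215, e205, e204]
  rw [← h]
  refine congrArg₂ (· - ·) (congrArg₂ (· + ·) (congrArg₂ (· - ·) rfl ?_) ?_) ?_
  · refine congrArg sym2 ?_
    field_simp
  · refine congrArg sym2 ?_
    field_simp
  · refine congrArg sym2 ?_
    field_simp

/-- The five-term relation of `sym2_tripleRatio_five_term`, multiplied by `Δ(x₀, x₁, x₄)`. The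
fourth term is invariant under the transposition of `x₂` and `x₅`. -/
lemma altSum_tripleTerm_five_term {ω : V [⋀^Fin 3]→ₗ[F] F} {x : Fin 6 → V} (hx : Generic ω x) :
    -altSum 6 (planeTerm ω x) (![0, 2, 1, 3, 4], {0, 1, 4}) +
      altSum 6 (planeTerm ω x) (![2, 1, 0, 4, 5], {0, 1, 4}) -
      altSum 6 (tripleTerm ω x) (![0, 1, 2, 3, 4, 5], {0, 1, 4}) -
      altSum 6 (tripleTerm ω x) (![4, 0, 2, 1, 3, 5], {0, 1, 4}) = 0 := by
  let N : (Fin 6 → Fin 6) × Finset (Fin 6) → B2 F ⊗[ℚ] MultQ F := fun p =>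
    sym2 (ω ![x (p.1 2), x (p.1 4), x (p.1 5)] * ω ![x (p.1 0), x (p.1 1), x (p.1 3)] /
      (ω ![x (p.1 1), x (p.1 2), x (p.1 5)] * ω ![x (p.1 0), x (p.1 3), x (p.1 4)])) ⊗ₜ vol ω x p.2
  have hN : altSum 6 N (![0, 1, 2, 3, 4, 5], {0, 1, 4}) = 0 := by
    refine altSum_eq_zero N (swap 2 5) _ fun σ => ?_
    rw [sgn_swap (by decide), neg_one_smul, neg_neg,
      show swap (2 : Fin 6) 5 •
        ((![0, 1, 2, 3, 4, 5], {0, 1, 4}) : (Fin 6 → Fin 6) × Finset (Fin 6)) =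
          (![0, 1, 5, 3, 4, 2], {0, 1, 4}) by decide]
    refine congrArg (fun t => sym2 t ⊗ₜ[ℚ] vol ω x (σ • {0, 1, 4})) ?_
    change ω ![x (σ 5), x (σ 4), x (σ 2)] * ω ![x (σ 0), x (σ 1), x (σ 3)] /
      (ω ![x (σ 1), x (σ 5), x (σ 2)] * ω ![x (σ 0), x (σ 3), x (σ 4)]) =
      ω ![x (σ 2), x (σ 4), x (σ 5)] * ω ![x (σ 0), x (σ 1), x (σ 3)] /
      (ω ![x (σ 1), x (σ 2), x (σ 5)] * ω ![x (σ 0), x (σ 3), x (σ 4)])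
    have h1 : ω ![x (σ 5), x (σ 4), x (σ 2)] = -ω ![x (σ 2), x (σ 4), x (σ 5)] := by
      rw [map_swap₃, map_rotate₃ ω (x (σ 2)) (x (σ 4)) (x (σ 5))]
    have h2 : ω ![x (σ 1), x (σ 5), x (σ 2)] = -ω ![x (σ 1), x (σ 2), x (σ 5)] := by
      rw [← map_rotate₃, map_swap₃, map_rotate₃ ω (x (σ 1)) (x (σ 2)) (x (σ 5))]
    rw [h1, h2, neg_mul, neg_mul, neg_div_neg_eq]
  suffices h : -altSum 6 (planeTerm ω x) (![0, 2, 1, 3, 4], {0, 1, 4}) +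
      altSum 6 (planeTerm ω x) (![2, 1, 0, 4, 5], {0, 1, 4}) -
      altSum 6 (tripleTerm ω x) (![0, 1, 2, 3, 4, 5], {0, 1, 4}) -
      altSum 6 (tripleTerm ω x) (![4, 0, 2, 1, 3, 5], {0, 1, 4}) +
      altSum 6 N (![0, 1, 2, 3, 4, 5], {0, 1, 4}) = 0 by rwa [hN, add_zero] at h
  rw [← altSum_neg]
  simp only [altSum, ← Finset.sum_add_distrib, ← Finset.sum_sub_distrib, ← smul_add, ← smul_sub]
  refine Finset.sum_eq_zero fun σ _ => ?_
  have h := congrArg (fun t => t ⊗ₜ[ℚ] vol ω x (σ • {0, 1, 4}))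
    (sym2_tripleRatio_five_term (hx.comp σ.injective))
  simp only [TensorProduct.add_tmul, TensorProduct.sub_tmul, TensorProduct.neg_tmul,
    TensorProduct.zero_tmul] at h
  refine smul_eq_zero_of_right _ (Eq.trans ?_ h)
  have e1 : planeTerm ω x (σ • (![0, 2, 1, 3, 4], {0, 1, 4})) =
      sym2 (crossRatio (ω.curryLeft ((x ∘ σ) 0)) ![(x ∘ σ) 2, (x ∘ σ) 1, (x ∘ σ) 3, (x ∘ σ) 4])
        ⊗ₜ vol ω x (σ • {0, 1, 4}) := by
    refine congrArg (fun t => sym2 (crossRatio _ t) ⊗ₜ[ℚ] _) (funext fun k => ?_)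
    fin_cases k <;> rfl
  have e2 : planeTerm ω x (σ • (![2, 1, 0, 4, 5], {0, 1, 4})) =
      sym2 (crossRatio (ω.curryLeft ((x ∘ σ) 2)) ![(x ∘ σ) 1, (x ∘ σ) 0, (x ∘ σ) 4, (x ∘ σ) 5])
        ⊗ₜ vol ω x (σ • {0, 1, 4}) := by
    refine congrArg (fun t => sym2 (crossRatio _ t) ⊗ₜ[ℚ] _) (funext fun k => ?_)
    fin_cases k <;> rfl
  have e3 : tripleTerm ω x (σ • (![0, 1, 2, 3, 4, 5], {0, 1, 4})) =
      sym2 (tripleRatio ω (x ∘ σ)) ⊗ₜ vol ω x (σ • {0, 1, 4}) := by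
    refine congrArg (fun t => sym2 (tripleRatio ω t) ⊗ₜ[ℚ] _) (funext fun k => ?_)
    fin_cases k <;> rfl
  have e4 : tripleTerm ω x (σ • (![4, 0, 2, 1, 3, 5], {0, 1, 4})) =
      sym2 (tripleRatio ω ((x ∘ σ) ∘ ![4, 0, 2, 1, 3, 5])) ⊗ₜ vol ω x (σ • {0, 1, 4}) := rfl
  rw [e1, e2, e3, e4]
  have comm : ∀ a b c d e : B2 F ⊗[ℚ] MultQ F, a + b - c - e + d = a + b - c + d - e := by
    intros; abel
  exact comm _ _ _ _ _

/-- The differential of `r₃` is expressed by cross-ratios of projections: the five-term relation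
reduces triple ratios to cross-ratios, and `altSum_planeTerm_dual` reduces the two kinds of terms
which appear to one. -/
lemma symTensor_preR3 {ω : V [⋀^Fin 3]→ₗ[F] F} {x : Fin 6 → V} (hx : Generic ω x) :
    symTensor F (preR3 ω x) =
      (-1 / 2 : ℚ) • altSum 6 (planeTerm ω x) (![0, 1, 2, 3, 4], {0, 1, 2}) := by
  have hF := hx.hasFourElements₃
  have h1 := altSum_tripleTerm_five_term hx
  have h2 := altSum_planeTerm_dual hx
  have a1 : altSum 6 (planeTerm ω x) (![0, 2, 1, 3, 4], {0, 1, 4}) =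
      -altSum 6 (planeTerm ω x) (![0, 1, 2, 3, 4], {0, 1, 2}) := by
    rw [altSum_relabel (x := ((![0, 1, 2, 3, 4], {0, 2, 4}) : (Fin 5 → Fin 6) × Finset (Fin 6)))
      _ (swap 1 2) (by decide), sgn_swap (by decide), neg_one_smul,
      altSum_planeTerm_eq hF hx (swap 0 3) (swap 1 4) (I := {0, 1, 2}) (J := {0, 2, 4}) (by decide)
      (by decide) (by decide)]
  have a2 : altSum 6 (planeTerm ω x) (![2, 1, 0, 4, 5], {0, 1, 4}) =
      -altSum 6 (planeTerm ω x) (![0, 1, 2, 3, 4], {1, 2, 3}) := by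
    rw [altSum_relabel (x := ((![0, 1, 2, 3, 4], {1, 2, 3}) : (Fin 5 → Fin 6) × Finset (Fin 6)))
      _ ⟨![2, 1, 0, 4, 5, 3], ![2, 1, 0, 5, 3, 4], by decide, by decide⟩ (by decide),
      sgn_eq (z := -1) _ (by decide)]
    simp
  have a3 : altSum 6 (tripleTerm ω x) (![4, 0, 2, 1, 3, 5], {0, 1, 4}) =
      -altSum 6 (tripleTerm ω x) (![0, 1, 2, 3, 4, 5], {0, 1, 3}) := by
    rw [altSum_relabel (x := ((![0, 1, 2, 3, 4, 5], {0, 1, 3}) : (Fin 6 → Fin 6) × Finset (Fin 6)))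
      _ ⟨![4, 0, 2, 1, 3, 5], ![1, 3, 2, 4, 0, 5], by decide, by decide⟩ (by decide),
      sgn_eq (z := -1) _ (by decide)]
    simp
  rw [a1, a2, a3, altSum_tripleTerm_reflect hF ω x
    (show _ • ({0, 1, 3} : Finset (Fin 6)) = {0, 1, 4} by decide)] at h1
  rw [symTensor_preR3_eq_tripleTerm hx]
  linear_combination (norm := module) (1 / 5 : ℚ) • h1 + (1 / 10 : ℚ) • h2

end TripleRatioDifferential

section Descent

variable {F : Type*} [Field F]

/-- The seven-term relation is mapped to zero: by `symTensor_preR3` the image is an alternating sum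
over seven indices of terms which involve only five of them. -/
lemma symTensor_seven_term {ω : (Fin 3 → F) [⋀^Fin 3]→ₗ[F] F} {x : Fin 7 → (Fin 3 → F)}
    (hx : Generic ω x) :
    ∑ i : Fin 7, (-1 : ℚ) ^ (i : ℕ) • symTensor F (preR3 ω (x ∘ i.succAbove)) = 0 := by
  simp only [fun i : Fin 7 => symTensor_preR3 (hx.comp (f := i.succAbove)
    Fin.succAbove_right_injective), smul_comm _ (-1 / 2 : ℚ), ← Finset.smul_sum]
  rw [sum_altSum_succAbove _ (planeTerm ω x) (![0, 1, 2, 3, 4], {0, 1, 2})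
    (![1, 2, 3, 4, 5], {1, 2, 3}) fun i σ => ?_,
    altSum_eq_zero_of_fixed _ (swap 0 6) (by decide) (by decide), smul_zero]
  have hI : ({1, 2, 3} : Finset (Fin 7)) = ({0, 1, 2} : Finset (Fin 6)).image Fin.succ := by decide
  have he : (![1, 2, 3, 4, 5] : Fin 5 → Fin 7) = Fin.succ ∘ (![0, 1, 2, 3, 4] : Fin 5 → Fin 6) := by
    decide
  rw [hI, he, Prod.smul_mk, Prod.smul_mk, cycleRange_symm_smul_succ, cycleRange_symm_smul_image,
    planeTerm, vol_comp _ _ Fin.succAbove_right_injective]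
  rfl

/-- The arguments of Kummer's relation satisfy three five-term relations in `B₂`. -/
lemma sym2_kummer (hF : HasFourElements F) {x y : F} (hx : x ≠ 0) (hx1 : x ≠ 1) (hy : y ≠ 0)
    (hy1 : y ≠ 1) :
    sym2 (x / y) = -sym2 y + sym2 x + sym2 ((1 - x) / (1 - y)) +
      sym2 (x * (1 - y) / (y * (1 - x))) ∧
    sym2 (x * y) = sym2 y + sym2 x + sym2 (-y * (1 - x) / (1 - y)) +
      sym2 (-x * (1 - y) / (1 - x)) ∧
    sym2 (x * (1 - y) ^ 2 / (y * (1 - x) ^ 2)) = sym2 (-x * (1 - y) / (1 - x)) +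
      sym2 (x * (1 - y) / (y * (1 - x))) - sym2 (-y * (1 - x) / (1 - y)) -
      sym2 ((1 - x) / (1 - y)) := by
  have hx2 : 1 - x ≠ 0 := sub_ne_zero.2 hx1.symm
  have hy2 : 1 - y ≠ 0 := sub_ne_zero.2 hy1.symm
  have hy3 : y - 1 ≠ 0 := sub_ne_zero.2 hy1
  refine ⟨?_, ?_, ?_⟩
  · have h := sym2_five_term hF hy hx
    rw [show y * (1 - x) / (x * (1 - y)) = (x * (1 - y) / (y * (1 - x)))⁻¹ from (inv_div _ _).symm,
      sym2_inv hF] at h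
    linear_combination (norm := module) -h
  · have h := sym2_five_term hF (inv_ne_zero hy) hx
    rw [sym2_inv hF, show x / y⁻¹ = x * y by rw [div_inv_eq_mul],
      show (1 - x) / (1 - y⁻¹) = -y * (1 - x) / (1 - y) by field_simp; grind,
      show y⁻¹ * (1 - x) / (x * (1 - y⁻¹)) = (-x * (1 - y) / (1 - x))⁻¹ by
        have : 1 - y⁻¹ ≠ 0 := sub_ne_zero.2 fun h => hy1 (by rw [← inv_inv y, ← h, inv_one])
        field_simp; grind,
      sym2_inv hF] at h
    linear_combination (norm := module) -h
  · by_cases hxy : x * y = 1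
    · have h1 : -x * (1 - y) / (1 - x) = 1 := by
        rw [div_eq_one_iff_eq hx2]; linear_combination hxy
      have h2 : -y * (1 - x) / (1 - y) = 1 := by
        rw [div_eq_one_iff_eq hy2]; linear_combination hxy
      have h3 : x * (1 - y) ^ 2 / (y * (1 - x) ^ 2) = 1 := by
        rw [div_eq_one_iff_eq (mul_ne_zero hy (pow_ne_zero 2 hx2))]
        linear_combination (y - x) * hxy
      have h4 : x * (1 - y) / (y * (1 - x)) = (1 - x) / (1 - y) := by
        rw [div_eq_div_iff (mul_ne_zero hy hx2) hy2]
        linear_combination (y - x) * hxy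
      rw [h1, h2, h3, h4, sym2_one]
      abel
    · have hxy2 : 1 - x * y ≠ 0 := sub_ne_zero.2 fun h => hxy h.symm
      have hD : -y * (1 - x) / (1 - y) ≠ 0 := div_ne_zero (mul_ne_zero (neg_ne_zero.2 hy) hx2) hy2
      have hB : -x * (1 - y) / (1 - x) ≠ 0 := div_ne_zero (mul_ne_zero (neg_ne_zero.2 hx) hy2) hx2
      have h := sym2_five_term hF hD hB
      have h1 : 1 - -x * (1 - y) / (1 - x) = (1 - x * y) / (1 - x) := by field_simp; ring
      have h2 : 1 - -y * (1 - x) / (1 - y) = (1 - x * y) / (1 - y) := by field_simp; ring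
      rw [h1, h2,
        show (1 - x * y) / (1 - x) / ((1 - x * y) / (1 - y)) = ((1 - x) / (1 - y))⁻¹ by field_simp,
        show -x * (1 - y) / (1 - x) / (-y * (1 - x) / (1 - y)) =
          x * (1 - y) ^ 2 / (y * (1 - x) ^ 2) by field_simp,
        show -y * (1 - x) / (1 - y) * ((1 - x * y) / (1 - x)) /
          (-x * (1 - y) / (1 - x) * ((1 - x * y) / (1 - y))) = (x * (1 - y) / (y * (1 - x)))⁻¹ by
          field_simp
          rw [mul_comm y x, div_self hxy2],
        sym2_inv hF, sym2_inv hF] at h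
      linear_combination (norm := module) -h

lemma symTensor_kummer (hF : HasFourElements F) {x y : F} (hx : x ≠ 0) (hx1 : x ≠ 1) (hy : y ≠ 0)
    (hy1 : y ≠ 1) : symTensor F (kummer x y) = 0 := by
  have hx2 : 1 - x ≠ 0 := sub_ne_zero.2 hx1.symm
  have hy2 : 1 - y ≠ 0 := sub_ne_zero.2 hy1.symm
  obtain ⟨h1, h2, h3⟩ := sym2_kummer hF hx hx1 hy hy1
  have uA : unitClass (x * (1 - y) ^ 2 / (y * (1 - x) ^ 2)) = unitClass x +
      (2 : ℚ) • unitClass (1 - y) - (unitClass y + (2 : ℚ) • unitClass (1 - x)) := by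
    rw [unitClass_div (mul_ne_zero hx (pow_ne_zero 2 hy2)) (mul_ne_zero hy (pow_ne_zero 2 hx2)),
      unitClass_mul hx (pow_ne_zero 2 hy2), unitClass_mul hy (pow_ne_zero 2 hx2),
      unitClass_pow hx2, unitClass_pow hy2, Nat.cast_ofNat]
  have uB : ∀ {x y : F}, x ≠ 0 → 1 - x ≠ 0 → 1 - y ≠ 0 →
      unitClass (-x * (1 - y) / (1 - x)) = unitClass x + unitClass (1 - y) - unitClass (1 - x) := by
    intro x y hx hx2 hy2
    rw [unitClass_div (mul_ne_zero (neg_ne_zero.2 hx) hy2) hx2,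
      unitClass_mul (neg_ne_zero.2 hx) hy2, unitClass_neg]
  rw [kummer]
  simp only [map_add, map_sub, map_neg, map_smul, symTensor_pre3]
  rw [uA, uB hx hx2 hy2, uB hy hy2 hx2, unitClass_mul hx hy, unitClass_div hx hy, unitClass_one,
    unitClass_div hx2 hy2, unitClass_div (mul_ne_zero hx hy2) (mul_ne_zero hy hx2),
    unitClass_mul hx hy2, unitClass_mul hy hx2, h1, h2, h3]
  simp only [TensorProduct.tmul_add, TensorProduct.tmul_sub, TensorProduct.tmul_smul,
    TensorProduct.add_tmul, TensorProduct.sub_tmul, TensorProduct.neg_tmul, TensorProduct.tmul_zero]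
  module

/-- The differential `B₃ → B₂ ⊗ F*` with `{x}₃ ↦ {x}₂ ⊗ x`. -/
noncomputable def trilogDifferential (F : Type*) [Field F] : B3 F →ₗ[ℚ] B2 F ⊗[ℚ] MultQ F :=
  (R3 F).liftQ (symTensor F) <| by
    by_cases hF : HasFourElements F
    · rw [R3, Submodule.span_le]
      rintro z ((⟨x, hx, rfl⟩ | ⟨x, hx, rfl⟩) | ⟨x, y, hx, hx1, hy, hy1, rfl⟩)
      · rw [SetLike.mem_coe, LinearMap.mem_ker, map_sub, symTensor_pre3, symTensor_pre3,
          sym2_inv hF, unitClass_inv, TensorProduct.neg_tmul, TensorProduct.tmul_neg, neg_neg,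
          sub_self]
      · rw [SetLike.mem_coe, LinearMap.mem_ker, map_sum]
        simp only [map_smul]
        exact symTensor_seven_term hx.generic
      · exact symTensor_kummer hF hx hx1 hy hy1
    · intro z _
      have := subsingleton_multQ_of_not_hasFourElements hF
      rw [LinearMap.mem_ker]
      induction symTensor F z using TensorProduct.induction_on with
      | zero => rfl
      | add s t hs ht => rw [hs, ht, add_zero]
      | tmul a b => rw [Subsingleton.elim b 0, TensorProduct.tmul_zero]

lemma trilogDifferential_sym3 (x : F) :
    trilogDifferential F (sym3 x) = sym2 x ⊗ₜ unitClass x := by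
  rw [sym3, trilogDifferential, Submodule.mkQ_apply, Submodule.liftQ_apply, symTensor_pre3]

lemma trilogDifferential_r3 {V : Type*} [AddCommGroup V] [Module F V] {ω : V [⋀^Fin 3]→ₗ[F] F}
    {x : Fin 6 → V} (hx : Generic ω x) :
    trilogDifferential F (r3 ω x) =
      (-1 / 2 : ℚ) • altSum 6 (planeTerm ω x) (![0, 1, 2, 3, 4], {0, 1, 2}) := by
  rw [r3, trilogDifferential, Submodule.mkQ_apply, Submodule.liftQ_apply, symTensor_preR3 hx]

end Descent

/-! ### The differential on `B₃ ⊗ F* ⊕ Λ² B₂` -/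

section Differential

variable {F : Type*} [Field F]

/-- The bilinear map with `(a ⊗ u, v) ↦ a ⊗ (u ∧ v)`. -/
noncomputable def tmulWedge (B M : Type*) [AddCommGroup B] [Module ℚ B] [AddCommGroup M]
    [Module ℚ M] : (B ⊗[ℚ] M) ⊗[ℚ] M →ₗ[ℚ] B ⊗[ℚ] ⋀[ℚ]^2 M :=
  (TensorProduct.map LinearMap.id (TensorProduct.lift
    (LinearMap.mk₂ ℚ wedge (fun a b c => wedge_add_left a b c) (fun c a b => wedge_smul_left c a b)
      (fun a b c => wedge_add_right a b c) (fun c a b => wedge_smul_right c a b)))).comp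
    (TensorProduct.assoc ℚ B M M).toLinearMap

lemma tmulWedge_tmul {B M : Type*} [AddCommGroup B] [Module ℚ B] [AddCommGroup M]
    [Module ℚ M] (a : B) (u v : M) : tmulWedge B M ((a ⊗ₜ u) ⊗ₜ v) = a ⊗ₜ wedge u v := rfl

/-- The linear map on the exterior square with `a ∧ b ↦ b ⊗ ∂a - a ⊗ ∂b`. -/
noncomputable def wedgeDifferential {B N : Type*} [AddCommGroup B] [Module ℚ B] [AddCommGroup N]
    [Module ℚ N] (D : B →ₗ[ℚ] N) : ⋀[ℚ]^2 B →ₗ[ℚ] B ⊗[ℚ] N :=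
  exteriorPower.alternatingMapLinearEquiv
    { toFun := fun v => v 1 ⊗ₜ D (v 0) - v 0 ⊗ₜ D (v 1)
      map_update_add' := fun v i a b => by
        fin_cases i <;> simp [TensorProduct.tmul_add, TensorProduct.add_tmul] <;> abel
      map_update_smul' := fun v i c a => by
        fin_cases i <;> simp [TensorProduct.tmul_smul, TensorProduct.smul_tmul', smul_sub]
      map_eq_zero_of_eq' := fun v i j h hij => by
        have h01 : v 0 = v 1 := by
          fin_cases i <;> fin_cases j <;> first | exact absurd rfl hij | exact h | exact h.symm
        rw [h01, sub_self] }

lemma wedgeDifferential_wedge {B N : Type*} [AddCommGroup B] [Module ℚ B] [AddCommGroup N]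
    [Module ℚ N] (D : B →ₗ[ℚ] N) (a b : B) :
    wedgeDifferential D (wedge a b) = b ⊗ₜ D a - a ⊗ₜ D b := by
  rw [wedgeDifferential, wedge, exteriorPower.alternatingMapLinearEquiv_apply_ιMulti]
  rfl

/-- The differential `B₃ ⊗ F* ⊕ Λ² B₂ → B₂ ⊗ Λ² F*`. -/
noncomputable def differential (F : Type*) [Field F] :
    Target F →ₗ[ℚ] B2 F ⊗[ℚ] ⋀[ℚ]^2 (MultQ F) :=
  LinearMap.coprod
    ((tmulWedge (B2 F) (MultQ F)).comp (TensorProduct.map (trilogDifferential F) LinearMap.id))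
    (wedgeDifferential (blochDifferential F))

lemma differential_sym3_tmul (x : F) (u : MultQ F) :
    differential F (sym3 x ⊗ₜ u, 0) = sym2 x ⊗ₜ wedge (unitClass x) u := by
  rw [differential, LinearMap.coprod_apply, map_zero, add_zero, LinearMap.comp_apply,
    TensorProduct.map_tmul, trilogDifferential_sym3, LinearMap.id_apply, tmulWedge_tmul]

lemma differential_wedge (x y : F) :
    differential F (0, wedge (sym2 x) (sym2 y)) =
      sym2 y ⊗ₜ logPair x - sym2 x ⊗ₜ logPair y := by
  rw [differential, LinearMap.coprod_apply, map_zero, zero_add, wedgeDifferential_wedge,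
    blochDifferential_sym2, blochDifferential_sym2]

end Differential

/-! ### Alternating sums in `B₂ ⊗ Λ² F*` -/

section RatioSum

variable {F V : Type*} [Field F] [AddCommGroup V] [Module F V] {m : ℕ}

/-- The dual five-term relation for the projection of five points with one fixed centre. -/
lemma sym2_projRatio_dual (hF : HasFourElements F) {ω : V [⋀^Fin 4]→ₗ[F] F} {x : Fin m → V}
    (hx : Generic ω x) {e : Fin 6 → Fin m} (he : Function.Injective e) :
    sym2 (projRatio ω x e) = sym2 (projRatio ω x (e ∘ swap 1 2)) +
      sym2 (projRatio ω x (e ∘ swap 1 3)) + sym2 (projRatio ω x (e ∘ swap 1 4)) +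
      sym2 (projRatio ω x (e ∘ swap 1 5)) := by
  have h1 := hx.proj (e 0) (f := fun j : Fin 5 => e j.succ)
    (he.comp (Fin.succ_injective _)) (fun j h => Fin.succ_ne_zero _ (he h)) (by decide)
  have h := sym2_crossRatio_dual_subst hF h1
  have key : ∀ (e' : Fin 6 → Fin m) (y : Fin 4 → V), e' 0 = e 0 →
      (∀ k : Fin 4, x (e' k.succ.succ) = y k) → projRatio ω x e' =
      crossRatio ((ω.curryLeft (x (e 0))).curryLeft (x (e' 1))) y := by
    intro e' y h0 hk
    rw [← h0, projRatio]
    exact congrArg (crossRatio _) (funext hk)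
  refine Eq.trans (congrArg sym2 (key e _ rfl fun k => ?_)) (h.trans ?_)
  · fin_cases k <;> rfl
  · refine congrArg₂ (· + ·) (congrArg₂ (· + ·) (congrArg₂ (· + ·) ?_ ?_) ?_) ?_
    · exact congrArg sym2 (key (e ∘ swap 1 2) _ rfl fun k => by fin_cases k <;> rfl).symm
    · exact congrArg sym2 (key (e ∘ swap 1 3) _ rfl fun k => by fin_cases k <;> rfl).symm
    · exact congrArg sym2 (key (e ∘ swap 1 4) _ rfl fun k => by fin_cases k <;> rfl).symm
    · exact congrArg sym2 (key (e ∘ swap 1 5) _ rfl fun k => by fin_cases k <;> rfl).symm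

/-- The five-term relation for the projections of five points with two fixed centres. -/
lemma sym2_projRatio_subst (hF : HasFourElements F) {ω : V [⋀^Fin 4]→ₗ[F] F} {x : Fin m → V}
    (hx : Generic ω x) {e : Fin 7 → Fin m} (he : Function.Injective e) :
    sym2 (projRatio ω x (e ∘ ![0, 1, 2, 3, 4, 5])) =
      sym2 (projRatio ω x (e ∘ ![0, 1, 6, 3, 4, 5])) +
      sym2 (projRatio ω x (e ∘ ![0, 1, 2, 6, 4, 5])) +
      sym2 (projRatio ω x (e ∘ ![0, 1, 2, 3, 6, 5])) +
      sym2 (projRatio ω x (e ∘ ![0, 1, 2, 3, 4, 6])) := by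
  have h := sym2_crossRatio_subst hF (hx.projRatio₂ (k := 5) he (by decide))
  have key : ∀ (g : Fin 6 → Fin 7) (y : Fin 4 → V), g 0 = 0 → g 1 = 1 →
      (∀ k : Fin 4, x (e (g k.succ.succ)) = y k) → projRatio ω x (e ∘ g) =
      crossRatio ((ω.curryLeft (x (e 0))).curryLeft (x (e 1))) y := by
    intro g y h0 h1 hk
    rw [← h0, ← h1, projRatio]
    exact congrArg (crossRatio _) (funext hk)
  refine Eq.trans (congrArg sym2 (key _ _ rfl rfl fun k => ?_)) (h.trans ?_)
  · fin_cases k <;> rfl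
  · refine congrArg₂ (· + ·) (congrArg₂ (· + ·) (congrArg₂ (· + ·) ?_ ?_) ?_) ?_ <;>
    exact congrArg sym2 (key _ _ rfl rfl fun k => by fin_cases k <;> rfl).symm

/-- Permuting the four projected points, and possibly exchanging the two centres, changes
`{r(x_{e₀}, x_{e₁} | …)}₂` by the sign of the permutation of the projected points. -/
lemma sym2_projRatio_perm (hF : HasFourElements F) {ω : V [⋀^Fin 4]→ₗ[F] F} {x : Fin m → V}
    (hx : Generic ω x) {e e' : Fin 6 → Fin m} (he : Function.Injective e) (π : Perm (Fin 4))
    (h01 : e' 0 = e 0 ∧ e' 1 = e 1 ∨ e' 0 = e 1 ∧ e' 1 = e 0)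
    (hπ : ∀ k : Fin 4, e' k.succ.succ = e (π k).succ.succ) :
    sym2 (projRatio ω x e') = sgn π • sym2 (projRatio ω x e) := by
  rw [projRatio, projRatio,
    ← sym2_crossRatio_perm hF π (hx.projRatio₂ (k := 4) he (by decide))]
  simp only [hπ]
  rcases h01 with ⟨h0, h1⟩ | ⟨h0, h1⟩
  · rw [h0, h1]
    rfl
  · rw [h0, h1]
    exact congrArg sym2 ((scaledBy_curryLeft_swap ω (x (e 0)) (x (e 1)) x).crossRatio_eq
      fun k => e (π k).succ.succ)

/-- `{r(x_{e₀}, x_{e₁} | x_{e₂}, …, x_{e₅})}₂ ⊗ Δ(I) ∧ Δ(J)`. -/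
noncomputable def ratioVolWedge (ω : V [⋀^Fin 4]→ₗ[F] F) (x : Fin m → V)
    (p : (Fin 6 → Fin m) × Finset (Fin m) × Finset (Fin m)) : B2 F ⊗[ℚ] ⋀[ℚ]^2 (MultQ F) :=
  sym2 (projRatio ω x p.1) ⊗ₜ wedge (vol ω x p.2.1) (vol ω x p.2.2)

/-- The alternating sum of `{r(x_{e₀}, x_{e₁} | x_{e₂}, …, x_{e₅})}₂ ⊗ Δ(I) ∧ Δ(J)`. -/
noncomputable def ratioSum (ω : V [⋀^Fin 4]→ₗ[F] F) (x : Fin m → V) (e : Fin 6 → Fin m)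
    (I J : Finset (Fin m)) : B2 F ⊗[ℚ] ⋀[ℚ]^2 (MultQ F) :=
  altSum m (ratioVolWedge ω x) (e, I, J)

variable {ω : V [⋀^Fin 4]→ₗ[F] F} {x : Fin m → V} {e e' : Fin 6 → Fin m}
  {I J I' J' : Finset (Fin m)}

lemma ratioSum_symm : ratioSum ω x e J I = -ratioSum ω x e I J := by
  rw [ratioSum, ratioSum, ← altSum_neg]
  refine altSum_congr fun σ => ?_
  rw [Prod.smul_mk, Prod.smul_mk, Prod.smul_mk, Prod.smul_mk, ratioVolWedge, ratioVolWedge,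
    wedge_swap, TensorProduct.tmul_neg]

/-- The symmetries of the alternating sums: a permutation `τ` of the indices which changes `e` by
a permutation of the two centres and the permutation `π` of the four projected points. -/
lemma ratioSum_perm (hF : HasFourElements F) (hx : Generic ω x) (he : Function.Injective e)
    (τ : Perm (Fin m)) (π : Perm (Fin 4)) (u : ℤ)
    (h : ((e' 0 = τ (e 0) ∧ e' 1 = τ (e 1) ∨ e' 0 = τ (e 1) ∧ e' 1 = τ (e 0)) ∧
      ∀ k : Fin 4, e' k.succ.succ = τ (e (π k).succ.succ)) ∧ τ • I = I' ∧ τ • J = J' ∧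
      Perm.sign τ = u * Perm.sign π) :
    ratioSum ω x e' I' J' = u • ratioSum ω x e I J := by
  obtain ⟨⟨h01, hπ⟩, rfl, rfl, hs⟩ := h
  have h1 : ratioSum ω x e' (τ • I) (τ • J) =
      sgn π • altSum m (ratioVolWedge ω x) (τ • (e, I, J)) := by
    rw [ratioSum, ← altSum_const_smul]
    refine altSum_congr fun σ => ?_
    have h2 := sym2_projRatio_perm hF hx (e := σ • τ • e) (e' := σ • e')
      (σ.injective.comp (τ.injective.comp he)) π
      (h01.imp (fun h => ⟨congrArg σ h.1, congrArg σ h.2⟩)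
        (fun h => ⟨congrArg σ h.1, congrArg σ h.2⟩)) (fun k => congrArg σ (hπ k))
    simp only [Prod.smul_mk, ratioVolWedge]
    rw [h2, TensorProduct.smul_tmul']
  have hs' : sgn τ = u * sgn π := by
    rw [sgn, sgn, hs]
    push_cast
    rfl
  rw [h1, altSum_smul, hs', smul_smul, mul_left_comm, sgn_mul_self, mul_one, Int.cast_smul_eq_zsmul]
  rfl

end RatioSum

section Averaging

/-- Permutations of the indices act transitively on the sets of indices of a given size. -/
lemma choose_smul_sum_perm {T : Type*} [AddCommGroup T] [Module ℚ T] {n : ℕ}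
    (g : Finset (Fin n) → T) (K₀ : Finset (Fin n)) :
    n.choose K₀.card • ∑ ρ : Perm (Fin n), g (ρ • K₀) =
      n.factorial • ∑ K ∈ Finset.univ.powersetCard K₀.card, g K := by
  have h1 : ∀ K ∈ (Finset.univ : Finset (Fin n)).powersetCard K₀.card,
      ∑ ρ : Perm (Fin n), g (ρ • K) = ∑ ρ : Perm (Fin n), g (ρ • K₀) := by
    intro K hK
    have hc := (Finset.mem_powersetCard.1 hK).2
    let τ : Perm (Fin n) := (Finset.equivOfCardEq hc.symm : K₀ ≃ K).extendSubtype
    have hτ : τ • K₀ = K := by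
      refine Finset.eq_of_subset_of_card_le ?_ (by rw [Finset.card_smul_finset, hc])
      intro i hi
      obtain ⟨j, hj, rfl⟩ := Finset.mem_smul_finset.1 hi
      exact Equiv.extendSubtype_mem _ j hj
    refine Fintype.sum_equiv (Equiv.mulRight τ) _ _ fun ρ => ?_
    rw [Equiv.coe_mulRight, mul_smul, hτ]
  have h2 : ∀ ρ : Perm (Fin n),
      ∑ K ∈ (Finset.univ : Finset (Fin n)).powersetCard K₀.card, g (ρ • K) =
      ∑ K ∈ (Finset.univ : Finset (Fin n)).powersetCard K₀.card, g K := by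
    intro ρ
    refine Finset.sum_bij' (fun K _ => ρ • K) (fun K _ => ρ⁻¹ • K) ?_ ?_ ?_ ?_ ?_ <;>
      simp [Finset.mem_powersetCard, Finset.card_smul_finset]
  have h3 := Finset.sum_congr rfl h1
  rw [Finset.sum_comm, Finset.sum_congr rfl fun ρ _ => h2 ρ] at h3
  simpa [Finset.card_powersetCard, Fintype.card_perm] using h3.symm

end Averaging

section EightPoints

variable {F V : Type*} [Field F] [AddCommGroup V] [Module F V]
variable {ω : V [⋀^Fin 4]→ₗ[F] F} {x : Fin 8 → V} {I J : Finset (Fin 8)}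

lemma Generic.hasFourElements₄ (hx : Generic ω x) : HasFourElements F :=
  Generic.hasFourElements
    (hx.projRatio₂ (k := 5) (e := ![0, 1, 2, 3, 4, 5, 6]) (by decide) (by decide))

/-- The alternating sum of `{r(x₀, x₁ | x₂, x₃, x₄, x₅)}₂ ⊗ Δ(I) ∧ Δ(J)`. -/
noncomputable def standardSum (ω : V [⋀^Fin 4]→ₗ[F] F) (x : Fin 8 → V) (I J : Finset (Fin 8)) :
    B2 F ⊗[ℚ] ⋀[ℚ]^2 (MultQ F) :=
  ratioSum ω x ![0, 1, 2, 3, 4, 5] I J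

lemma standardSum_symm {I J : Finset (Fin 8)} :
    standardSum ω x J I = -standardSum ω x I J := ratioSum_symm

/-- The transposition `(0 1)` of the two centres, or the transposition `(6 7)` of the indices which
do not occur in the cross-ratio, fixes the summands if it fixes `I` and `J`. -/
lemma ratioSum_eq_zero (hx : Generic ω x)
    (h : (0 ∈ I ↔ 1 ∈ I) ∧ (0 ∈ J ↔ 1 ∈ J) ∨ (6 ∈ I ↔ 7 ∈ I) ∧ (6 ∈ J ↔ 7 ∈ J)) :
    ratioSum ω x ![0, 1, 2, 3, 4, 5] I J = 0 := by
  have hswap : ∀ (a b : Fin 8) (K : Finset (Fin 8)), (a ∈ K ↔ b ∈ K) → swap a b • K = K := by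
    intro a b K h
    ext c
    rw [← Finset.inv_smul_mem_iff, swap_inv, Perm.smul_def]
    rcases eq_or_ne c a with rfl | ha
    · rw [swap_apply_left, h]
    · rcases eq_or_ne c b with rfl | hb
      · rw [swap_apply_right, h]
      · rw [swap_apply_of_ne_of_ne ha hb]
  have key : ∀ τ : Perm (Fin 8), (((![0, 1, 2, 3, 4, 5] : Fin 6 → Fin 8) 0 = τ 0 ∧
      (![0, 1, 2, 3, 4, 5] : Fin 6 → Fin 8) 1 = τ 1 ∨
      (![0, 1, 2, 3, 4, 5] : Fin 6 → Fin 8) 0 = τ 1 ∧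
      (![0, 1, 2, 3, 4, 5] : Fin 6 → Fin 8) 1 = τ 0) ∧
      ∀ k : Fin 4, (![0, 1, 2, 3, 4, 5] : Fin 6 → Fin 8) k.succ.succ =
        τ ((![0, 1, 2, 3, 4, 5] : Fin 6 → Fin 8) k.succ.succ)) → τ • I = I → τ • J = J →
      Perm.sign τ = -1 → ratioSum ω x ![0, 1, 2, 3, 4, 5] I J = 0 := by
    intro τ h hI hJ hs
    have h1 := ratioSum_perm (e := ![0, 1, 2, 3, 4, 5]) (e' := ![0, 1, 2, 3, 4, 5])
      hx.hasFourElements₄ hx (by decide) τ 1 (-1) ⟨h, hI, hJ, by rw [hs]; rfl⟩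
    rw [neg_one_smul] at h1
    exact eq_zero_of_eq_neg h1
  rcases h with ⟨hI, hJ⟩ | ⟨hI, hJ⟩
  · exact key (swap 0 1) (by decide) (hswap _ _ _ hI) (hswap _ _ _ hJ) (by decide)
  · exact key (swap 6 7) (by decide) (hswap _ _ _ hI) (hswap _ _ _ hJ) (by decide)

lemma ratioSum_five_term (hx : Generic ω x) (I J : Finset (Fin 8)) :
    ratioSum ω x ![0, 1, 2, 3, 4, 5] I J = ratioSum ω x ![0, 1, 6, 3, 4, 5] I J +
      ratioSum ω x ![0, 1, 2, 6, 4, 5] I J + ratioSum ω x ![0, 1, 2, 3, 6, 5] I J +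
      ratioSum ω x ![0, 1, 2, 3, 4, 6] I J := by
  simp only [ratioSum, altSum, ← Finset.sum_add_distrib, ← smul_add]
  refine Finset.sum_congr rfl fun σ _ => congrArg (fun t => sgn σ • t) ?_
  have h := sym2_projRatio_subst hx.hasFourElements₄ hx (e := σ • ![0, 1, 2, 3, 4, 5, 6])
    (σ.injective.comp (by decide))
  have h' := congrArg (fun t => t ⊗ₜ[ℚ] wedge (vol ω x (σ • I)) (vol ω x (σ • J))) h
  simp only [TensorProduct.add_tmul] at h'
  have key : ∀ (e : Fin 6 → Fin 8) (g : Fin 6 → Fin 7), e = ![0, 1, 2, 3, 4, 5, 6] ∘ g →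
      ratioVolWedge ω x (σ • (e, I, J)) =
      sym2 (projRatio ω x ((σ • (![0, 1, 2, 3, 4, 5, 6] : Fin 7 → Fin 8)) ∘ g)) ⊗ₜ
        wedge (vol ω x (σ • I)) (vol ω x (σ • J)) := by
    rintro e g rfl
    rfl
  rw [key _ ![0, 1, 2, 3, 4, 5] (by decide), key _ ![0, 1, 6, 3, 4, 5] (by decide),
    key _ ![0, 1, 2, 6, 4, 5] (by decide),
    key _ ![0, 1, 2, 3, 6, 5] (by decide), key _ ![0, 1, 2, 3, 4, 6] (by decide)]
  exact h'

lemma ratioSum_dual (hx : Generic ω x) (I J : Finset (Fin 8)) :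
    ratioSum ω x ![0, 1, 2, 3, 4, 5] I J = ratioSum ω x ![0, 2, 1, 3, 4, 5] I J +
      ratioSum ω x ![0, 3, 2, 1, 4, 5] I J + ratioSum ω x ![0, 4, 2, 3, 1, 5] I J +
      ratioSum ω x ![0, 5, 2, 3, 4, 1] I J := by
  simp only [ratioSum, altSum, ← Finset.sum_add_distrib, ← smul_add]
  refine Finset.sum_congr rfl fun σ _ => congrArg (fun t => sgn σ • t) ?_
  have h := sym2_projRatio_dual hx.hasFourElements₄ hx (e := σ • ![0, 1, 2, 3, 4, 5])
    (σ.injective.comp (by decide))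
  have h' := congrArg (fun t => t ⊗ₜ[ℚ] wedge (vol ω x (σ • I)) (vol ω x (σ • J))) h
  simp only [TensorProduct.add_tmul] at h'
  have key : ∀ (e : Fin 6 → Fin 8) (g : Fin 6 → Fin 6), e = ![0, 1, 2, 3, 4, 5] ∘ g →
      ratioVolWedge ω x (σ • (e, I, J)) =
      sym2 (projRatio ω x ((σ • (![0, 1, 2, 3, 4, 5] : Fin 6 → Fin 8)) ∘ g)) ⊗ₜ
        wedge (vol ω x (σ • I)) (vol ω x (σ • J)) := by
    rintro e g rfl
    rfl
  rw [key ![0, 1, 2, 3, 4, 5] id (by decide), key ![0, 2, 1, 3, 4, 5] (swap 1 2) (by decide),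
    key ![0, 3, 2, 1, 4, 5] (swap 1 3) (by decide),
    key ![0, 4, 2, 3, 1, 5] (swap 1 4) (by decide), key ![0, 5, 2, 3, 4, 1] (swap 1 5) (by decide)]
  exact h'

/-! ### The composition of the cobracket and the differential -/

lemma differential_inl (t : B3 F ⊗[ℚ] MultQ F) :
    differential F (t, 0) = ((tmulWedge (B2 F) (MultQ F)).comp
      (TensorProduct.map (trilogDifferential F) LinearMap.id)) t := by
  rw [differential, LinearMap.coprod_apply, map_zero, add_zero]

/-- `1, …, 6` as indices of eight points. -/
def middle : Fin 6 ↪ Fin 8 := ⟨fun j => j.succ.castSucc, by decide⟩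

/-- The differential of `r₃(x₀ | x₁, …, x₆)` for points in `ℙ³`. -/
lemma trilogDifferential_projR3 (hx : Generic ω x) (σ : Perm (Fin 8)) :
    trilogDifferential F (projR3 ω x (σ • ![0, 1, 2, 3, 4, 5, 6])) =
      (-1 / 2 : ℚ) • ∑ ρ : Perm (Fin 6), sgn ρ •
        sym2 (projRatio ω x ((σ * ρ.viaFintypeEmbedding middle) • ![0, 1, 2, 3, 4, 5])) ⊗ₜ
          vol ω x ((σ * ρ.viaFintypeEmbedding middle) • {0, 1, 2, 3}) := by
  have hg := hx.proj (σ 0) (f := fun j : Fin 6 => σ (middle j))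
    (σ.injective.comp middle.injective)
    (fun j h => absurd (σ.injective h) (by clear h; revert j; decide))
    (by decide)
  have h := trilogDifferential_r3 hg
  have hr : projR3 ω x (σ • ![0, 1, 2, 3, 4, 5, 6]) =
      r3 (ω.curryLeft (x (σ 0))) (x ∘ fun j : Fin 6 => σ (middle j)) := by
    refine congrArg (r3 _) (funext fun k => ?_)
    fin_cases k <;> rfl
  rw [hr, h, altSum]
  refine congrArg (fun t => (-1 / 2 : ℚ) • t) (Finset.sum_congr rfl fun ρ _ => ?_)
  refine congrArg (fun t => sgn ρ • t) ?_
  have h0 : ρ.viaFintypeEmbedding middle 0 = 0 :=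
    Perm.viaFintypeEmbedding_apply_notMem_range _ _ (by decide)
  have hm : ∀ j : Fin 6, ρ.viaFintypeEmbedding middle (middle j) = middle (ρ j) :=
    Perm.viaFintypeEmbedding_apply_image ρ middle
  have hI : ({0, 1, 2, 3} : Finset (Fin 8)) =
      insert 0 (({0, 1, 2} : Finset (Fin 6)).image middle) := by
    decide
  have hI' : (σ * ρ.viaFintypeEmbedding middle) • ({0, 1, 2, 3} : Finset (Fin 8)) =
      insert (σ 0) ((ρ • ({0, 1, 2} : Finset (Fin 6))).image fun j : Fin 6 => σ (middle j)) := by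
    rw [hI, Finset.smul_finset_def, Finset.image_insert, Finset.image_image, Finset.smul_finset_def,
      Finset.image_image]
    exact congrArg₂ insert (congrArg σ h0) (Finset.image_congr fun j _ => congrArg σ (hm j))
  rw [hI', ← vol_curryLeft, Prod.smul_mk, planeTerm]
  · refine congrArg₂ (fun s t => sym2 s ⊗ₜ[ℚ] t) ?_
      (vol_comp _ _ (σ.injective.comp middle.injective) _)
    have h0' :
        ((σ * ρ.viaFintypeEmbedding middle) • (![0, 1, 2, 3, 4, 5] : Fin 6 → Fin 8)) 0 = σ 0 :=
      congrArg σ h0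
    have hm' : ∀ j : Fin 5, ((σ * ρ.viaFintypeEmbedding middle) •
        (![0, 1, 2, 3, 4, 5] : Fin 6 → Fin 8)) j.succ = σ (middle (ρ j.castSucc)) := fun j => by
      refine Eq.trans ?_ (congrArg σ (hm j.castSucc))
      fin_cases j <;> rfl
    rw [projRatio, h0', show (1 : Fin 6) = (0 : Fin 5).succ from rfl, hm']
    refine congrArg (crossRatio _) (funext fun k => ?_)
    rw [hm']
    fin_cases k <;> rfl
  · rw [Finset.mem_image]
    rintro ⟨j, -, hj⟩
    exact absurd (σ.injective hj) (by clear hj; revert j; decide)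

/-- Summation over the permutations of `x₁, …, x₆` in the differential of `r₃` is absorbed by the
alternating sum, at the cost of letting it act on `Δ(J)`; the `6!` permutations map `K₀`
equally often to each of the `20` sets `K` with three elements, and `18 = 6! / (2 * 20)`. -/
lemma differential_altSum_r3Vol (hx : Generic ω x) (K₀ : Finset (Fin 6)) (hK : K₀.card = 3)
    (c : Fin 8) (hc : c ∉ Set.range middle) :
    differential F (altSum 8 (r3Vol ω x) (![0, 1, 2, 3, 4, 5, 6], insert c (K₀.image middle)), 0) =
      (-18 : ℚ) • ∑ K ∈ Finset.univ.powersetCard 3,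
        standardSum ω x {0, 1, 2, 3} (insert c (K.image middle)) := by
  have h1 : differential F
      (altSum 8 (r3Vol ω x) (![0, 1, 2, 3, 4, 5, 6], insert c (K₀.image middle)), 0) =
      (-1 / 2 : ℚ) • ∑ ρ : Perm (Fin 6),
        standardSum ω x {0, 1, 2, 3} (insert c ((ρ⁻¹ • K₀).image middle)) := by
    rw [differential_inl, map_altSum, altSum, Finset.smul_sum]
    have hρ : ∀ ρ : Perm (Fin 6), standardSum ω x {0, 1, 2, 3}
        (insert c ((ρ⁻¹ • K₀).image middle)) = ∑ σ : Perm (Fin 8), sgn σ • sgn ρ •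
          sym2 (projRatio ω x ((σ * ρ.viaFintypeEmbedding middle) • ![0, 1, 2, 3, 4, 5])) ⊗ₜ
          wedge (vol ω x ((σ * ρ.viaFintypeEmbedding middle) • {0, 1, 2, 3}))
            (vol ω x (σ • insert c (K₀.image middle))) := by
      intro ρ
      rw [standardSum, ratioSum, altSum]
      symm
      refine Fintype.sum_equiv (Equiv.mulRight (ρ.viaFintypeEmbedding middle)) _ _ fun σ => ?_
      have hs : sgn (ρ.viaFintypeEmbedding middle) = sgn ρ := by
        rw [sgn, Perm.viaFintypeEmbedding_sign, sgn]
      have hI : (ρ.viaFintypeEmbedding middle) • insert c ((ρ⁻¹ • K₀).image middle) =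
          insert c (K₀.image middle) := by
        rw [Finset.smul_finset_def, Finset.image_insert, Finset.image_image, Finset.smul_finset_def,
          Finset.image_image]
        congr 1
        · exact Perm.viaFintypeEmbedding_apply_notMem_range _ _ hc
        · refine Finset.image_congr fun j _ => ?_
          refine (Perm.viaFintypeEmbedding_apply_image ρ middle (ρ⁻¹ j)).trans ?_
          simp
      rw [Equiv.coe_mulRight, sgn_mul, hs, smul_smul, Prod.smul_mk, Prod.smul_mk, ratioVolWedge,
        mul_smul σ _ (insert c _), hI]
    simp only [hρ]
    rw [← Finset.smul_sum, Finset.sum_comm, Finset.smul_sum]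
    refine Finset.sum_congr rfl fun σ _ => ?_
    rw [← Finset.smul_sum, smul_comm]
    refine congrArg (fun t => sgn σ • t) ?_
    rw [Prod.smul_mk, r3Vol, LinearMap.comp_apply, TensorProduct.map_tmul, LinearMap.id_apply,
      trilogDifferential_projR3 hx, ← TensorProduct.smul_tmul', map_smul, TensorProduct.sum_tmul,
      map_sum]
    simp only [← TensorProduct.smul_tmul', map_smul, tmulWedge_tmul]
  have h2 := choose_smul_sum_perm (fun K => standardSum ω x {0, 1, 2, 3}
    (insert c (K.image middle))) K₀
  have h3 : ∑ ρ : Perm (Fin 6), standardSum ω x {0, 1, 2, 3}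
      (insert c ((ρ⁻¹ • K₀).image middle)) = ∑ ρ : Perm (Fin 6), standardSum ω x
        {0, 1, 2, 3} (insert c ((ρ • K₀).image middle)) :=
    Fintype.sum_equiv (Equiv.inv _) _ _ fun ρ => rfl
  rw [hK, show Nat.choose 6 3 = 20 from rfl, show Nat.factorial 6 = 720 from rfl] at h2
  rw [h1, h3]
  linear_combination (norm := module) (-1 / 40 : ℚ) • h2

/-- Reduction to `standardSum`: `τ` permutes the indices, `π` is the permutation of the four
projected points which remains, and `u` is the resulting sign. -/
lemma ratioSum_eq_standardSum (hx : Generic ω x) {e' : Fin 6 → Fin 8} {I J I' J' : Finset (Fin 8)}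
    (τ : Perm (Fin 8)) (π : Perm (Fin 4)) (u : ℤ)
    (h : ((e' 0 = τ 0 ∧ e' 1 = τ 1 ∨ e' 0 = τ 1 ∧ e' 1 = τ 0) ∧
      ∀ k : Fin 4, e' k.succ.succ = τ (![2, 3, 4, 5] (π k))) ∧ τ • I = I' ∧ τ • J = J' ∧
      Perm.sign τ = u * Perm.sign π) :
    ratioSum ω x e' I' J' = u • standardSum ω x I J := by
  refine ratioSum_perm hx.hasFourElements₄ hx (by decide) τ π u
    ⟨⟨h.1.1, fun k => (h.1.2 k).trans (congrArg τ ?_)⟩, h.2⟩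
  generalize π k = j
  fin_cases j <;> rfl

lemma standardSum_perm (hx : Generic ω x) {I J I' J' : Finset (Fin 8)}
    (τ : Perm (Fin 8)) (π : Perm (Fin 4)) (u : ℤ)
    (h : ((0 = τ 0 ∧ 1 = τ 1 ∨ 0 = τ 1 ∧ 1 = τ 0) ∧
      ∀ k : Fin 4, k.succ.succ.castLE (by decide) = τ (![2, 3, 4, 5] (π k))) ∧
      τ • I = I' ∧ τ • J = J' ∧ Perm.sign τ = u * Perm.sign π) :
    standardSum ω x I' J' = u • standardSum ω x I J := by
  refine ratioSum_eq_standardSum hx τ π u ⟨⟨h.1.1, fun k => Eq.trans ?_ (h.1.2 k)⟩, h.2⟩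
  fin_cases k <;> rfl

/-- Relations between the sums `standardSum`. They follow from the five-term relation, with `x₆` as
the additional point, and from the dual five-term relation, by the symmetries. -/
lemma standardSum_relations (hx : Generic ω x) :
    standardSum ω x {0, 1, 2, 3} {0, 4, 5, 6} = 0 ∧
    standardSum ω x {0, 1, 2, 3} {0, 2, 3, 6} +
      (2 : ℚ) • standardSum ω x {0, 2, 3, 4} {0, 2, 3, 6} = 0 ∧
    (3 : ℚ) • standardSum ω x {0, 1, 2, 3} {0, 2, 3, 6} -
      (2 : ℚ) • standardSum ω x {0, 2, 3, 4} {2, 3, 4, 6} = 0 ∧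
    standardSum ω x {0, 2, 3, 4} {2, 3, 4, 6} +
      (3 : ℚ) • standardSum ω x {0, 2, 3, 6} {2, 3, 4, 6} = 0 ∧
    standardSum ω x {0, 2, 3, 6} {1, 2, 3, 6} = 0 := by
  have five := fun I J => ratioSum_five_term hx I J
  have dual := fun I J => ratioSum_dual hx I J
  have r := @ratioSum_eq_standardSum _ _ _ _ _ _ _ hx
  have zero : ∀ I J : Finset (Fin 8), (0 ∈ I ↔ 1 ∈ I) ∧ (0 ∈ J ↔ 1 ∈ J) ∨
      (6 ∈ I ↔ 7 ∈ I) ∧ (6 ∈ J ↔ 7 ∈ J) → standardSum ω x I J = 0 :=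
    fun I J h => ratioSum_eq_zero hx h
  change ∀ I J, standardSum ω x I J = _ at five dual
  refine ⟨?_, ?_, ?_, ?_, ?_⟩
  · have d := dual {0, 1, 2, 3} {0, 4, 5, 6}
    have f := five {0, 1, 2, 3} {0, 4, 5, 6}
    have h1 : ratioSum ω x ![0, 2, 1, 3, 4, 5] {0, 1, 2, 3} {0, 4, 5, 6} =
        (-1 : ℤ) • standardSum ω x {0, 1, 2, 3} {0, 4, 5, 6} :=
      r (swap 1 2) 1 (-1) (by decide)
    have h2 : ratioSum ω x ![0, 3, 2, 1, 4, 5] {0, 1, 2, 3} {0, 4, 5, 6} =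
        (-1 : ℤ) • standardSum ω x {0, 1, 2, 3} {0, 4, 5, 6} :=
      r (swap 1 3) 1 (-1) (by decide)
    have h3 : ratioSum ω x ![0, 4, 2, 3, 1, 5] {0, 1, 2, 3} {0, 4, 5, 6} =
        (-1 : ℤ) • standardSum ω x {0, 3, 4, 5} {0, 1, 2, 6} :=
      r (swap 1 4 * swap 2 5) (swap 0 3) (-1) (by decide)
    have h4 : ratioSum ω x ![0, 5, 2, 3, 4, 1] {0, 1, 2, 3} {0, 4, 5, 6} =
        (-1 : ℤ) • standardSum ω x {0, 3, 4, 5} {0, 1, 2, 6} :=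
      r (swap 1 5 * swap 2 4) (swap 0 2) (-1) (by decide)
    rw [h1, h2, h3, h4, standardSum_symm (I := {0, 1, 2, 6}) (J := {0, 3, 4, 5})] at d
    clear h1 h2 h3 h4
    have h1 : ratioSum ω x ![0, 1, 6, 3, 4, 5] {0, 1, 2, 3} {0, 4, 5, 6} =
        (-1 : ℤ) • standardSum ω x {0, 1, 2, 6} {0, 3, 4, 5} :=
      r (swap 2 3 * swap 3 6) (swap 0 1) (-1) (by decide)
    have h2 : ratioSum ω x ![0, 1, 2, 6, 4, 5] {0, 1, 2, 3} {0, 4, 5, 6} =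
        (-1 : ℤ) • standardSum ω x {0, 1, 2, 6} {0, 3, 4, 5} :=
      r (swap 3 6) 1 (-1) (by decide)
    have h3 : ratioSum ω x ![0, 1, 2, 3, 6, 5] {0, 1, 2, 3} {0, 4, 5, 6} =
        (-1 : ℤ) • standardSum ω x {0, 1, 2, 3} {0, 4, 5, 6} :=
      r (swap 4 6) 1 (-1) (by decide)
    have h4 : ratioSum ω x ![0, 1, 2, 3, 4, 6] {0, 1, 2, 3} {0, 4, 5, 6} =
        (-1 : ℤ) • standardSum ω x {0, 1, 2, 3} {0, 4, 5, 6} :=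
      r (swap 5 6) 1 (-1) (by decide)
    rw [h1, h2, h3, h4] at f
    linear_combination (norm := module) (1 / 6 : ℚ) • d + (1 / 6 : ℚ) • f
  · have h := dual {0, 1, 2, 3} {0, 1, 2, 6}
    have h1 : ratioSum ω x ![0, 2, 1, 3, 4, 5] {0, 1, 2, 3} {0, 1, 2, 6} =
        (-1 : ℤ) • standardSum ω x {0, 1, 2, 3} {0, 1, 2, 6} :=
      r (swap 1 2) 1 (-1) (by decide)
    have h2 : ratioSum ω x ![0, 3, 2, 1, 4, 5] {0, 1, 2, 3} {0, 1, 2, 6} =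
        (-1 : ℤ) • standardSum ω x {0, 1, 2, 3} {0, 2, 3, 6} :=
      r (swap 1 3) 1 (-1) (by decide)
    have h3 : ratioSum ω x ![0, 4, 2, 3, 1, 5] {0, 1, 2, 3} {0, 1, 2, 6} =
        (-1 : ℤ) • standardSum ω x {0, 2, 3, 4} {0, 2, 3, 6} :=
      r (swap 1 4 * swap 4 3) (swap 1 2) (-1) (by decide)
    have h4 : ratioSum ω x ![0, 5, 2, 3, 4, 1] {0, 1, 2, 3} {0, 1, 2, 6} =
        (-1 : ℤ) • standardSum ω x {0, 2, 3, 4} {0, 2, 3, 6} :=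
      r (swap 1 5 * swap 5 4 * swap 4 3) (swap 1 2 * swap 2 3) (-1) (by decide)
    rw [h1, h2, h3, h4, zero {0, 1, 2, 3} {0, 1, 2, 6} (by decide)] at h
    linear_combination (norm := module) (1 : ℚ) • h
  · have h := dual {0, 1, 2, 3} {1, 2, 3, 6}
    have h1 : ratioSum ω x ![0, 2, 1, 3, 4, 5] {0, 1, 2, 3} {1, 2, 3, 6} =
        (1 : ℤ) • standardSum ω x {0, 1, 2, 3} {0, 2, 3, 6} :=
      r (swap 0 2 * swap 2 1) 1 1 (by decide)
    have h2 : ratioSum ω x ![0, 3, 2, 1, 4, 5] {0, 1, 2, 3} {1, 2, 3, 6} =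
        (1 : ℤ) • standardSum ω x {0, 1, 2, 3} {0, 2, 3, 6} :=
      r (swap 0 3 * swap 3 1) 1 1 (by decide)
    have h3 : ratioSum ω x ![0, 4, 2, 3, 1, 5] {0, 1, 2, 3} {1, 2, 3, 6} =
        (-1 : ℤ) • standardSum ω x {0, 2, 3, 4} {2, 3, 4, 6} :=
      r (swap 1 4) 1 (-1) (by decide)
    have h4 : ratioSum ω x ![0, 5, 2, 3, 4, 1] {0, 1, 2, 3} {1, 2, 3, 6} =
        (-1 : ℤ) • standardSum ω x {0, 2, 3, 4} {2, 3, 4, 6} :=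
      r (swap 1 5 * swap 5 4) (swap 2 3) (-1) (by decide)
    have h5 : standardSum ω x {0, 1, 2, 3} {1, 2, 3, 6} =
        (-1 : ℤ) • standardSum ω x {0, 1, 2, 3} {0, 2, 3, 6} :=
      r (swap 0 1) 1 (-1) (by decide)
    rw [h1, h2, h3, h4, h5] at h
    linear_combination (norm := module) (-1 : ℚ) • h
  · have h := five {0, 2, 3, 4} {2, 3, 4, 5}
    have h1 : ratioSum ω x ![0, 1, 6, 3, 4, 5] {0, 2, 3, 4} {2, 3, 4, 5} =
        (-1 : ℤ) • standardSum ω x {0, 2, 3, 6} {2, 3, 4, 6} :=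
      r (swap 2 4 * swap 4 5 * swap 5 6) (swap 0 3 * swap 3 2) (-1) (by decide)
    have h2 : ratioSum ω x ![0, 1, 2, 6, 4, 5] {0, 2, 3, 4} {2, 3, 4, 5} =
        (-1 : ℤ) • standardSum ω x {0, 2, 3, 6} {2, 3, 4, 6} :=
      r (swap 3 4 * swap 4 5 * swap 5 6) (swap 1 3 * swap 3 2) (-1) (by decide)
    have h3 : ratioSum ω x ![0, 1, 2, 3, 6, 5] {0, 2, 3, 4} {2, 3, 4, 5} =
        (-1 : ℤ) • standardSum ω x {0, 2, 3, 6} {2, 3, 4, 6} :=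
      r (swap 4 5 * swap 5 6) (swap 2 3) (-1) (by decide)
    have h4 : ratioSum ω x ![0, 1, 2, 3, 4, 6] {0, 2, 3, 4} {2, 3, 4, 5} =
        (-1 : ℤ) • standardSum ω x {0, 2, 3, 4} {2, 3, 4, 6} :=
      r (swap 5 6) 1 (-1) (by decide)
    rw [h1, h2, h3, h4, zero {0, 2, 3, 4} {2, 3, 4, 5} (by decide)] at h
    linear_combination (norm := module) (1 : ℚ) • h
  · have h := five {0, 2, 3, 4} {1, 2, 3, 4}
    have h1 : ratioSum ω x ![0, 1, 6, 3, 4, 5] {0, 2, 3, 4} {1, 2, 3, 4} =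
        (-1 : ℤ) • standardSum ω x {0, 2, 3, 6} {1, 2, 3, 6} :=
      r (swap 2 4 * swap 4 6) (swap 0 2) (-1) (by decide)
    have h2 : ratioSum ω x ![0, 1, 2, 6, 4, 5] {0, 2, 3, 4} {1, 2, 3, 4} =
        (-1 : ℤ) • standardSum ω x {0, 2, 3, 6} {1, 2, 3, 6} :=
      r (swap 3 4 * swap 4 6) (swap 1 2) (-1) (by decide)
    have h3 : ratioSum ω x ![0, 1, 2, 3, 6, 5] {0, 2, 3, 4} {1, 2, 3, 4} =
        (-1 : ℤ) • standardSum ω x {0, 2, 3, 6} {1, 2, 3, 6} :=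
      r (swap 4 6) 1 (-1) (by decide)
    have h4 : ratioSum ω x ![0, 1, 2, 3, 4, 6] {0, 2, 3, 4} {1, 2, 3, 4} =
        (-1 : ℤ) • standardSum ω x {0, 2, 3, 4} {1, 2, 3, 4} :=
      r (swap 5 6) 1 (-1) (by decide)
    rw [h1, h2, h3, h4, zero {0, 2, 3, 4} {1, 2, 3, 4} (by decide)] at h
    linear_combination (norm := module) (1 / 3 : ℚ) • h

/-- The contribution of `r₃ ⊗ Δ(J)` for sets `J` of indices which contain `7`. The sets `K` which
contain `5`, that is `x₆`, contribute nothing, because of the symmetry in `6` and `7`, nor do those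
which do not contain `0`, that is `x₁`, because of the symmetry in `0` and `1`. -/
lemma sum_standardSum_seven (hx : Generic ω x) :
    ∑ K ∈ Finset.univ.powersetCard 3, standardSum ω x {0, 1, 2, 3} (insert 7 (K.image middle)) =
      standardSum ω x {0, 1, 2, 3} {0, 2, 3, 6} + standardSum ω x {0, 1, 2, 3} {0, 4, 5, 6} +
        (4 : ℚ) • standardSum ω x {0, 1, 2, 3} {0, 2, 4, 6} := by
  have r := @standardSum_perm _ _ _ _ _ _ _ hx
  have hz : ∀ K ∈ (Finset.univ : Finset (Fin 6)).powersetCard 3,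
      K ∉ ({{0, 1, 2}, {0, 1, 3}, {0, 1, 4}, {0, 2, 3}, {0, 2, 4}, {0, 3, 4}} :
        Finset (Finset (Fin 6))) →
      standardSum ω x {0, 1, 2, 3} (insert 7 (K.image middle)) = 0 := fun K hK hK' =>
    ratioSum_eq_zero hx (by revert K; decide)
  rw [← Finset.sum_subset (by decide) hz, Finset.sum_insert (by decide),
    Finset.sum_insert (by decide), Finset.sum_insert (by decide), Finset.sum_insert (by decide),
    Finset.sum_insert (by decide), Finset.sum_singleton]
  have h1 : standardSum ω x {0, 1, 2, 3} (insert 7 (Finset.image middle {0, 1, 2})) =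
      (1 : ℤ) • standardSum ω x {0, 1, 2, 3} {0, 2, 3, 6} :=
    r (swap 0 1 * swap 6 7) 1 1 (by decide)
  have h2 : standardSum ω x {0, 1, 2, 3} (insert 7 (Finset.image middle {0, 1, 3})) =
      (1 : ℤ) • standardSum ω x {0, 1, 2, 3} {0, 2, 4, 6} :=
    r (swap 0 1 * swap 6 7) 1 1 (by decide)
  have h3 : standardSum ω x {0, 1, 2, 3} (insert 7 (Finset.image middle {0, 1, 4})) =
      (1 : ℤ) • standardSum ω x {0, 1, 2, 3} {0, 2, 4, 6} :=
    r (swap 0 1 * swap 4 5 * swap 6 7) (swap 2 3) 1 (by decide)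
  have h4 : standardSum ω x {0, 1, 2, 3} (insert 7 (Finset.image middle {0, 2, 3})) =
      (1 : ℤ) • standardSum ω x {0, 1, 2, 3} {0, 2, 4, 6} :=
    r (swap 0 1 * swap 2 3 * swap 6 7) (swap 0 1) 1 (by decide)
  have h5 : standardSum ω x {0, 1, 2, 3} (insert 7 (Finset.image middle {0, 2, 4})) =
      (1 : ℤ) • standardSum ω x {0, 1, 2, 3} {0, 2, 4, 6} :=
    r (swap 0 1 * swap 2 3 * swap 4 5 * swap 6 7) (swap 0 1 * swap 2 3) 1 (by decide)
  have h6 : standardSum ω x {0, 1, 2, 3} (insert 7 (Finset.image middle {0, 3, 4})) =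
      (1 : ℤ) • standardSum ω x {0, 1, 2, 3} {0, 4, 5, 6} :=
    r (swap 0 1 * swap 6 7) 1 1 (by decide)
  rw [h1, h2, h3, h4, h5, h6]
  module

/-- The contribution of `r₃ ⊗ Δ(J)` for sets `J` of indices which contain `0`. By the same
symmetries only the sets `K` which contain `5` and not `0` contribute. -/
lemma sum_standardSum_zero (hx : Generic ω x) :
    ∑ K ∈ Finset.univ.powersetCard 3, standardSum ω x {0, 1, 2, 3} (insert 0 (K.image middle)) =
      standardSum ω x {0, 1, 2, 3} {0, 2, 3, 6} + standardSum ω x {0, 1, 2, 3} {0, 4, 5, 6} +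
        (4 : ℚ) • standardSum ω x {0, 1, 2, 3} {0, 2, 4, 6} := by
  have r := @standardSum_perm _ _ _ _ _ _ _ hx
  have hz : ∀ K ∈ (Finset.univ : Finset (Fin 6)).powersetCard 3,
      K ∉ ({{1, 2, 5}, {1, 3, 5}, {1, 4, 5}, {2, 3, 5}, {2, 4, 5}, {3, 4, 5}} :
        Finset (Finset (Fin 6))) →
      standardSum ω x {0, 1, 2, 3} (insert 0 (K.image middle)) = 0 := fun K hK hK' =>
    ratioSum_eq_zero hx (by revert K; decide)
  rw [← Finset.sum_subset (by decide) hz, Finset.sum_insert (by decide),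
    Finset.sum_insert (by decide), Finset.sum_insert (by decide), Finset.sum_insert (by decide),
    Finset.sum_insert (by decide), Finset.sum_singleton]
  have h1 : standardSum ω x {0, 1, 2, 3} (insert 0 (Finset.image middle {1, 2, 5})) =
      (1 : ℤ) • standardSum ω x {0, 1, 2, 3} {0, 2, 3, 6} :=
    r 1 1 1 (by decide)
  have h2 : standardSum ω x {0, 1, 2, 3} (insert 0 (Finset.image middle {1, 3, 5})) =
      (1 : ℤ) • standardSum ω x {0, 1, 2, 3} {0, 2, 4, 6} :=
    r 1 1 1 (by decide)
  have h3 : standardSum ω x {0, 1, 2, 3} (insert 0 (Finset.image middle {1, 4, 5})) =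
      (1 : ℤ) • standardSum ω x {0, 1, 2, 3} {0, 2, 4, 6} :=
    r (swap 4 5) (swap 2 3) 1 (by decide)
  have h4 : standardSum ω x {0, 1, 2, 3} (insert 0 (Finset.image middle {2, 3, 5})) =
      (1 : ℤ) • standardSum ω x {0, 1, 2, 3} {0, 2, 4, 6} :=
    r (swap 2 3) (swap 0 1) 1 (by decide)
  have h5 : standardSum ω x {0, 1, 2, 3} (insert 0 (Finset.image middle {2, 4, 5})) =
      (1 : ℤ) • standardSum ω x {0, 1, 2, 3} {0, 2, 4, 6} :=
    r (swap 2 3 * swap 4 5) (swap 0 1 * swap 2 3) 1 (by decide)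
  have h6 : standardSum ω x {0, 1, 2, 3} (insert 0 (Finset.image middle {3, 4, 5})) =
      (1 : ℤ) • standardSum ω x {0, 1, 2, 3} {0, 4, 5, 6} :=
    r 1 1 1 (by decide)
  rw [h1, h2, h3, h4, h5, h6]
  module

lemma sum_standardSum_ratio (hx : Generic ω x) :
    standardSum ω x {0, 1, 2, 4} {1, 3, 5, 7} + standardSum ω x {0, 1, 3, 5} {1, 3, 5, 7} -
      standardSum ω x {0, 1, 2, 5} {1, 3, 5, 7} - standardSum ω x {0, 1, 3, 4} {1, 3, 5, 7} +
      (standardSum ω x {0, 1, 2, 4} {0, 2, 4, 6} + standardSum ω x {0, 1, 3, 5} {0, 2, 4, 6} -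
      standardSum ω x {0, 1, 2, 5} {0, 2, 4, 6} - standardSum ω x {0, 1, 3, 4} {0, 2, 4, 6}) =
      (2 : ℚ) • standardSum ω x {0, 1, 2, 3} {0, 2, 3, 6} +
      (2 : ℚ) • standardSum ω x {0, 1, 2, 3} {0, 4, 5, 6} -
      (4 : ℚ) • standardSum ω x {0, 1, 2, 3} {0, 2, 4, 6} := by
  have r := @standardSum_perm _ _ _ _ _ _ _ hx
  have h1 : standardSum ω x {0, 1, 2, 4} {1, 3, 5, 7} =
      (1 : ℤ) • standardSum ω x {0, 1, 2, 3} {0, 4, 5, 6} :=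
    r (swap 0 1 * swap 3 4 * swap 6 7) (swap 1 2) 1 (by decide)
  have h2 : standardSum ω x {0, 1, 3, 5} {1, 3, 5, 7} =
      (1 : ℤ) • standardSum ω x {0, 1, 2, 3} {0, 2, 3, 6} :=
    r (swap 0 1 * swap 2 5 * swap 6 7) (swap 0 3) 1 (by decide)
  have h3 : standardSum ω x {0, 1, 2, 5} {1, 3, 5, 7} =
      (1 : ℤ) • standardSum ω x {0, 1, 2, 3} {0, 2, 4, 6} :=
    r (swap 0 1 * swap 2 5 * swap 5 4 * swap 4 3 * swap 6 7)
      (swap 0 1 * swap 1 2 * swap 2 3) 1 (by decide)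
  have h4 : standardSum ω x {0, 1, 3, 4} {1, 3, 5, 7} =
      (1 : ℤ) • standardSum ω x {0, 1, 2, 3} {0, 2, 4, 6} :=
    r (swap 0 1 * swap 2 3 * swap 3 4 * swap 4 5 * swap 6 7)
      (swap 0 3 * swap 3 2 * swap 2 1) 1 (by decide)
  have h5 : standardSum ω x {0, 1, 2, 4} {0, 2, 4, 6} =
      (1 : ℤ) • standardSum ω x {0, 1, 2, 3} {0, 2, 3, 6} :=
    r (swap 3 4) (swap 1 2) 1 (by decide)
  have h6 : standardSum ω x {0, 1, 3, 5} {0, 2, 4, 6} =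
      (1 : ℤ) • standardSum ω x {0, 1, 2, 3} {0, 4, 5, 6} :=
    r (swap 2 5) (swap 0 3) 1 (by decide)
  have h7 : standardSum ω x {0, 1, 2, 5} {0, 2, 4, 6} =
      (1 : ℤ) • standardSum ω x {0, 1, 2, 3} {0, 2, 4, 6} :=
    r (swap 3 5) (swap 1 3) 1 (by decide)
  have h8 : standardSum ω x {0, 1, 3, 4} {0, 2, 4, 6} =
      (1 : ℤ) • standardSum ω x {0, 1, 2, 3} {0, 2, 4, 6} :=
    r (swap 2 4) (swap 0 2) 1 (by decide)
  rw [h1, h2, h3, h4, h5, h6, h7, h8]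
  module

lemma sum_standardSum_logPair (hx : Generic ω x) :
    (standardSum ω x {2, 3, 1, 4} {2, 3, 4, 6} +
        standardSum ω x {2, 3, 4, 6} {2, 3, 1, 6} +
        standardSum ω x {2, 3, 1, 6} {2, 3, 1, 4}) -
      (standardSum ω x {2, 3, 0, 4} {2, 3, 4, 6} +
        standardSum ω x {2, 3, 4, 6} {2, 3, 0, 6} +
        standardSum ω x {2, 3, 0, 6} {2, 3, 0, 4}) +
      (standardSum ω x {2, 3, 0, 1} {2, 3, 1, 6} +
        standardSum ω x {2, 3, 1, 6} {2, 3, 0, 6} +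
        standardSum ω x {2, 3, 0, 6} {2, 3, 0, 1}) -
      (standardSum ω x {2, 3, 0, 1} {2, 3, 1, 4} +
        standardSum ω x {2, 3, 1, 4} {2, 3, 0, 4} +
        standardSum ω x {2, 3, 0, 4} {2, 3, 0, 1}) =
      (-2 : ℚ) • standardSum ω x {0, 2, 3, 4} {2, 3, 4, 6} +
      (2 : ℚ) • standardSum ω x {0, 2, 3, 6} {2, 3, 4, 6} +
      (2 : ℚ) • standardSum ω x {0, 2, 3, 4} {0, 2, 3, 6} -
      (2 : ℚ) • standardSum ω x {0, 1, 2, 3} {0, 2, 3, 6} -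
      standardSum ω x {0, 2, 3, 6} {1, 2, 3, 6} := by
  have r := @standardSum_perm _ _ _ _ _ _ _ hx
  have zero : ∀ I J : Finset (Fin 8), (0 ∈ I ↔ 1 ∈ I) ∧ (0 ∈ J ↔ 1 ∈ J) ∨
      (6 ∈ I ↔ 7 ∈ I) ∧ (6 ∈ J ↔ 7 ∈ J) → standardSum ω x I J = 0 :=
    fun I J h => ratioSum_eq_zero hx h
  have h1 : standardSum ω x {2, 3, 1, 4} {2, 3, 4, 6} =
      (-1 : ℤ) • standardSum ω x {0, 2, 3, 4} {2, 3, 4, 6} :=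
    r (swap 0 1) 1 (-1) (by decide)
  have h2 : standardSum ω x {2, 3, 4, 6} {2, 3, 1, 6} =
      (-1 : ℤ) • standardSum ω x {2, 3, 4, 6} {0, 2, 3, 6} :=
    r (swap 0 1) 1 (-1) (by decide)
  have h3 : standardSum ω x {2, 3, 1, 6} {2, 3, 1, 4} =
      (-1 : ℤ) • standardSum ω x {0, 2, 3, 6} {0, 2, 3, 4} :=
    r (swap 0 1) 1 (-1) (by decide)
  have h4 : standardSum ω x {2, 3, 0, 4} {2, 3, 4, 6} =
      (1 : ℤ) • standardSum ω x {0, 2, 3, 4} {2, 3, 4, 6} :=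
    r 1 1 1 (by decide)
  have h5 : standardSum ω x {2, 3, 4, 6} {2, 3, 0, 6} =
      (1 : ℤ) • standardSum ω x {2, 3, 4, 6} {0, 2, 3, 6} :=
    r 1 1 1 (by decide)
  have h6 : standardSum ω x {2, 3, 0, 6} {2, 3, 0, 4} =
      (1 : ℤ) • standardSum ω x {0, 2, 3, 6} {0, 2, 3, 4} :=
    r 1 1 1 (by decide)
  have h7 : standardSum ω x {2, 3, 0, 1} {2, 3, 1, 6} =
      (-1 : ℤ) • standardSum ω x {0, 1, 2, 3} {0, 2, 3, 6} :=
    r (swap 0 1) 1 (-1) (by decide)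
  have h8 : standardSum ω x {2, 3, 1, 6} {2, 3, 0, 6} =
      (-1 : ℤ) • standardSum ω x {0, 2, 3, 6} {1, 2, 3, 6} :=
    r (swap 0 1) 1 (-1) (by decide)
  have h9 : standardSum ω x {2, 3, 0, 6} {2, 3, 0, 1} =
      (1 : ℤ) • standardSum ω x {0, 2, 3, 6} {0, 1, 2, 3} :=
    r 1 1 1 (by decide)
  have h10 : standardSum ω x {2, 3, 0, 1} {2, 3, 1, 4} = 0 := zero _ _ (by decide)
  have h11 : standardSum ω x {2, 3, 1, 4} {2, 3, 0, 4} = 0 := zero _ _ (by decide)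
  have h12 : standardSum ω x {2, 3, 0, 4} {2, 3, 0, 1} = 0 := zero _ _ (by decide)
  have s1 : standardSum ω x {2, 3, 4, 6} {0, 2, 3, 6} =
      -standardSum ω x {0, 2, 3, 6} {2, 3, 4, 6} :=
    standardSum_symm
  have s2 : standardSum ω x {0, 2, 3, 6} {0, 2, 3, 4} =
      -standardSum ω x {0, 2, 3, 4} {0, 2, 3, 6} :=
    standardSum_symm
  have s3 : standardSum ω x {0, 2, 3, 6} {0, 1, 2, 3} =
      -standardSum ω x {0, 1, 2, 3} {0, 2, 3, 6} :=
    standardSum_symm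
  linear_combination (norm := module) h1 + h2 + h3 - h4 - h5 - h6 + h7 + h8 + h9 - h10 - h11 - h12 -
    (2 : ℚ) • s1 - (2 : ℚ) • s2 + s3

lemma altSum_relabel_neg {T X : Type*} [AddCommGroup T] [Module ℚ T] {m : ℕ}
    [MulAction (Perm (Fin m)) X] (f : X → T) (τ : Perm (Fin m)) {x y : X} (h : τ • x = y)
    (hs : Perm.sign τ = -1) : altSum m f y = -altSum m f x := by
  rw [altSum_relabel f τ h, sgn_eq τ hs, Units.val_neg, Units.val_one, Int.cast_neg, Int.cast_one,
    neg_one_smul]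

lemma unitClass_curryLeft_curryLeft (ω : V [⋀^Fin 4]→ₗ[F] F) (x : Fin 8 → V) (σ : Perm (Fin 8))
    (i j a b : Fin 8) (h : Function.Injective ![i, j, a, b]) :
    unitClass (((ω.curryLeft (x (σ i))).curryLeft (x (σ j))) ![x (σ a), x (σ b)]) =
      vol ω x (σ • {i, j, a, b}) := by
  have h1 := vol_image ω x (σ.injective.comp h)
  rw [← Finset.image_image] at h1
  have himg : Finset.univ.image ![i, j, a, b] = {i, j, a, b} := by
    ext c
    simp [Fin.exists_fin_succ, eq_comm]
  rw [himg] at h1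
  change vol ω x (σ • {i, j, a, b}) = _ at h1
  rw [h1]
  change unitClass (ω ![x (σ i), x (σ j), x (σ a), x (σ b)]) = _
  congr 2
  funext c
  fin_cases c <;> rfl

/-- A cross-ratio is a quotient of products of two determinants. -/
lemma differential_altSum_ratioVol (hx : Generic ω x) (U : Finset (Fin 8)) :
    differential F (altSum 8 (ratioVol ω x) (![0, 1, 2, 3, 4, 5], U), 0) =
      standardSum ω x {0, 1, 2, 4} U + standardSum ω x {0, 1, 3, 5} U -
        standardSum ω x {0, 1, 2, 5} U - standardSum ω x {0, 1, 3, 4} U := by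
  rw [differential_inl, map_altSum]
  simp only [standardSum, ratioSum, altSum, ← Finset.sum_add_distrib, ← Finset.sum_sub_distrib,
    ← smul_add, ← smul_sub]
  refine Finset.sum_congr rfl fun σ _ => congrArg (fun t => sgn σ • t) ?_
  have hg := hx.projRatio₂ (k := 4) (e := σ • ![0, 1, 2, 3, 4, 5]) (σ.injective.comp (by decide))
    (by decide)
  have hu : unitClass (projRatio ω x (σ • ![0, 1, 2, 3, 4, 5])) = vol ω x (σ • {0, 1, 2, 4}) +
      vol ω x (σ • {0, 1, 3, 5}) - vol ω x (σ • {0, 1, 2, 5}) - vol ω x (σ • {0, 1, 3, 4}) := by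
    rw [← unitClass_curryLeft_curryLeft ω x σ 0 1 2 4 (by decide),
      ← unitClass_curryLeft_curryLeft ω x σ 0 1 3 5 (by decide),
      ← unitClass_curryLeft_curryLeft ω x σ 0 1 2 5 (by decide),
      ← unitClass_curryLeft_curryLeft ω x σ 0 1 3 4 (by decide)]
    exact unitClass_crossRatio hg
  simp only [Prod.smul_mk, ratioVolWedge, ratioVol, LinearMap.comp_apply, TensorProduct.map_tmul,
    LinearMap.id_apply, trilogDifferential_sym3, tmulWedge_tmul, hu,
    TensorProduct.tmul_add, TensorProduct.tmul_sub, TensorProduct.add_tmul, TensorProduct.sub_tmul,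
    map_add, map_sub]

/-- The differential of `{r(x₂, x₃ | x₀, x₁, x₄, x₆)}₂`. -/
lemma logPair_projRatio (hx : Generic ω x) (σ : Perm (Fin 8)) (W : Fin 8 → Fin 8 → MultQ F)
    (hW : ∀ a b, W a b = vol ω x (σ • {2, 3, a, b})) :
    logPair (projRatio ω x (σ • ![2, 3, 0, 1, 4, 6])) =
      (wedge (W 1 4) (W 4 6) + wedge (W 4 6) (W 1 6) + wedge (W 1 6) (W 1 4)) -
      (wedge (W 0 4) (W 4 6) + wedge (W 4 6) (W 0 6) + wedge (W 0 6) (W 0 4)) +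
      (wedge (W 0 1) (W 1 6) + wedge (W 1 6) (W 0 6) + wedge (W 0 6) (W 0 1)) -
      (wedge (W 0 1) (W 1 4) + wedge (W 1 4) (W 0 4) + wedge (W 0 4) (W 0 1)) := by
  have hg := hx.projRatio₂ (k := 4) (e := σ • ![2, 3, 0, 1, 4, 6]) (σ.injective.comp (by decide))
    (by decide)
  have hu : ∀ a b : Fin 8, Function.Injective ![2, 3, a, b] → W a b = unitClass
      (((ω.curryLeft (x (σ 2))).curryLeft (x (σ 3))) ![x (σ a), x (σ b)]) := fun a b h => by
    rw [hW, unitClass_curryLeft_curryLeft ω x σ 2 3 a b h]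
  rw [hu 1 4 (by decide), hu 4 6 (by decide), hu 1 6 (by decide), hu 0 4 (by decide),
    hu 0 6 (by decide), hu 0 1 (by decide)]
  exact logPair_crossRatio hg

/-- The involution `0 ↔ 2, 1 ↔ 3, 5 ↔ 6` exchanges the two factors. -/
lemma differential_altSum_ratioWedge (ω : V [⋀^Fin 4]→ₗ[F] F) (x : Fin 8 → V) :
    differential F (0, altSum 8 (ratioWedge ω x) (![0, 1, 2, 3, 4, 5], ![2, 3, 0, 1, 4, 6])) =
      (-2 : ℚ) • altSum 8 (fun p => sym2 (projRatio ω x p.1) ⊗ₜ logPair (projRatio ω x p.2))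
        (![0, 1, 2, 3, 4, 5], ![2, 3, 0, 1, 4, 6]) := by
  let f : (Fin 6 → Fin 8) × (Fin 6 → Fin 8) → B2 F ⊗[ℚ] ⋀[ℚ]^2 (MultQ F) := fun p =>
    sym2 (projRatio ω x p.1) ⊗ₜ logPair (projRatio ω x p.2)
  have h1 : differential F
      (0, altSum 8 (ratioWedge ω x) (![0, 1, 2, 3, 4, 5], ![2, 3, 0, 1, 4, 6])) =
      altSum 8 f (![2, 3, 0, 1, 4, 6], ![0, 1, 2, 3, 4, 5]) -
        altSum 8 f (![0, 1, 2, 3, 4, 5], ![2, 3, 0, 1, 4, 6]) := by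
    rw [differential, LinearMap.coprod_apply, map_zero, zero_add, map_altSum]
    simp only [altSum, ← Finset.sum_sub_distrib, ← smul_sub]
    refine Finset.sum_congr rfl fun σ _ => congrArg (fun t => sgn σ • t) ?_
    simp only [Prod.smul_mk, ratioWedge, wedgeDifferential_wedge, blochDifferential_sym2, f]
  have h2 : altSum 8 f (![2, 3, 0, 1, 4, 6], ![0, 1, 2, 3, 4, 5]) =
      -altSum 8 f (![0, 1, 2, 3, 4, 5], ![2, 3, 0, 1, 4, 6]) :=
    altSum_relabel_neg f
      ⟨![2, 3, 0, 1, 4, 6, 5, 7], ![2, 3, 0, 1, 4, 6, 5, 7], by decide, by decide⟩ (by decide)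
      (by decide)
  rw [h1, h2]
  module

lemma altSum_sym2_logPair (hx : Generic ω x) :
    altSum 8 (fun p => sym2 (projRatio ω x p.1) ⊗ₜ logPair (projRatio ω x p.2))
        ((![0, 1, 2, 3, 4, 5], ![2, 3, 0, 1, 4, 6]) : (Fin 6 → Fin 8) × (Fin 6 → Fin 8)) =
      (-2 : ℚ) • standardSum ω x {0, 2, 3, 4} {2, 3, 4, 6} +
      (2 : ℚ) • standardSum ω x {0, 2, 3, 6} {2, 3, 4, 6} +
      (2 : ℚ) • standardSum ω x {0, 2, 3, 4} {0, 2, 3, 6} -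
      (2 : ℚ) • standardSum ω x {0, 1, 2, 3} {0, 2, 3, 6} -
      standardSum ω x {0, 2, 3, 6} {1, 2, 3, 6} := by
  rw [← sum_standardSum_logPair hx]
  simp only [standardSum, ratioSum, altSum, ← Finset.sum_add_distrib, ← Finset.sum_sub_distrib,
    ← smul_add, ← smul_sub]
  refine Finset.sum_congr rfl fun σ _ => congrArg (fun t => sgn σ • t) ?_
  simp only [Prod.smul_mk, logPair_projRatio hx σ _ fun _ _ => rfl, ratioVolWedge,
    TensorProduct.tmul_add, TensorProduct.tmul_sub]

/-- `d ∘ δ = 0`: all components are sums `standardSum`, and the relations between them eliminate the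
sums which occur. -/
lemma differential_cobracket {ω : (Fin 4 → F) [⋀^Fin 4]→ₗ[F] F} {x : Fin 8 → (Fin 4 → F)}
    (hx : Generic ω x) : differential F (cobracket ω x) = 0 := by
  obtain ⟨p2, p15, p13, p34, p6⟩ := standardSum_relations hx
  -- relabelling, such that the cross-ratios and `r₃` have the first indices as arguments
  have a1 := altSum_relabel_neg (m := 8) (r3Vol ω x)
    ⟨![0, 1, 2, 3, 5, 6, 7, 4], ![0, 1, 2, 3, 7, 4, 5, 6], by decide, by decide⟩
    (x := (![0, 1, 2, 3, 4, 5, 6], insert 7 (({3, 4, 5} : Finset (Fin 6)).image middle)))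
    (y := (![0, 1, 2, 3, 5, 6, 7], {4, 5, 6, 7})) (by decide) (by decide)
  have a2 := altSum_relabel_neg (m := 8) (r3Vol ω x)
    ⟨![0, 1, 2, 3, 5, 6, 7, 4], ![0, 1, 2, 3, 7, 4, 5, 6], by decide, by decide⟩
    (x := (![0, 1, 2, 3, 4, 5, 6], insert 0 (({0, 1, 2} : Finset (Fin 6)).image middle)))
    (y := (![0, 1, 2, 3, 5, 6, 7], {0, 1, 2, 3})) (by decide) (by decide)
  have b1 := altSum_relabel_neg (m := 8) (ratioVol ω x)
    ⟨![0, 4, 1, 6, 2, 5, 3, 7], ![0, 2, 4, 6, 1, 5, 3, 7], by decide, by decide⟩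
    (x := (![0, 1, 2, 3, 4, 5], {1, 3, 5, 7})) (y := (![0, 4, 1, 6, 2, 5], {4, 5, 6, 7}))
    (by decide) (by decide)
  have b2 := altSum_relabel_neg (m := 8) (ratioVol ω x)
    ⟨![0, 4, 1, 6, 2, 5, 3, 7], ![0, 2, 4, 6, 1, 5, 3, 7], by decide, by decide⟩
    (x := (![0, 1, 2, 3, 4, 5], {0, 2, 4, 6})) (y := (![0, 4, 1, 6, 2, 5], {0, 1, 2, 3}))
    (by decide) (by decide)
  have hsplit : cobracket ω x = (-8 / 3 : ℚ) •
      (((altSum 8 (r3Vol ω x) (![0, 1, 2, 3, 4, 5, 6],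
        insert 7 (({3, 4, 5} : Finset (Fin 6)).image middle)), 0) : Target F) +
      (altSum 8 (r3Vol ω x) (![0, 1, 2, 3, 4, 5, 6],
        insert 0 (({0, 1, 2} : Finset (Fin 6)).image middle)), 0)) +
      (96 : ℚ) • ((altSum 8 (ratioVol ω x) (![0, 1, 2, 3, 4, 5], {1, 3, 5, 7}), 0) +
        (altSum 8 (ratioVol ω x) (![0, 1, 2, 3, 4, 5], {0, 2, 4, 6}), 0)) +
      (-144 / 7 : ℚ) •
        (0, altSum 8 (ratioWedge ω x) (![0, 1, 2, 3, 4, 5], ![2, 3, 0, 1, 4, 6])) := by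
    rw [cobracket, cobracket31, a1, a2, b1, b2]
    ext
    · simp only [Prod.fst_add, Prod.smul_fst]
      module
    · simp only [Prod.snd_add, Prod.smul_snd, add_zero, smul_zero, zero_add]
  rw [hsplit, map_add, map_add, map_smul, map_smul, map_smul, map_add, map_add,
    differential_altSum_r3Vol hx _ (by decide) 7 (by decide),
    differential_altSum_r3Vol hx _ (by decide) 0 (by decide),
    differential_altSum_ratioVol hx, differential_altSum_ratioVol hx,
    differential_altSum_ratioWedge, sum_standardSum_seven hx, sum_standardSum_zero hx]
  linear_combination (norm := module) (96 : ℚ) • sum_standardSum_ratio hx +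
    (288 / 7 : ℚ) • altSum_sym2_logPair hx + (288 : ℚ) • p2 + (288 / 7 : ℚ) • p15 +
    (384 / 7 : ℚ) • p13 + (192 / 7 : ℚ) • p34 - (288 / 7 : ℚ) • p6

end EightPoints

end Tetralog

/-- There is a (necessarily unique) homomorphism `δ` on `G̃₄(F)` given on every generator by the
formula for `(δ₃,₁, δ₁,₃, δ₂,₂)`, for all choices of a volume form and of vectors which represent
the points; and there is a (necessarily unique) linear map `d` given by the formulas for the next
differential, and `d ∘ δ = 0`. -/
theorem mainTheorem4 (F : Type*) [Field F] :
    ∃ δ : Tetralog.G4 F →+ Tetralog.Target F,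
      (∀ (c : Tetralog.Conf F 4 8) (v : Fin 8 → (Fin 4 → F))
          (ω : (Fin 4 → F) [⋀^Fin 4]→ₗ[F] F), ω ≠ 0 →
          (∀ j, ∃ h : v j ≠ 0, c.1 j = Projectivization.mk F (v j) h) →
          δ (Tetralog.G4.mk c) =
            Tetralog.throughA3 (Tetralog.delta31 ω v c) (Tetralog.delta13 ω v c)
              (Tetralog.delta22 ω v)) ∧
      ∃ d : Tetralog.Target F →ₗ[ℚ]
          TensorProduct ℚ (Tetralog.B2 F) (⋀[ℚ]^2 (Tetralog.MultQ F)),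
        (∀ x y : F, x ≠ 0 → y ≠ 0 →
          d (TensorProduct.tmul ℚ (Tetralog.sym3 x) (Tetralog.unitClass y), 0) =
            TensorProduct.tmul ℚ (Tetralog.sym2 x)
              (Tetralog.wedge (Tetralog.unitClass x) (Tetralog.unitClass y))) ∧
        (∀ x y : F, x ≠ 0 → x ≠ 1 → y ≠ 0 → y ≠ 1 →
          d (0, Tetralog.wedge (Tetralog.sym2 x) (Tetralog.sym2 y)) =
            TensorProduct.tmul ℚ (Tetralog.sym2 y)
                (Tetralog.wedge (Tetralog.unitClass (1 - x)) (Tetralog.unitClass x)) -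
              TensorProduct.tmul ℚ (Tetralog.sym2 x)
                (Tetralog.wedge (Tetralog.unitClass (1 - y)) (Tetralog.unitClass y))) ∧
        ∀ g : Tetralog.G4 F, d (δ g) = 0 := by
  obtain ⟨δ, hδ⟩ := Tetralog.exists_cobracket F
  refine ⟨δ, fun c v ω hω hv => (hδ c).trans (Tetralog.throughA3_delta_eq c v ω hω hv).symm,
    Tetralog.differential F, fun x y _ _ => Tetralog.differential_sym3_tmul x _,
    fun x y _ _ _ _ => Tetralog.differential_wedge x y, fun g => ?_⟩
  obtain ⟨f, rfl⟩ := (Tetralog.relG4 F).mkQ_surjective g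
  induction f using Finsupp.induction_linear with
  | zero => simp only [map_zero]
  | add f g hf hg => simp only [map_add, hf, hg, add_zero]
  | single c n =>
    have h : (Tetralog.relG4 F).mkQ (Finsupp.single c n) = n • Tetralog.G4.mk c := by
      rw [Tetralog.G4.mk, ← map_smul, Finsupp.smul_single, smul_eq_mul, mul_one]
    rw [h, map_zsmul, map_zsmul, hδ c]
    exact (congrArg (n • ·) (Tetralog.differential_cobracket c.generic)).trans (smul_zero n)
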